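/- Let $\mathbb{K}$ be a field and let $\mathcal{A}$ be a central arrangement in $V=\mathbb{K}^\ell$, that is, a finite set of linear hyperplanes of $V$, and let $H\in\mathcal{A}$. Write $\mathcal{A}'=\mathcal{A}\setminus\{H\}$ for the deletion and $\mathcal{A}^H=\{L\cap H\mid L\in\mathcal{A}'\}$ for the restriction, which is an arrangement in the vector space $H$. For a central arrangement $\mathcal{B}$ in a finite-dimensional $\mathbb{K}$-vector space $W$, let $L(\mathcal{B})$ be the set of all intersections of members of $\mathcal{B}$ (including $W$, the empty intersection). Define $\mu$ on $L(\mathcal{B})$ by $\mu(W)=1$ and $\mu(X)=-\sum_{Y\in L(\mathcal{B}),\,X\subsetneq Y}\mu(Y)$ for $X\neq W$. Put $\chi(\mathcal{B};t)=\sum_{X\in L(\mathcal{B})}\mu(X)t^{\dim X}$ and $\chi_0(\mathcal{B};t)=\chi(\mathcal{B};t)/(t-1)$ (if $\mathcal{B}=\emptyset$, this means the quotient in the division with remainder). Let $S=\operatorname{Sym}(W^*)$. For each $L\in\mathcal{B}$ let $\alpha_L\in W^*$ be a linear form with kernel $L$. The arrangement $\mathcal{B}$ is called free if $D(\mathcal{B})=\{\theta\in\operatorname{Der}_{\mathbb{K}}(S)\mid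 \theta(\alpha_L)\in S\alpha_L\text{ for all }L\in\mathcal{B}\}$ is a free $S$-module with a basis of $\dim W$ homogeneous derivations. (1) Assume that $\mathcal{A}$ and $\mathcal{A}^H$ are free with $\chi_0(\mathcal{A};t)=\prod_{i=2}^{\ell}(t-d_i)$ and $\chi_0(\mathcal{A}^H;t)=\prod_{i=2}^{\ell-1}(t-e_i)$, where $d_i,e_i$ are integers with $1\le d_2\le\cdots\le d_\ell$ and $1\le e_2\le\cdots\le e_{\ell-1}$. Then either $\chi(\mathcal{A}^H;t)$ divides $\chi(\mathcal{A};t)$ in $\mathbb{Z}[t]$, or $d_2\ge e_2$ and $d_i\ge e_{i-1}$ for all $3\le i\le\ell$. (For $\ell\le 2$, where $e_2$ does not exist, the first alternative holds.) (2) Assume that $\mathcal{A}'$ and $\mathcal{A}^H$ are free with $\chi_0(\mathcal{A}';t)=\prod_{i=2}^{\ell}(t-d_i)$ and $\chi_0(\mathcal{A}^H;t)=\prod_{i=2}^{\ell-1}(t-e_i)$, where $d_i,e_i$ are integers with $1\le d_2\le\cdots\le d_\ell$ and $1\le e_2\le\cdots\le e_{\ell-1}$. Then $d_i\le e_i$ for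 $i=2,\ldots,\ell-1$. -/

import Mathlib

open scoped Polynomial

noncomputable section

/-- A central arrangement in the `K`-vector space `V`: a finite set of linear hyperplanes,
each being the kernel of a nonzero linear form. -/
structure HypArr (K V : Type*) [Field K] [AddCommGroup V] [Module K V] where
  carrier : Set (Submodule K V)
  finite : carrier.Finite
  hyperplane : ∀ H ∈ carrier, ∃ α : Module.Dual K V, α ≠ 0 ∧ H = LinearMap.ker α

namespace HypArr

variable {K V : Type*} [Field K] [AddCommGroup V] [Module K V]

/-- The deletion `A' = A \ {H}`. -/
def deletion (A : HypArr K V) (H : Submodule K V) : HypArr K V where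
  carrier := A.carrier \ {H}
  finite := A.finite.sdiff
  hyperplane := fun L hL => A.hyperplane L hL.1

/-- The restriction `A^H = {L ∩ H | L ∈ A \ {H}}` for `H ∈ A`, an arrangement in the vector
space `H`. -/
def restriction (A : HypArr K V) (H : Submodule K V) (hH : H ∈ A.carrier) : HypArr K H where
  carrier := (fun L : Submodule K V => L.comap H.subtype) '' (A.carrier \ {H})
  finite := A.finite.sdiff.image _
  hyperplane := by
    rintro _ ⟨L, ⟨hL, hLH⟩, rfl⟩
    obtain ⟨α, hα, rfl⟩ := A.hyperplane L hL
    obtain ⟨β, hβ, rfl⟩ := A.hyperplane H hH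
    refine ⟨α.comp (LinearMap.ker β).subtype, fun h0 => hLH ?_, ?_⟩
    · have hle : LinearMap.ker β ≤ LinearMap.ker α := fun x hx =>
        LinearMap.congr_fun h0 ⟨x, hx⟩
      have hco : IsCoatom (LinearMap.ker β) := LinearMap.isCoatom_ker_of_surjective
        (LinearMap.surjective hβ)
      rcases hco.le_iff.1 hle with h | h
      · exact absurd (LinearMap.ker_eq_top.1 h) hα
      · exact h
    · rw [LinearMap.ker_comp]

/-- The intersection lattice `L(A) = {⋂_{L ∈ B} L | B ⊆ A}`; the empty intersection is `V`. -/
def lattice (A : HypArr K V) : Set (Submodule K V) := sInf '' (𝒫 A.carrier)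

theorem lattice_finite (A : HypArr K V) : A.lattice.Finite :=
  A.finite.finite_subsets.image _

/-- `L(A)` as a finset. -/
def flats (A : HypArr K V) : Finset (Submodule K V) := A.lattice_finite.toFinset

open Classical in
/-- The Möbius function of `L(A)` ordered by reverse inclusion: `μ(V) = 1` and
`μ(X) = - ∑_{X ⊊ Y ⊆ V} μ(Y)`, the sum running over `Y ∈ L(A)`. -/
def moebius [FiniteDimensional K V] (A : HypArr K V) (X : Submodule K V) : ℤ :=
  if X = ⊤ then 1
  else - ∑ Y ∈ (A.flats.filter (fun Y => X < Y)).attach, A.moebius Y.1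
termination_by Module.finrank K V - Module.finrank K X
decreasing_by
  have h : X < Y.1 := (Finset.mem_filter.1 Y.2).2
  have h1 := Submodule.finrank_lt_finrank_of_lt h
  have h2 := Submodule.finrank_le Y.1
  omega

/-- The characteristic polynomial `χ(A; t) = ∑_{X ∈ L(A)} μ(X) t^{dim X}`. -/
def charPoly [FiniteDimensional K V] (A : HypArr K V) : ℤ[X] :=
  ∑ X ∈ A.flats, Polynomial.C (A.moebius X) * Polynomial.X ^ Module.finrank K X

/-- The quotient `χ₀(A; t) = χ(A; t) / (t - 1)` by the monic polynomial `t - 1`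
(the division is exact for nonempty `A`). -/
def charPoly₀ [FiniteDimensional K V] (A : HypArr K V) : ℤ[X] :=
  A.charPoly /ₘ (Polynomial.X - Polynomial.C 1)

variable (K V) in
/-- The coordinate ring `S = Sym(V^*)` of `V`. -/
abbrev CoordRing : Type _ := SymmetricAlgebra K (Module.Dual K V)

variable (K V) in
/-- The homogeneous part of degree `n` of `S`: the span of all products of `n` linear forms. -/
def homogeneousPart (n : ℕ) : Submodule K (CoordRing K V) :=
  LinearMap.range (SymmetricAlgebra.ι K (Module.Dual K V)) ^ n

/-- The logarithmic derivation module
`D(A) = {θ ∈ Der_K(S) | θ(α_H) ∈ S α_H for all H ∈ A}`. The condition on `H` does not depend on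
the choice of the linear form `α_H` with kernel `H`. -/
def logDer (A : HypArr K V) :
    Submodule (CoordRing K V) (Derivation K (CoordRing K V) (CoordRing K V)) where
  carrier := {θ | ∀ H ∈ A.carrier, ∀ α : Module.Dual K V, LinearMap.ker α = H →
    θ (SymmetricAlgebra.ι K _ α) ∈ Ideal.span {SymmetricAlgebra.ι K (Module.Dual K V) α}}
  add_mem' := fun h1 h2 H hH α hα => Ideal.add_mem _ (h1 H hH α hα) (h2 H hH α hα)
  zero_mem' := fun _ _ _ _ => Ideal.zero_mem _
  smul_mem' := fun c _ h H hH α hα => Ideal.mul_mem_left _ c (h H hH α hα)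

/-- `θ` is homogeneous of (polynomial) degree `n`: it maps linear forms to forms of degree `n`. -/
def IsHomogeneousDer (θ : Derivation K (CoordRing K V) (CoordRing K V)) (n : ℕ) : Prop :=
  ∀ α : Module.Dual K V, θ (SymmetricAlgebra.ι K _ α) ∈ homogeneousPart K V n

/-- `A` is free with exponents `m`: `D(A)` is a free `S`-module with a homogeneous basis
`θ₁, …, θ_ℓ`, `ℓ = dim V`, such that `deg θᵢ = mᵢ`. -/
def IsFreeWithExp (A : HypArr K V) (m : Fin (Module.finrank K V) → ℕ) : Prop :=
  ∃ θ : Module.Basis (Fin (Module.finrank K V)) (CoordRing K V) A.logDer,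
    ∀ i, IsHomogeneousDer (θ i : Derivation K (CoordRing K V) (CoordRing K V)) (m i)

/-- `A` is free. -/
def IsFree (A : HypArr K V) : Prop := ∃ m, A.IsFreeWithExp m

end HypArr

end

/-!
The proof compares exponents. In coordinates, a free arrangement has a basis of logarithmic vector
fields that is homogeneous of degrees `m j`. By Saito's criterion (`IsLogBasis.det_eq`) its
determinant is the product of the forms up to a constant, so the `m j` add up to the number of
hyperplanes; by Terao's factorization theorem (`whitneyPoly_eq_prod`) the `m j` are the roots of the
characteristic polynomial. So for a nonempty arrangement the integers of the statement, together with
`1`, are the exponents (`HypArr.IsDefining.exponents_eq`).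

Terao's theorem is proved by counting over finite fields. Since the basis, the forms and
certificates for the ranks of all subfamilies are defined over a finitely generated ring, they can be
reduced to finite fields of arbitrarily large order `q`. By Whitney's formula the value of the
characteristic polynomial at `q` is the number of points of the complement of the arrangement. On
the other hand, the vector field `∑ (X i ^ q - X i) ∂ᵢ` is logarithmic, and the points of the
complement are the common zeros of its coefficients with respect to the basis, which have degrees
`q - m j` and define a reduced complete intersection without points at infinity. So by Bézout's
theorem (`card_fiber`) there are `∏ (q - m j)` of them (`card_complement`).

The comparison takes place on the hyperplane `H`, in coordinates `X 0 = 0`.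
* If the deletion is free, the restrictions of its basis fields to `H` stay independent, and every
  logarithmic field of the restriction is a combination of them (`IsRestriction.cons_zero_mem_span`).
  Comparing the numbers of fields of small degree gives `d i ≤ e i` (`IsRestriction.deletion_le`).
* If the whole arrangement is free, its basis fields restrict to logarithmic fields of the
  restriction and have full rank there, which gives `e (i - 1) ≤ d i` for `3 ≤ i`
  (`IsRestriction.restriction_le`). If moreover `d 2 < e 2`, then the first two basis fields restrict
  to multiples of one field; a combination of them is `X 0` times a logarithmic field of the deletion
  that is not tangent to `H`, and the degree of such a field is at least the number of hyperplanes
  that are lost under restriction (`IsRestriction.card_le_of_lt`). As the exponents add up to the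
  numbers of hyperplanes, this forces `e (i - 1) = d i` for `3 ≤ i`, and the characteristic
  polynomial of the restriction divides that of the arrangement.
-/

noncomputable section

/-! ### Counting exponents of bounded weighted degree -/

/-- The exponent vectors `a` whose weighted degree `∑ a j * d j` is at most `N`; for positive
weights `d` the box in which they are searched is no restriction. -/
def expLE {σ : Type*} [Fintype σ] [DecidableEq σ] (d : σ → ℕ) (N : ℕ) : Finset (σ → ℕ) :=
  (Fintype.piFinset fun _ => Finset.range (N + 1)).filter fun a => ∑ j, a j * d j ≤ N

section Counting

variable {σ : Type*} [Fintype σ] [DecidableEq σ]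

theorem mem_expLE {d : σ → ℕ} (hd : ∀ j, 1 ≤ d j) {N : ℕ} {a : σ → ℕ} :
    a ∈ expLE d N ↔ ∑ j, a j * d j ≤ N := by
  simp only [expLE, Finset.mem_filter, Fintype.mem_piFinset, Finset.mem_range, and_iff_right_iff_imp]
  intro h j
  have h1 : a j * d j ≤ ∑ j, a j * d j :=
    Finset.single_le_sum (f := fun j => a j * d j) (fun _ _ => Nat.zero_le _) (Finset.mem_univ j)
  have h2 : a j * 1 ≤ a j * d j := Nat.mul_le_mul_left _ (hd j)
  omega

theorem expLE_mono {d : σ → ℕ} (hd : ∀ j, 1 ≤ d j) {M N : ℕ} (h : M ≤ N) :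
    expLE d M ⊆ expLE d N := fun a ha => by
  rw [mem_expLE hd] at ha ⊢; omega

/-- Dividing exponents by the weights with remainder is injective. -/
theorem card_expLE_one_le (d : σ → ℕ) (hd : ∀ j, 1 ≤ d j) (N : ℕ) :
    (expLE (fun _ : σ => 1) N).card ≤ (∏ j, d j) * (expLE d N).card := by
  have hc : ((Fintype.piFinset fun j => Finset.range (d j)) ×ˢ expLE d N).card =
      (∏ j, d j) * (expLE d N).card := by simp [Finset.card_product]
  rw [← hc]
  refine Finset.card_le_card_of_injOn (fun b => (fun j => b j % d j, fun j => b j / d j)) ?_ ?_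
  · intro b hb
    rw [Finset.mem_coe, mem_expLE (fun _ => le_rfl)] at hb
    simp only [Finset.coe_product, Set.mem_prod, Finset.mem_coe, Fintype.mem_piFinset,
      Finset.mem_range, mem_expLE hd]
    refine ⟨fun j => Nat.mod_lt _ (hd j), le_trans (Finset.sum_le_sum fun j _ => ?_) hb⟩
    simpa using Nat.div_mul_le_self (b j) (d j)
  · intro b _ b' _ h
    rw [Prod.mk.injEq] at h
    funext j
    rw [← Nat.div_add_mod (b j) (d j), ← Nat.div_add_mod (b' j) (d j), congrFun h.1 j,
      congrFun h.2 j]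

/-- The same division with remainder, read backwards: all pairs of a quotient and a remainder occur. -/
theorem prod_mul_card_expLE_le (d : σ → ℕ) (hd : ∀ j, 1 ≤ d j) (N : ℕ) :
    (∏ j, d j) * (expLE d N).card ≤ (expLE (fun _ : σ => 1) (N + ∑ j, d j)).card := by
  have hc : ((Fintype.piFinset fun j => Finset.range (d j)) ×ˢ expLE d N).card =
      (∏ j, d j) * (expLE d N).card := by simp [Finset.card_product]
  rw [← hc]
  refine Finset.card_le_card_of_injOn (fun x => fun j => x.2 j * d j + x.1 j) ?_ ?_
  · rintro ⟨r, a⟩ hx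
    simp only [Finset.coe_product, Set.mem_prod, Finset.mem_coe, Fintype.mem_piFinset,
      Finset.mem_range, mem_expLE hd] at hx
    rw [Finset.mem_coe, mem_expLE (fun _ => le_rfl)]
    simp only [mul_one, Finset.sum_add_distrib]
    exact add_le_add hx.2 (Finset.sum_le_sum fun j _ => (hx.1 j).le)
  · rintro ⟨r, a⟩ hx ⟨r', a'⟩ hx' h
    simp only [Finset.coe_product, Set.mem_prod, Finset.mem_coe, Fintype.mem_piFinset,
      Finset.mem_range] at hx hx'
    have key : ∀ j, a j = a' j ∧ r j = r' j := fun j => by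
      have h1 : a j * d j + r j = a' j * d j + r' j := congrFun h j
      have hq : (a j * d j + r j) / d j = a j := by
        rw [add_comm, Nat.add_mul_div_right _ _ (hd j), Nat.div_eq_of_lt (hx.1 j), zero_add]
      have hq' : (a' j * d j + r' j) / d j = a' j := by
        rw [add_comm, Nat.add_mul_div_right _ _ (hd j), Nat.div_eq_of_lt (hx'.1 j), zero_add]
      have h2 : a j = a' j := by rw [← hq, h1, hq']
      rw [h2] at h1
      exact ⟨h2, by omega⟩
    exact Prod.ext (funext fun j => (key j).2) (funext fun j => (key j).1)

/-- The number of exponents of degree at most `N` grows polynomially, so that a shift of `N` cannot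
make up for a constant factor. -/
theorem le_of_mul_card_expLE_le {A B c : ℕ}
    (h : ∀ N, A * (expLE (fun _ : σ => 1) N).card ≤ B * (expLE (fun _ : σ => 1) (N + c)).card) :
    A ≤ B := by
  by_contra! hAB
  have hpos : ∀ N, 1 ≤ (expLE (fun _ : σ => 1) N).card := fun N =>
    Finset.card_pos.2 ⟨0, (mem_expLE fun _ => le_rfl).2 (by simp)⟩
  have hle : ∀ N, (expLE (fun _ : σ => 1) N).card ≤ (N + 1) ^ Fintype.card σ := fun N => by
    refine (Finset.card_filter_le _ _).trans ?_
    simp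
  have hB : 1 ≤ B := by
    rcases Nat.eq_zero_or_pos B with rfl | hB
    · have := h 0
      have := hpos 0
      nlinarith
    · exact hB
  have hk : ∀ k, (B + 1) ^ k ≤ B ^ k * (expLE (fun _ : σ => 1) (k * c)).card := by
    intro k
    induction k with
    | zero => simpa using hpos 0
    | succ k ih =>
      have h1 : (B + 1) * (expLE (fun _ : σ => 1) (k * c)).card ≤
          B * (expLE (fun _ : σ => 1) ((k + 1) * c)).card := by
        rw [add_mul k 1 c, one_mul]
        exact le_trans (Nat.mul_le_mul_right _ hAB) (h (k * c))
      calc (B + 1) ^ (k + 1) = (B + 1) * (B + 1) ^ k := by ring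
        _ ≤ (B + 1) * (B ^ k * (expLE (fun _ : σ => 1) (k * c)).card) := Nat.mul_le_mul_left _ ih
        _ = B ^ k * ((B + 1) * (expLE (fun _ : σ => 1) (k * c)).card) := by ring
        _ ≤ B ^ k * (B * (expLE (fun _ : σ => 1) ((k + 1) * c)).card) := Nat.mul_le_mul_left _ h1
        _ = _ := by ring
  set n := Fintype.card σ
  have hBr : (0 : ℝ) < B := by exact_mod_cast hB
  have hr : (1 : ℝ) < (B + 1) / B := by rw [lt_div_iff₀ hBr]; linarith
  have hlim := (tendsto_pow_const_div_const_pow_of_one_lt n hr).const_mul (((c : ℝ) + 1) ^ n)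
  rw [mul_zero] at hlim
  obtain ⟨k, hk1, hk2⟩ :=
    ((hlim.eventually (gt_mem_nhds one_pos)).and (Filter.eventually_ge_atTop 1)).exists
  have h3 : (B + 1) ^ k ≤ B ^ k * ((c + 1) ^ n * k ^ n) := by
    refine (hk k).trans (Nat.mul_le_mul_left _ ((hle _).trans ?_))
    rw [← mul_pow]
    exact Nat.pow_le_pow_left (by nlinarith) n
  have h4 : ((B : ℝ) + 1) ^ k ≤ B ^ k * ((c + 1) ^ n * k ^ n) := by exact_mod_cast h3
  rw [div_pow, ← mul_div_assoc, div_div_eq_mul_div, div_lt_one (by positivity)] at hk1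
  linarith

end Counting

/-! ### The number of points of a reduced complete intersection without points at infinity -/

/-- In a module over a commutative ring, an independent family in the span of a finite family is not
larger than that family. -/
theorem LinearIndependent.card_le_of_mem_span {R M ι κ : Type*} [CommRing R] [Nontrivial R]
    [AddCommGroup M] [Module R M] [Fintype ι] {v : ι → M} (hv : LinearIndependent R v)
    (s : Finset κ) (w : κ → M) (h : ∀ i, v i ∈ Submodule.span R (w '' (s : Set κ))) :
    Fintype.card ι ≤ s.card := by
  classical
  have h1 := linearIndependent_le_span' v hv ((s.image w : Finset M) : Set M) (by
    rintro _ ⟨i, rfl⟩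
    simpa using h i)
  rw [Cardinal.mk_fintype] at h1
  have h2 : Fintype.card ι ≤ (s.image w).card := by simpa using h1
  exact h2.trans Finset.card_image_le

theorem card_expLE_one_congr {σ τ : Type*} [Fintype σ] [Fintype τ] [DecidableEq σ] [DecidableEq τ]
    (e : τ ≃ σ) (N : ℕ) :
    (expLE (fun _ : τ => 1) N).card = (expLE (fun _ : σ => 1) N).card := by
  refine Finset.card_equiv (e.arrowCongr (Equiv.refl ℕ)) fun a => ?_
  rw [mem_expLE fun _ => le_rfl, mem_expLE fun _ => le_rfl]
  simp only [mul_one, Equiv.arrowCongr_apply, Equiv.coe_refl, Function.comp_apply, id_eq]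
  rw [Equiv.sum_comp e.symm a]

section Fiber

open MvPolynomial

variable {L : Type*} [Field L] {σ τ : Type*} [Fintype σ] [Fintype τ]

/-- The monomial with exponents `a`. -/
def mono (L : Type*) [Field L] {σ : Type*} [Fintype σ] (a : σ → ℕ) : MvPolynomial σ L :=
  ∏ i, X i ^ a i

theorem mono_add (a b : σ → ℕ) : mono L (a + b) = mono L a * mono L b := by
  simp [mono, pow_add, Finset.prod_mul_distrib]

theorem mono_single [DecidableEq σ] (i : σ) (k : ℕ) : mono L (Pi.single i k) = X i ^ k := by
  rw [mono, Finset.prod_eq_single i]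
  · simp
  · intro j _ hj; simp [hj]
  · simp

theorem mono_eq_monomial (a : σ → ℕ) :
    mono L a = monomial (Finsupp.equivFunOnFinite.symm a) 1 := by
  rw [monomial_eq, C_1, one_mul, Finsupp.prod_fintype _ _ (fun _ => pow_zero _)]
  rfl

theorem linearIndependent_mono : LinearIndependent L (mono L : (σ → ℕ) → MvPolynomial σ L) := by
  have h := ((basisMonomials σ L).linearIndependent).comp _
    (Finsupp.equivFunOnFinite (α := σ) (M := ℕ)).symm.injective
  have h2 : (mono L : (σ → ℕ) → MvPolynomial σ L) =
      basisMonomials σ L ∘ Finsupp.equivFunOnFinite.symm := by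
    funext a
    simp [mono_eq_monomial]
  rw [h2]
  exact h

theorem mem_span_mono [DecidableEq σ] {p : MvPolynomial σ L} {N : ℕ} (h : p.totalDegree ≤ N) :
    p ∈ Submodule.span L (mono L '' (expLE (fun _ : σ => 1) N : Set (σ → ℕ))) := by
  rw [p.as_sum]
  refine Submodule.sum_mem _ fun b hb => ?_
  have h1 : monomial b (coeff b p) = coeff b p • mono L (b : σ → ℕ) := by
    rw [mono_eq_monomial, smul_monomial, smul_eq_mul, mul_one]
    congr 2
    ext i
    rfl
  rw [h1]
  refine Submodule.smul_mem _ _ (Submodule.subset_span ⟨_, ?_, rfl⟩)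
  rw [Finset.mem_coe, mem_expLE fun _ => le_rfl]
  have h2 := le_totalDegree hb
  rw [Finsupp.sum_fintype _ _ (fun _ => rfl)] at h2
  simpa using h2.trans h

theorem exists_mem_span_mono [DecidableEq σ] (d : σ → ℕ) (hd : ∀ j, 1 ≤ d j)
    (p : MvPolynomial σ L) :
    ∃ N, p ∈ Submodule.span L (mono L '' (expLE d N : Set (σ → ℕ))) := by
  refine ⟨p.totalDegree * ∑ j, d j, Submodule.span_mono (Set.image_mono ?_) (mem_span_mono le_rfl)⟩
  intro a ha
  rw [Finset.mem_coe, mem_expLE fun _ => le_rfl] at ha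
  rw [Finset.mem_coe, mem_expLE hd]
  simp only [mul_one] at ha
  calc ∑ j, a j * d j ≤ ∑ j, a j * ∑ k, d k := Finset.sum_le_sum fun j _ =>
        Nat.mul_le_mul_left _ (Finset.single_le_sum (fun _ _ => Nat.zero_le _) (Finset.mem_univ j))
    _ = (∑ j, a j) * ∑ k, d k := by rw [Finset.sum_mul]
    _ ≤ _ := Nat.mul_le_mul_right _ ha

omit [Fintype σ] in
theorem span_mul_mem {A B : Set (MvPolynomial σ L)} {p q : MvPolynomial σ L}
    (hp : p ∈ Submodule.span L A) (hq : q ∈ Submodule.span L B) {C : Set (MvPolynomial σ L)}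
    (h : ∀ a ∈ A, ∀ b ∈ B, a * b ∈ Submodule.span L C) : p * q ∈ Submodule.span L C := by
  have h1 : p * q ∈ Submodule.span L A * Submodule.span L B := Submodule.mul_mem_mul hp hq
  rw [Submodule.span_mul_span] at h1
  refine Submodule.span_le.2 ?_ h1
  rintro _ ⟨a, ha, b, hb, rfl⟩
  exact h a ha b hb

/-- Division with remainder by the relations `X i ^ q - X i = ∑ j, g j * Θ j i`: every polynomial
is a combination of the monomials with exponents below `q` with coefficients that are polynomials
in the `g j`, and the degrees are under control. -/
theorem mem_span_box [DecidableEq σ] [DecidableEq τ] (g : τ → MvPolynomial σ L) (d m : τ → ℕ)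
    (hd : ∀ j, 1 ≤ d j) (Θ : τ → σ → MvPolynomial σ L) (hΘ : ∀ j i, (Θ j i).totalDegree ≤ m j)
    (q : ℕ) (hq : 2 ≤ q) (hdm : ∀ j, d j + m j = q)
    (hrel : ∀ i, X i ^ q - X i = ∑ j, g j * Θ j i) (N : ℕ) :
    ∀ p : MvPolynomial σ L, p.totalDegree ≤ N → p ∈ Submodule.span L
      {x | ∃ a ∈ expLE d N, ∃ α : σ → ℕ, (∀ i, α i < q) ∧ x = aeval g (mono L a) * mono L α} := by
  induction N using Nat.strong_induction_on with
  | _ N ih =>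
  have hmono : ∀ {N' : ℕ}, N' ≤ N → ∀ {p : MvPolynomial σ L}, p ∈ Submodule.span L
      {x | ∃ a ∈ expLE d N', ∃ α : σ → ℕ, (∀ i, α i < q) ∧ x = aeval g (mono L a) * mono L α} →
      p ∈ Submodule.span L
      {x | ∃ a ∈ expLE d N, ∃ α : σ → ℕ, (∀ i, α i < q) ∧ x = aeval g (mono L a) * mono L α} := by
    intro N' hN' p hp
    refine Submodule.span_mono ?_ hp
    rintro x ⟨a, ha, h⟩
    exact ⟨a, expLE_mono hd hN' ha, h⟩
  intro p hp
  refine Submodule.span_le.2 ?_ (mem_span_mono hp)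
  rintro _ ⟨b, hb, rfl⟩
  rw [Finset.mem_coe, mem_expLE fun _ => le_rfl] at hb
  simp only [mul_one] at hb
  by_cases hbox : ∀ i, b i < q
  · refine Submodule.subset_span ⟨0, (mem_expLE hd).2 (by simp), b, hbox, ?_⟩
    simp [mono]
  · push Not at hbox
    obtain ⟨i, hi⟩ := hbox
    set b' : σ → ℕ := b - Pi.single i q with hb'
    have hbb : b = b' + Pi.single i q := by
      funext k
      by_cases hk : k = i
      · subst hk; simp [hb', Nat.sub_add_cancel hi]
      · simp [hb', hk]
    have hsum : ∑ k, b' k + q = ∑ k, b k := by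
      rw [hbb]; simp [Finset.sum_add_distrib]
    have hdeg : (mono L b').totalDegree ≤ ∑ k, b' k := by
      refine (totalDegree_finsetProd _ _).trans (Finset.sum_le_sum fun k _ => ?_)
      exact (totalDegree_X_pow _ _).le
    have hx : mono L b = mono L b' * X i + ∑ j, g j * (Θ j i * mono L b') := by
      have h2 : (X i : MvPolynomial σ L) ^ q = X i + ∑ j, g j * Θ j i := by rw [← hrel]; ring
      rw [hbb, mono_add, mono_single, h2, mul_add, Finset.mul_sum]
      congr 1
      exact Finset.sum_congr rfl fun j _ => by ring
    rw [SetLike.mem_coe, hx]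
    refine Submodule.add_mem _ ?_ (Submodule.sum_mem _ fun j _ => ?_)
    · refine hmono (Nat.sub_le N 1) (ih (N - 1) (by omega) _ ?_)
      refine (totalDegree_mul _ _).trans ?_
      rw [totalDegree_X]
      omega
    · have hdj := hd j
      have hdmj := hdm j
      have h3 := ih (N - d j) (by omega) (Θ j i * mono L b')
        ((totalDegree_mul _ _).trans (by have := hΘ j i; omega))
      have h4 : g j ∈ Submodule.span L {g j} := Submodule.mem_span_singleton_self _
      refine span_mul_mem h4 h3 ?_
      rintro x hx y ⟨a, ha, α, hα, rfl⟩
      rw [Set.mem_singleton_iff] at hx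
      subst hx
      refine Submodule.subset_span ⟨a + Pi.single j 1, ?_, α, hα, ?_⟩
      · rw [mem_expLE hd] at ha ⊢
        have : ∑ k, (a + Pi.single j 1 : τ → ℕ) k * d k = ∑ k, a k * d k + d j := by
          simp [add_mul, Finset.sum_add_distrib, Pi.single_apply]
        omega
      · rw [mono_add, mono_single, map_mul, pow_one, aeval_X]; ring

/-- The number of points in the zero fibre of a map `g : Lⁿ → Lⁿ` whose components have degrees at
most `d j`, which is finite by relations of the stated form and whose zero fibre `pt '' Z` is reduced (by
`hspan`), is `∏ d j`. This is Bézout's theorem for complete intersections without points at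
infinity. The lower bound comes from Nakayama's lemma, by which the polynomial ring has rank at most
`|Z|` over the subring generated by the `g j`; the upper bound from the minimal polynomial over
that integrally closed subring of a function that separates the points of `Z`. -/
theorem card_fiber [Infinite L] (hcard : Fintype.card τ = Fintype.card σ)
    (g : τ → MvPolynomial σ L) (d m : τ → ℕ)
    (hd : ∀ j, 1 ≤ d j) (hg : ∀ j, (g j).totalDegree ≤ d j)
    (Θ : τ → σ → MvPolynomial σ L) (hΘ : ∀ j i, (Θ j i).totalDegree ≤ m j)
    (q : ℕ) (hq : 2 ≤ q) (hdm : ∀ j, d j + m j = q)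
    (hrel : ∀ i, X i ^ q - X i = ∑ j, g j * Θ j i)
    {κ : Type*} (Z : Finset κ) (pt : κ → σ → L) (hZ : ∀ v ∈ Z, ∀ j, eval (pt v) (g j) = 0)
    (e : κ → MvPolynomial σ L) (he : ∀ v ∈ Z, ∀ w ∈ Z, v ≠ w → eval (pt w) (e v) = 0)
    (he1 : ∀ v ∈ Z, eval (pt v) (e v) = 1)
    (hspan : ∀ p, ∃ c : κ → L, p - ∑ v ∈ Z, C (c v) * e v ∈ Ideal.span (Set.range g)) :
    Z.card = ∏ j, d j := by
  classical
  have hbox := mem_span_box g d m hd Θ hΘ q hq hdm hrel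
  set φ : MvPolynomial τ L →ₐ[L] MvPolynomial σ L := aeval g with hφ
  let _ : Algebra (MvPolynomial τ L) (MvPolynomial σ L) := φ.toRingHom.toAlgebra
  have hsmul : ∀ (p : MvPolynomial τ L) (x : MvPolynomial σ L), p • x = φ p * x :=
    fun p x => rfl
  have : IsScalarTower L (MvPolynomial τ L) (MvPolynomial σ L) :=
    IsScalarTower.of_algebraMap_eq fun x => (φ.commutes x).symm
  -- the monomials in the box generate the polynomial ring as a module
  set box : Finset (σ → ℕ) := Fintype.piFinset fun _ => Finset.range q with hboxdef
  have hgen : (⊤ : Submodule (MvPolynomial τ L) (MvPolynomial σ L)) ≤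
      Submodule.span _ (mono L '' (box : Set (σ → ℕ))) := by
    intro p _
    have h1 := hbox p.totalDegree p le_rfl
    have h2 : Submodule.span L {x | ∃ a ∈ expLE d p.totalDegree, ∃ α : σ → ℕ, (∀ i, α i < q) ∧
        x = φ (mono L a) * mono L α} ≤
        (Submodule.span (MvPolynomial τ L) (mono L '' (box : Set (σ → ℕ)))).restrictScalars L := by
      refine Submodule.span_le.2 ?_
      rintro x ⟨a, _, α, hα, rfl⟩
      rw [← hsmul]
      have h3 : mono L α ∈ Submodule.span (MvPolynomial τ L) (mono L '' (box : Set (σ → ℕ))) :=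
        Submodule.subset_span ⟨α, by simpa [hboxdef] using hα, rfl⟩
      exact Submodule.smul_mem (Submodule.span (MvPolynomial τ L) _) (mono L a) h3
    exact h2 h1
  have hfin : Module.Finite (MvPolynomial τ L) (MvPolynomial σ L) :=
    ⟨Submodule.fg_def.2 ⟨_, box.finite_toSet.image _, top_le_iff.1 hgen⟩⟩
  -- the polynomials `g j` are algebraically independent
  have halg : AlgebraicIndependent L g := by
    have hint : Algebra.IsAlgebraic (Algebra.adjoin L (Set.range g)) (MvPolynomial σ L) := by
      refine ⟨fun x => ?_⟩
      obtain ⟨P, hP, hx⟩ := Algebra.IsIntegral.isIntegral (R := MvPolynomial τ L) x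
      refine IsIntegral.isAlgebraic (R := Algebra.adjoin L (Set.range g)) ?_
      have hr : ∀ p, φ p ∈ Algebra.adjoin L (Set.range g) := fun p => by
        rw [Algebra.adjoin_range_eq_range_aeval]; exact ⟨p, rfl⟩
      refine ⟨P.map (φ.codRestrict _ hr).toRingHom, hP.map _, ?_⟩
      rw [Polynomial.eval₂_map]
      exact hx
    have htr := MvPolynomial.trdeg_of_isDomain (ι := σ) (S := L)
    refine (Algebra.IsAlgebraic.isTranscendenceBasis_of_lift_le_trdeg_of_finite L g ?_).1
    rw [htr]
    simp [hcard]
  have hinj : Function.Injective φ := halg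
  have : Module.IsTorsionFree (MvPolynomial τ L) (MvPolynomial σ L) := by
    have : FaithfulSMul (MvPolynomial τ L) (MvPolynomial σ L) :=
      (faithfulSMul_iff_algebraMap_injective _ _).2 hinj
    infer_instance
  refine le_antisymm ?_ ?_
  · -- a polynomial separating the points
    obtain ⟨c, hc⟩ : ∃ c : κ → L, Set.InjOn c Z := by
      obtain ⟨f⟩ : Nonempty (Z ↪ L) := by
        refine ⟨(Finset.equivFin Z).toEmbedding.trans (Fin.valEmbedding.trans (Infinite.natEmbedding L))⟩
      refine ⟨fun v => if h : v ∈ Z then f ⟨v, h⟩ else 0, fun v hv w hw h => ?_⟩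
      rw [Finset.mem_coe] at hv hw
      simpa [hv, hw] using h
    set s : MvPolynomial σ L := ∑ v ∈ Z, C (c v) * e v with hs
    have hsv : ∀ v ∈ Z, eval (pt v) s = c v := fun v hv => by
      rw [hs, map_sum, Finset.sum_eq_single v]
      · simp [he1 v hv]
      · intro w hw hwv
        simp [he w hw v hv hwv]
      · exact fun h => absurd hv h
    have hsint : IsIntegral (MvPolynomial τ L) s := Algebra.IsIntegral.isIntegral s
    set r := (minpoly (MvPolynomial τ L) s).natDegree with hr
    have hcardr : Z.card ≤ r := by
      set μ : L[X] := (minpoly (MvPolynomial τ L) s).map (constantCoeff : _ →+* L) with hμ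
      have hmonic : μ.Monic := (minpoly.monic hsint).map _
      have hroots : Z.image c ⊆ μ.roots.toFinset := by
        intro x hx
        obtain ⟨v, hv, rfl⟩ := Finset.mem_image.1 hx
        rw [Multiset.mem_toFinset, Polynomial.mem_roots hmonic.ne_zero, Polynomial.IsRoot.def, hμ,
          Polynomial.eval_map]
        have h1 : ((eval (pt v)).comp φ.toRingHom : MvPolynomial τ L →+* L) = constantCoeff := by
          refine MvPolynomial.ringHom_ext (fun a => ?_) (fun j => ?_)
          · simp [hφ]
          · simp [hφ, hZ v hv j]
        have h2 := congrArg (eval (pt v)) (minpoly.aeval (MvPolynomial τ L) s)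
        rw [map_zero, Polynomial.aeval_def, Polynomial.hom_eval₂, hsv v hv] at h2
        rw [← h1]
        exact h2
      have h3 : (Z.image c).card = Z.card := Finset.card_image_of_injOn hc
      rw [← h3]
      calc (Z.image c).card ≤ μ.roots.toFinset.card := Finset.card_le_card hroots
        _ ≤ Multiset.card μ.roots := Multiset.toFinset_card_le _
        _ ≤ μ.natDegree := Polynomial.card_roots' _
        _ ≤ r := Polynomial.natDegree_map_le
    refine hcardr.trans ?_
    -- the powers of `s` below `r` are independent
    have hind : LinearIndependent (MvPolynomial τ L) (fun k : Fin r => s ^ (k : ℕ)) := by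
      rw [Fintype.linearIndependent_iff]
      intro p hp
      set P : Polynomial (MvPolynomial τ L) := ∑ k : Fin r, Polynomial.monomial (k : ℕ) (p k) with hP
      have hP0 : Polynomial.aeval s P = 0 := by
        rw [hP, map_sum, ← hp]
        refine Finset.sum_congr rfl fun k _ => ?_
        rw [Polynomial.aeval_monomial, Algebra.smul_def]
      have hPz : P = 0 := by
        by_contra hne
        have h1 := minpoly.IsIntegrallyClosed.degree_le_of_ne_zero (s := s) hne hP0
        have h2 : P.degree < r := by
          rw [Polynomial.degree_lt_iff_coeff_zero]
          intro k hk
          rw [hP, Polynomial.finsetSum_coeff]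
          refine Finset.sum_eq_zero fun i _ => ?_
          rw [Polynomial.coeff_monomial, if_neg]
          have := i.2
          omega
        rw [Polynomial.degree_eq_natDegree (minpoly.ne_zero hsint), ← hr] at h1
        exact absurd h2 (not_lt.2 h1)
      intro k
      have h3 := congrArg (fun Q => Polynomial.coeff Q (k : ℕ)) hPz
      simp only [hP, Polynomial.finsetSum_coeff, Polynomial.coeff_monomial,
        Polynomial.coeff_zero] at h3
      rw [Finset.sum_eq_single k] at h3
      · simpa using h3
      · intro i _ hik
        rw [if_neg]
        exact fun h => hik (Fin.ext h)
      · simp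
    refine le_of_mul_card_expLE_le (σ := τ) (c := r * s.totalDegree) fun N => ?_
    have h1 := card_expLE_one_le d hd N
    have h2 := (linearIndependent_smul (linearIndependent_mono (L := L) (σ := τ)) hind).comp
      (fun x : expLE d N × Fin r => (x.1.1, x.2)) (by
        rintro ⟨a, k⟩ ⟨a', k'⟩ h
        simp only [Prod.mk.injEq] at h
        exact Prod.ext (Subtype.ext h.1) h.2)
    have h3 := h2.card_le_of_mem_span (expLE (fun _ : σ => 1) (N + r * s.totalDegree)) (mono L) (by
      rintro ⟨⟨a, ha⟩, k⟩
      refine mem_span_mono ?_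
      simp only [Function.comp_apply, hsmul]
      refine (totalDegree_mul _ _).trans (add_le_add ?_ ?_)
      · rw [mem_expLE hd] at ha
        refine le_trans ?_ ha
        rw [mono, map_prod]
        refine (totalDegree_finsetProd _ _).trans (Finset.sum_le_sum fun j _ => ?_)
        rw [map_pow, hφ, aeval_X]
        exact (totalDegree_pow _ _).trans (Nat.mul_le_mul_left _ (hg j))
      · exact (totalDegree_pow _ _).trans (Nat.mul_le_mul_right _ k.2.le))
    rw [Fintype.card_prod, Fintype.card_coe, Fintype.card_fin,
      ← card_expLE_one_congr (Fintype.equivOfCardEq hcard)] at h3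
    calc r * (expLE (fun _ : τ => 1) N).card ≤ r * ((∏ j, d j) * (expLE d N).card) :=
          Nat.mul_le_mul_left _ h1
      _ = (∏ j, d j) * ((expLE d N).card * r) := by ring
      _ ≤ _ := Nat.mul_le_mul_left _ h3
  · -- Nakayama's lemma at the origin of the target
    have hnak : (⊤ : Submodule (MvPolynomial τ L) (MvPolynomial σ L)) ≤
        Submodule.span _ (e '' (Z : Set κ)) ⊔
          Ideal.span (Set.range (X : τ → MvPolynomial τ L)) •
            (⊤ : Submodule (MvPolynomial τ L) (MvPolynomial σ L)) := by
      intro p _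
      obtain ⟨c, hc⟩ := hspan p
      rw [← sub_add_cancel p (∑ v ∈ Z, C (c v) * e v), add_comm]
      refine Submodule.add_mem_sup (Submodule.sum_mem _ fun v hv => ?_) ?_
      · have h1 : C (c v) * e v = (C (c v) : MvPolynomial τ L) • e v := by
          rw [hsmul, hφ, aeval_C, algebraMap_eq]
        rw [h1]
        exact Submodule.smul_mem _ _ (Submodule.subset_span ⟨v, hv, rfl⟩)
      · refine Submodule.span_induction (p := fun x _ => x ∈ _) ?_ (Submodule.zero_mem _)
          (fun x y _ _ hx hy => Submodule.add_mem _ hx hy) (fun a x _ hx => ?_) hc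
        · rintro _ ⟨j, rfl⟩
          have h1 : g j = (X j : MvPolynomial τ L) • (1 : MvPolynomial σ L) := by
            rw [hsmul, hφ, aeval_X, mul_one]
          rw [h1]
          exact Submodule.smul_mem_smul (Ideal.subset_span ⟨j, rfl⟩) trivial
        · refine Submodule.smul_induction_on hx (fun y hy z _ => ?_) (fun y z hy hz => ?_)
          · rw [smul_comm]
            exact Submodule.smul_mem_smul hy trivial
          · rw [smul_add]
            exact Submodule.add_mem _ hy hz
    obtain ⟨r, hr1, hr2⟩ := Submodule.exists_sub_one_mem_and_smul_le_of_fg_of_le_sup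
      hfin.1 le_rfl hnak
    have hr0 : φ r ≠ 0 := by
      have h1 : constantCoeff (r - 1) = 0 := by
        have h2 : Ideal.span (Set.range (X : τ → MvPolynomial τ L)) ≤
            RingHom.ker (constantCoeff : MvPolynomial τ L →+* L) := by
          refine Ideal.span_le.2 ?_
          rintro _ ⟨j, rfl⟩
          simp
        exact h2 hr1
      rw [Ne, map_eq_zero_iff φ hinj]
      rintro rfl
      simp at h1
    have hcoef : ∀ α : σ → ℕ, ∃ N, φ r * mono L α ∈ Submodule.span L
        ((fun x : (τ → ℕ) × κ => φ (mono L x.1) * e x.2) '' (expLE d N ×ˢ Z : Finset _)) := by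
      intro α
      have h1 : φ r * mono L α ∈ Submodule.span (MvPolynomial τ L) (e '' (Z : Set κ)) :=
        hr2 (Submodule.smul_mem_pointwise_smul (mono L α) r ⊤ trivial)
      obtain ⟨p, hp⟩ := (Submodule.mem_span_image_finset_iff_exists_fun' _).1 h1
      choose M hM using fun v => exists_mem_span_mono d hd (p v)
      refine ⟨Z.sup M, ?_⟩
      rw [← hp]
      refine Submodule.sum_mem _ fun v hv => ?_
      have h2 := Submodule.mem_map_of_mem (f := φ.toLinearMap) (hM v)
      rw [Submodule.map_span] at h2
      rw [hsmul]
      refine span_mul_mem h2 (Submodule.mem_span_singleton_self (e v)) ?_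
      rintro _ ⟨_, ⟨a, ha, rfl⟩, rfl⟩ y hy
      rw [Set.mem_singleton_iff] at hy
      subst hy
      refine Submodule.subset_span ⟨(a, v), ?_, rfl⟩
      rw [Finset.mem_coe, Finset.mem_product]
      exact ⟨expLE_mono hd (Finset.le_sup hv) ha, hv⟩
    choose M hM using hcoef
    set c := box.sup M with hcdef
    refine le_of_mul_card_expLE_le (σ := τ) (c := c + ∑ j, d j) fun N => ?_
    have h1 : LinearIndependent L (fun b : expLE (fun _ : σ => 1) N => φ r * mono L b.1) := by
      have h2 := (linearIndependent_mono (L := L) (σ := σ)).comp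
        (fun b : expLE (fun _ : σ => 1) N => b.1) Subtype.val_injective
      exact h2.map' (LinearMap.mulLeft L (φ r))
        (LinearMap.ker_eq_bot.2 (mul_right_injective₀ hr0))
    have h2 := h1.card_le_of_mem_span (expLE d (N + c) ×ˢ Z)
      (fun x : (τ → ℕ) × κ => φ (mono L x.1) * e x.2) (by
      rintro ⟨b, hb⟩
      rw [mem_expLE fun _ => le_rfl] at hb
      have h3 := hbox N (mono L b) (by
        refine le_trans ((totalDegree_finsetProd _ _).trans (Finset.sum_le_sum fun k _ => ?_)) hb
        rw [mul_one]
        exact (totalDegree_X_pow _ _).le)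
      refine span_mul_mem (Submodule.mem_span_singleton_self (φ r)) h3 ?_
      rintro _ rfl _ ⟨a, ha, α, hα, rfl⟩
      have h4 : φ r * (φ (mono L a) * mono L α) = φ (mono L a) * (φ r * mono L α) := by ring
      rw [h4]
      refine span_mul_mem (Submodule.mem_span_singleton_self _) (hM α) ?_
      rintro _ rfl _ ⟨⟨a', v⟩, hav, rfl⟩
      rw [Finset.mem_coe, Finset.mem_product] at hav
      refine Submodule.subset_span ⟨(a + a', v), ?_, ?_⟩
      · rw [Finset.mem_coe, Finset.mem_product]
        refine ⟨?_, hav.2⟩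
        have h5 : M α ≤ c := Finset.le_sup (f := M) (by simpa [hboxdef] using hα)
        have h6 : ∑ j, a' j * d j ≤ M α := (mem_expLE hd).1 hav.1
        have h7 := (mem_expLE hd).1 ha
        rw [mem_expLE hd]
        simp only [Pi.add_apply, add_mul, Finset.sum_add_distrib]
        omega
      · simp only [mono_add, map_mul]; ring)
    rw [Fintype.card_coe, Finset.card_product,
      ← card_expLE_one_congr (Fintype.equivOfCardEq hcard)] at h2
    calc (∏ j, d j) * (expLE (fun _ : τ => 1) N).card
        ≤ (∏ j, d j) * ((expLE d (N + c)).card * Z.card) := Nat.mul_le_mul_left _ h2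
      _ = Z.card * ((∏ j, d j) * (expLE d (N + c)).card) := by ring
      _ ≤ Z.card * (expLE (fun _ : τ => 1) (N + c + ∑ j, d j)).card :=
          Nat.mul_le_mul_left _ (prod_mul_card_expLE_le d hd (N + c))
      _ = _ := by rw [add_assoc]

end Fiber

/-! ### Linear forms and determinants of polynomial matrices -/

section LinForm

open MvPolynomial

variable {L : Type*} [Field L] {σ : Type*} [Fintype σ]

/-- The linear form with coefficients `a`. -/
def linForm (a : σ → L) : MvPolynomial σ L := ∑ i, C (a i) * X i

@[simp]
theorem eval_linForm (a v : σ → L) : eval v (linForm a) = a ⬝ᵥ v := by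
  simp [linForm, dotProduct]

theorem coeff_linForm [DecidableEq σ] (a : σ → L) (i : σ) :
    coeff (Finsupp.single i 1) (linForm a) = a i := by
  simp only [linForm, coeff_sum, coeff_C_mul, coeff_X, Finsupp.single_left_inj one_ne_zero]
  simp

theorem linForm_isHomogeneous (a : σ → L) : (linForm a).IsHomogeneous 1 :=
  IsHomogeneous.sum _ _ _ fun _ _ => isHomogeneous_C_mul_X _ _

theorem linForm_ne_zero {a : σ → L} (ha : a ≠ 0) : linForm a ≠ 0 := by
  classical
  intro h
  refine ha (funext fun i => ?_)
  rw [← coeff_linForm a i, h, coeff_zero, Pi.zero_apply]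

theorem linForm_prime {a : σ → L} (ha : a ≠ 0) : Prime (linForm a) := by
  classical
  refine Irreducible.prime (irreducible_of_totalDegree_eq_one
    ((linForm_isHomogeneous a).totalDegree (linForm_ne_zero ha)) fun x hx => ?_)
  obtain ⟨i, hi⟩ := Function.ne_iff.1 ha
  have h1 := hx (Finsupp.single i 1)
  rw [coeff_linForm] at h1
  exact isUnit_of_dvd_unit h1 (isUnit_iff_ne_zero.2 hi)

theorem linForm_not_dvd {a b u : σ → L} (h1 : a ⬝ᵥ u = 0) (h2 : b ⬝ᵥ u ≠ 0) :
    ¬ linForm a ∣ linForm b := by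
  rintro ⟨p, hp⟩
  refine h2 ?_
  rw [← eval_linForm, hp, map_mul, eval_linForm, h1, zero_mul]

theorem linForm_isRelPrime {a b u : σ → L} (ha : a ≠ 0) (h1 : a ⬝ᵥ u = 0) (h2 : b ⬝ᵥ u ≠ 0) :
    IsRelPrime (linForm a) (linForm b) :=
  (linForm_prime ha).irreducible.isRelPrime_iff_not_dvd.2 (linForm_not_dvd h1 h2)

theorem totalDegree_prod_linForm {ι : Type*} (s : Finset ι) (a : ι → σ → L)
    (ha : ∀ h ∈ s, a h ≠ 0) : (∏ h ∈ s, linForm (a h)).totalDegree = s.card := by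
  have h1 : (∏ h ∈ s, linForm (a h)).IsHomogeneous (∑ _h ∈ s, 1) :=
    IsHomogeneous.prod _ _ _ fun h _ => linForm_isHomogeneous (a h)
  rw [h1.totalDegree (Finset.prod_ne_zero_iff.2 fun h hh => linForm_ne_zero (ha h hh))]
  simp

variable [DecidableEq σ]

omit [Fintype σ] [DecidableEq σ] in
/-- If a constant nonzero combination of the columns of a matrix is divisible by `p`, then so is
the determinant. -/
theorem dvd_det_of_dvd_combination {τ : Type*} [Fintype τ] [DecidableEq τ]
    (N : Matrix τ τ (MvPolynomial σ L)) {a : τ → L} (ha : a ≠ 0)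
    {p : MvPolynomial σ L} (h : ∀ k, p ∣ ∑ i, C (a i) * N k i) : p ∣ N.det := by
  choose w hw using h
  obtain ⟨i, hi⟩ := Function.ne_iff.1 ha
  have h1 : N.mulVec (fun i => C (a i)) = p • w := by
    funext k
    rw [Pi.smul_apply, smul_eq_mul, ← hw]
    exact Finset.sum_congr rfl fun i _ => mul_comm _ _
  have h2 := congrArg (N.adjugate.mulVec) h1
  rw [Matrix.mulVec_mulVec, Matrix.adjugate_mul, Matrix.mulVec_smul, Matrix.smul_mulVec,
    Matrix.one_mulVec] at h2
  have h3 := congrFun h2 i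
  simp only [Pi.smul_apply, smul_eq_mul] at h3
  have h4 : N.det = C (a i)⁻¹ * (p * (N.adjugate.mulVec w) i) := by
    rw [← h3, mul_left_comm, ← C_mul, inv_mul_cancel₀ hi, C_1, mul_one]
  rw [h4]
  exact Dvd.dvd.mul_left (dvd_mul_right _ _) _

omit [Fintype σ] [DecidableEq σ] in
theorem totalDegree_det_le {τ : Type*} [Fintype τ] [DecidableEq τ]
    (N : Matrix τ τ (MvPolynomial σ L)) (k : τ → ℕ)
    (h : ∀ i j, (N i j).totalDegree ≤ k i) : N.det.totalDegree ≤ ∑ i, k i := by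
  rw [Matrix.det_apply']
  refine totalDegree_finsetSum_le fun s _ => ?_
  refine (totalDegree_mul _ _).trans ?_
  have h1 : (((Equiv.Perm.sign s : ℤˣ) : ℤ) : MvPolynomial σ L).totalDegree = 0 := by
    rw [← map_intCast (C : L →+* MvPolynomial σ L), totalDegree_C]
  rw [h1, zero_add]
  refine (totalDegree_finsetProd _ _).trans ?_
  rw [← Equiv.sum_comp s k]
  exact Finset.sum_le_sum fun i _ => h _ _

end LinForm

/-! ### Points over a finite field -/

section FiniteField

open MvPolynomial

variable {F L : Type*} [Field F] [Fintype F] [DecidableEq F] [Field L] [Algebra F L]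
  {σ : Type*} [Fintype σ] [DecidableEq σ]

/-- A polynomial over a finite field that is `1` at the point `v` and `0` at the other points. -/
def pointIndicator (L : Type*) [Field L] [Algebra F L] (v : σ → F) : MvPolynomial σ L :=
  ∏ i, Polynomial.aeval (X i : MvPolynomial σ L) (Lagrange.basis Finset.univ id (v i))

omit [Fintype F] [DecidableEq F] [Fintype σ] [DecidableEq σ] in
theorem eval_polynomial_aeval (p : F[X]) (w : σ → F) (i : σ) :
    eval (fun i => algebraMap F L (w i)) (Polynomial.aeval (X i : MvPolynomial σ L) p) =
      algebraMap F L (p.eval (w i)) := by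
  induction p using Polynomial.induction_on' with
  | add p q hp hq => simp [hp, hq]
  | monomial n c =>
    simp [Polynomial.aeval_monomial, IsScalarTower.algebraMap_apply F L (MvPolynomial σ L)]

omit [DecidableEq σ] in
theorem eval_pointIndicator_self (v : σ → F) :
    eval (fun i => algebraMap F L (v i)) (pointIndicator L v) = 1 := by
  rw [pointIndicator, map_prod]
  refine Finset.prod_eq_one fun i _ => ?_
  rw [eval_polynomial_aeval]
  have := Lagrange.eval_basis_self (v := (id : F → F)) (s := Finset.univ) (i := v i)
    (Function.injective_id.injOn) (Finset.mem_univ _)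
  rw [id] at this
  rw [this, map_one]

omit [DecidableEq σ] in
theorem eval_pointIndicator_of_ne {v w : σ → F} (h : v ≠ w) :
    eval (fun i => algebraMap F L (w i)) (pointIndicator L v) = 0 := by
  obtain ⟨i, hi⟩ := Function.ne_iff.1 h
  rw [pointIndicator, map_prod]
  refine Finset.prod_eq_zero (Finset.mem_univ i) ?_
  rw [eval_polynomial_aeval]
  have := Lagrange.eval_basis_of_ne (v := (id : F → F)) (s := Finset.univ) hi (Finset.mem_univ _)
  rw [id] at this
  rw [this, map_zero]

theorem sum_pointIndicator : ∑ v : σ → F, pointIndicator L v = 1 := by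
  have h1 := Finset.prod_univ_sum (fun _ : σ => (Finset.univ : Finset F))
    (fun i t => Polynomial.aeval (X i : MvPolynomial σ L) (Lagrange.basis Finset.univ id t))
  rw [Fintype.piFinset_univ] at h1
  simp only [pointIndicator]
  rw [← h1]
  refine Finset.prod_eq_one fun i _ => ?_
  rw [← map_sum, Lagrange.sum_basis Function.injective_id.injOn ⟨0, Finset.mem_univ _⟩, map_one]

omit [DecidableEq F] in
theorem X_pow_card_sub_X_dvd {p : F[X]} (hp : ∀ t, p.eval t = 0) :
    Polynomial.X ^ Fintype.card F - Polynomial.X ∣ p := by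
  have hdeg : (Polynomial.X : F[X]).degree < Fintype.card F := by
    rw [Polynomial.degree_X]
    exact_mod_cast Fintype.one_lt_card
  have hmonic : (Polynomial.X ^ Fintype.card F - Polynomial.X : F[X]).Monic :=
    Polynomial.monic_X_pow_sub hdeg
  rw [← Polynomial.modByMonic_eq_zero_iff_dvd hmonic]
  refine Polynomial.eq_zero_of_degree_lt_of_eval_finset_eq_zero (s := Finset.univ) ?_ fun t _ => ?_
  · refine (Polynomial.degree_modByMonic_lt _ hmonic).trans_le ?_
    rw [Polynomial.degree_sub_eq_left_of_degree_lt (by rwa [Polynomial.degree_X_pow]),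
      Polynomial.degree_X_pow, Finset.card_univ]
  · rw [Polynomial.modByMonic_eq_sub_mul_div p]
    simp [hp t, FiniteField.pow_card]

/-- Modulo the polynomials `X i ^ q - X i`, the indicator of a point is an eigenvector of the
multiplication by any polynomial, the eigenvalue being the value at the point. -/
theorem mul_pointIndicator_sub_mem {I : Ideal (MvPolynomial σ L)}
    (hI : ∀ i, X i ^ Fintype.card F - X i ∈ I) (v : σ → F) (p : MvPolynomial σ L) :
    p * pointIndicator L v - C (eval (fun i => algebraMap F L (v i)) p) * pointIndicator L v ∈ I := by
  have hX : ∀ i, (X i - C (algebraMap F L (v i))) * pointIndicator L v ∈ I := by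
    intro i
    have h1 : Polynomial.X ^ Fintype.card F - Polynomial.X ∣
        (Polynomial.X - Polynomial.C (v i)) * Lagrange.basis Finset.univ id (v i) := by
      refine X_pow_card_sub_X_dvd fun t => ?_
      rw [Polynomial.eval_mul]
      by_cases ht : v i = t
      · simp [ht]
      · have := Lagrange.eval_basis_of_ne (v := (id : F → F)) (s := Finset.univ) ht
          (Finset.mem_univ _)
        rw [id] at this
        rw [this, mul_zero]
    obtain ⟨r, hr⟩ := h1
    have h2 := congrArg (Polynomial.aeval (X i : MvPolynomial σ L)) hr
    simp only [map_mul, map_sub, map_pow, Polynomial.aeval_X, Polynomial.aeval_C] at h2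
    rw [pointIndicator, ← Finset.mul_prod_erase _ _ (Finset.mem_univ i), ← mul_assoc]
    refine Ideal.mul_mem_right _ _ ?_
    rw [IsScalarTower.algebraMap_apply F L (MvPolynomial σ L), algebraMap_eq] at h2
    rw [h2]
    exact Ideal.mul_mem_right _ _ (hI i)
  induction p using MvPolynomial.induction_on with
  | C a => simp
  | add p q hp hq =>
    have := I.add_mem hp hq
    rw [map_add, C_add]
    convert this using 1
    ring
  | mul_X p i hp =>
    have := I.add_mem (I.mul_mem_left (X i) hp)
      (I.mul_mem_left (C (eval (fun i => algebraMap F L (v i)) p)) (hX i))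
    rw [map_mul, C_mul, eval_X]
    convert this using 1
    ring

/-- The complement of an arrangement over a finite field with `q` elements has `∏ (q - m j)` points
if the arrangement has a basis of logarithmic derivations of degrees at most `m j`, in the form of
Saito's criterion. These points are the common zeros of the coefficients `g j` of the derivation
`∑ (X i ^ q - X i) ∂ᵢ` in terms of the basis. -/
theorem card_complement [Infinite L] {ι : Type*} [Fintype ι] (a : ι → σ → F)
    (ha : ∀ h, a h ≠ 0) (hpair : ∀ h h', h ≠ h' → ∃ u, a h ⬝ᵥ u = 0 ∧ a h' ⬝ᵥ u = 1)
    (m : σ → ℕ) (hm : ∑ j, m j = Fintype.card ι) (hmq : ∀ j, m j < Fintype.card F)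
    (Θ : Matrix σ σ (MvPolynomial σ L)) (hΘ : ∀ j i, (Θ j i).totalDegree ≤ m j)
    (b : ι → σ → MvPolynomial σ L)
    (hb : ∀ h j, ∑ i, C (algebraMap F L (a h i)) * Θ j i =
      linForm (fun i => algebraMap F L (a h i)) * b h j)
    {c : L} (hc : c ≠ 0) (hdet : Θ.det = C c * ∏ h, linForm (fun i => algebraMap F L (a h i))) :
    (Finset.univ.filter fun v : σ → F => ∀ h, a h ⬝ᵥ v ≠ 0).card =
      ∏ j, (Fintype.card F - m j) := by
  classical
  set q := Fintype.card F with hq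
  have hq2 : 2 ≤ q := Fintype.one_lt_card
  set aL : ι → σ → L := fun h i => algebraMap F L (a h i) with haL
  have hdot : ∀ h (v : σ → F), aL h ⬝ᵥ (fun i => algebraMap F L (v i)) =
      algebraMap F L (a h ⬝ᵥ v) := fun h v => by simp [haL, dotProduct]
  have haL0 : ∀ h, aL h ≠ 0 := fun h h0 => ha h (funext fun i => by
    have := congrFun h0 i
    simpa [haL] using this)
  -- the vector field with components `X i ^ q - X i` is logarithmic, by the Frobenius homomorphism
  have hfrob : ∀ h, ∑ i, C (aL h i) * (X i ^ q - X i) =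
      linForm (aL h) * (linForm (aL h) ^ (q - 1) - 1) := by
    intro h
    have h1 : linForm (aL h) ^ q = ∑ i, C (aL h i) * X i ^ q := by
      obtain ⟨p, hp⟩ := CharP.exists F
      have hpp : Fact p.Prime := ⟨CharP.char_is_prime F p⟩
      obtain ⟨n, hn, hcard⟩ := FiniteField.card F p
      have hpL : CharP L p := charP_of_injective_algebraMap (algebraMap F L).injective p
      rw [linForm, hq, hcard, sum_pow_char_pow]
      refine Finset.sum_congr rfl fun i _ => ?_
      rw [mul_pow, ← C_pow]
      congr 2
      rw [haL, ← map_pow, ← hcard, FiniteField.pow_card]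
    rw [mul_sub, mul_one, ← pow_succ', Nat.sub_add_cancel (by omega), h1, linForm,
      ← Finset.sum_sub_distrib]
    exact Finset.sum_congr rfl fun i _ => by ring
  -- the coefficients, by Cramer's rule
  have hdvd : ∀ j, ∏ h, linForm (aL h) ∣ (Θ.updateRow j fun i => X i ^ q - X i).det := by
    intro j
    refine Fintype.prod_dvd_of_isRelPrime (fun h h' hne => ?_) fun h => ?_
    · obtain ⟨u, hu1, hu2⟩ := hpair h h' hne
      exact linForm_isRelPrime (u := fun i => algebraMap F L (u i)) (haL0 h)
        (by rw [hdot, hu1, map_zero]) (by rw [hdot, hu2, map_one]; exact one_ne_zero)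
    · refine dvd_det_of_dvd_combination _ (haL0 h) fun k => ?_
      by_cases hk : k = j
      · subst hk
        simp only [Matrix.updateRow_self]
        exact ⟨_, hfrob h⟩
      · simp only [Matrix.updateRow_ne hk]
        exact ⟨_, hb h k⟩
  choose g0 hg0 using hdvd
  set g : σ → MvPolynomial σ L := fun j => C c⁻¹ * g0 j with hg
  have hdet0 : Θ.det ≠ 0 := by
    rw [hdet]
    exact mul_ne_zero (C_ne_zero.2 hc)
      (Finset.prod_ne_zero_iff.2 fun h _ => linForm_ne_zero (haL0 h))
  have hgdet : ∀ j, Θ.det * g j = (Θ.updateRow j fun i => X i ^ q - X i).det := fun j => by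
    rw [hg0 j, hdet, hg]
    calc _ = (C c * C c⁻¹) * ((∏ h, linForm (aL h)) * g0 j) := by ring
      _ = _ := by rw [← C_mul, mul_inv_cancel₀ hc, C_1, one_mul]
  have hrel : ∀ i, X i ^ q - X i = ∑ j, g j * Θ j i := by
    intro i
    have h1 := congrFun (Matrix.mulVec_cramer Θ.transpose fun i => X i ^ q - X i) i
    simp only [Matrix.mulVec, dotProduct, Matrix.transpose_apply, Matrix.cramer_transpose_apply,
      ← hgdet, Matrix.det_transpose, Pi.smul_apply, smul_eq_mul] at h1
    refine mul_left_cancel₀ hdet0 ?_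
    rw [← h1, Finset.mul_sum]
    exact Finset.sum_congr rfl fun j _ => by ring
  have hdetdeg : Θ.det.totalDegree = ∑ j, m j := by
    rw [hdet, hm, totalDegree_mul_of_isDomain (C_ne_zero.2 hc)
      (Finset.prod_ne_zero_iff.2 fun h _ => linForm_ne_zero (haL0 h)), totalDegree_C, zero_add,
      totalDegree_prod_linForm _ _ fun h _ => haL0 h, Finset.card_univ]
  have hgdeg : ∀ j, (g j).totalDegree ≤ q - m j := by
    intro j
    by_cases hgj : g j = 0
    · simp [hgj]
    have h1 := totalDegree_mul_of_isDomain hdet0 hgj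
    rw [hgdet, hdetdeg] at h1
    have h2 := totalDegree_det_le (Θ.updateRow j fun i => X i ^ q - X i)
      (Function.update m j q) (by
        intro k i
        by_cases hk : k = j
        · subst hk
          simp only [Matrix.updateRow_self, Function.update_self]
          refine (totalDegree_sub _ _).trans (max_le ?_ ?_)
          · rw [totalDegree_X_pow]
          · rw [totalDegree_X]; omega
        · simp only [Matrix.updateRow_ne hk, Function.update_of_ne hk]
          exact hΘ k i)
    rw [Finset.sum_update_of_mem (Finset.mem_univ j)] at h2
    rw [← Finset.add_sum_erase _ _ (Finset.mem_univ j), ← Finset.sdiff_singleton_eq_erase] at h1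
    omega
  -- the points of the complement are the common zeros of the coefficients
  have hout : ∀ v : σ → F, (∀ h, a h ⬝ᵥ v ≠ 0) → ∀ j,
      eval (fun i => algebraMap F L (v i)) (g j) = 0 := by
    intro v hv j
    have h1 := congrArg (eval fun i => algebraMap F L (v i)) (hgdet j)
    have h2 : eval (fun i => algebraMap F L (v i))
        (Θ.updateRow j fun i => X i ^ q - X i).det = 0 := by
      rw [RingHom.map_det]
      refine Matrix.det_eq_zero_of_row_eq_zero j fun i => ?_
      rw [RingHom.mapMatrix_apply, Matrix.map_apply, Matrix.updateRow_self, map_sub, map_pow, eval_X,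
        ← map_pow, hq, FiniteField.pow_card, sub_self]
    rw [h2, map_mul] at h1
    refine (mul_eq_zero.1 h1).resolve_left ?_
    rw [hdet, map_mul, eval_C, map_prod]
    refine mul_ne_zero hc (Finset.prod_ne_zero_iff.2 fun h _ => ?_)
    rw [eval_linForm, hdot]
    simpa using hv h
  have hin : ∀ v : σ → F, ¬ (∀ h, a h ⬝ᵥ v ≠ 0) → ∃ j,
      eval (fun i => algebraMap F L (v i)) (g j) ≠ 0 := by
    intro v hv
    by_contra! hall
    push Not at hv
    obtain ⟨h, hh⟩ := hv
    have h1 : linForm (aL h) ^ (q - 1) - 1 = ∑ j, g j * b h j := by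
      refine mul_left_cancel₀ (linForm_ne_zero (haL0 h)) ?_
      rw [← hfrob, Finset.mul_sum]
      calc ∑ i, C (aL h i) * (X i ^ q - X i) = ∑ i, ∑ j, g j * (C (aL h i) * Θ j i) := by
            refine Finset.sum_congr rfl fun i _ => ?_
            rw [hrel, Finset.mul_sum]
            exact Finset.sum_congr rfl fun j _ => by ring
        _ = ∑ j, g j * ∑ i, C (aL h i) * Θ j i := by
            rw [Finset.sum_comm]
            simp only [Finset.mul_sum]
        _ = _ := by
            refine Finset.sum_congr rfl fun j _ => ?_
            rw [hb]; ring
    have h2 := congrArg (eval fun i => algebraMap F L (v i)) h1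
    rw [map_sub, map_pow, eval_linForm, hdot, hh, map_zero, zero_pow (by omega), map_one, map_sum,
      Finset.sum_eq_zero (fun j _ => by rw [map_mul, hall j, zero_mul])] at h2
    simp at h2
  have hmem : ∀ i, X i ^ q - X i ∈ Ideal.span (Set.range g) := fun i => by
    rw [hrel]
    exact Ideal.sum_mem _ fun j _ => Ideal.mul_mem_right _ _ (Ideal.subset_span ⟨j, rfl⟩)
  refine card_fiber rfl g (fun j => q - m j) m (fun j => ?_) hgdeg Θ hΘ q hq2
    (fun j => ?_) hrel _ (fun v i => algebraMap F L (v i)) (fun v hv => ?_) (pointIndicator L)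
    (fun v _ w _ h => eval_pointIndicator_of_ne h) (fun v _ => eval_pointIndicator_self v)
    fun p => ?_
  · have := hmq j; omega
  · have := hmq j; omega
  · exact hout v (Finset.mem_filter.1 hv).2
  · refine ⟨fun v => eval (fun i => algebraMap F L (v i)) p, ?_⟩
    have h1 : p = ∑ v : σ → F, p * pointIndicator L v := by
      rw [← Finset.mul_sum, sum_pointIndicator, mul_one]
    have h2 : ∑ v ∈ Finset.univ.filter (fun v : σ → F => ¬ ∀ h, a h ⬝ᵥ v ≠ 0),
        p * pointIndicator L v ∈ Ideal.span (Set.range g) := by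
      refine Ideal.sum_mem _ fun v hv => Ideal.mul_mem_left _ _ ?_
      obtain ⟨j, hj⟩ := hin v (Finset.mem_filter.1 hv).2
      have h3 := mul_pointIndicator_sub_mem (L := L) hmem v (g j)
      have hgj : g j ∈ Ideal.span (Set.range g) := Ideal.subset_span ⟨j, rfl⟩
      have h4 := (Submodule.sub_mem_iff_right _ (Ideal.mul_mem_right (pointIndicator L v) _ hgj)).1 h3
      have h5 := Ideal.mul_mem_left _ (C (eval (fun i => algebraMap F L (v i)) (g j))⁻¹) h4
      rwa [← mul_assoc, ← C_mul, inv_mul_cancel₀ hj, C_1, one_mul] at h5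
    have h3 : ∑ v ∈ Finset.univ.filter (fun v : σ → F => ∀ h, a h ⬝ᵥ v ≠ 0),
        (p * pointIndicator L v - C (eval (fun i => algebraMap F L (v i)) p) *
          pointIndicator L v) ∈ Ideal.span (Set.range g) :=
      Ideal.sum_mem _ fun v _ => mul_pointIndicator_sub_mem hmem v p
    have h4 := Ideal.add_mem _ h3 h2
    rw [Finset.sum_sub_distrib, sub_add_eq_add_sub, Finset.sum_filter_add_sum_filter_not,
      ← h1] at h4
    exact h4

end FiniteField

/-! ### The characteristic polynomial of a family of linear forms -/

section Rank

variable {K : Type*} [Field K] {μ σ : Type*} [Fintype μ] [Fintype σ] [DecidableEq μ] [DecidableEq σ]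

/-- A matrix of rank `r` is the product of a left invertible matrix with `r` columns and a right
invertible one with `r` rows. By `finrank_ker_of_factorization` this property, which is preserved
by ring homomorphisms, determines the rank. -/
theorem exists_rank_factorization (M : Matrix μ σ K) :
    ∃ (r : ℕ) (x : Matrix μ (Fin r) K) (y : Matrix (Fin r) σ K) (x' : Matrix (Fin r) μ K)
      (y' : Matrix σ (Fin r) K), M = x * y ∧ x' * x = 1 ∧ y * y' = 1 := by
  set f := Matrix.toLin' M with hf
  set e := (Module.finBasis K (LinearMap.range f)).equivFun with he
  set y : (σ → K) →ₗ[K] (Fin (Module.finrank K (LinearMap.range f)) → K) :=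
    e.toLinearMap ∘ₗ f.rangeRestrict with hy
  set x : (Fin (Module.finrank K (LinearMap.range f)) → K) →ₗ[K] (μ → K) :=
    (LinearMap.range f).subtype ∘ₗ e.symm.toLinearMap with hx
  have hxy : f = x ∘ₗ y := by
    ext v i
    simp [hx, hy]
  obtain ⟨y', hy'⟩ := y.exists_rightInverse_of_surjective (by
    rw [LinearMap.range_eq_top, hy, LinearMap.coe_comp]
    exact e.surjective.comp f.surjective_rangeRestrict)
  obtain ⟨x', hx'⟩ := x.exists_leftInverse_of_injective (by
    rw [LinearMap.ker_eq_bot, hx, LinearMap.coe_comp]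
    exact (Submodule.injective_subtype _).comp e.symm.injective)
  refine ⟨_, LinearMap.toMatrix' x, LinearMap.toMatrix' y, LinearMap.toMatrix' x',
    LinearMap.toMatrix' y', ?_, ?_, ?_⟩
  · rw [← LinearMap.toMatrix'_comp, ← hxy, hf, LinearMap.toMatrix'_toLin']
  · rw [← LinearMap.toMatrix'_comp, hx', LinearMap.toMatrix'_id]
  · rw [← LinearMap.toMatrix'_comp, hy', LinearMap.toMatrix'_id]

omit [Fintype μ] [DecidableEq μ] [DecidableEq σ] in
theorem finrank_ker_of_factorization [Fintype μ] {r : ℕ} {M : Matrix μ σ K}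
    {x : Matrix μ (Fin r) K} {y : Matrix (Fin r) σ K} {x' : Matrix (Fin r) μ K}
    {y' : Matrix σ (Fin r) K} (h : M = x * y) (hx : x' * x = 1) (hy : y * y' = 1) :
    Module.finrank K (LinearMap.ker M.mulVecLin) = Fintype.card σ - r := by
  have h1 : LinearMap.ker M.mulVecLin = LinearMap.ker y.mulVecLin := by
    ext v
    simp only [LinearMap.mem_ker, Matrix.mulVecLin_apply, h, ← Matrix.mulVec_mulVec]
    refine ⟨fun h0 => ?_, fun h0 => by rw [h0, Matrix.mulVec_zero]⟩
    have := congrArg x'.mulVec h0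
    rwa [Matrix.mulVec_mulVec, hx, Matrix.one_mulVec, Matrix.mulVec_zero] at this
  have h2 : LinearMap.range y.mulVecLin = ⊤ := by
    rw [LinearMap.range_eq_top]
    intro w
    refine ⟨y'.mulVec w, ?_⟩
    rw [Matrix.mulVecLin_apply, Matrix.mulVec_mulVec, hy, Matrix.one_mulVec]
  have h3 := y.mulVecLin.finrank_range_add_finrank_ker
  rw [h2, finrank_top, Module.finrank_fin_fun, Module.finrank_fintype_fun_eq_card] at h3
  rw [h1]
  omega

end Rank

section CoordCharPoly

variable {K : Type*} [Field K] {σ ι : Type*} [Fintype σ] [Fintype ι]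

/-- The matrix of the forms with index in `B`. -/
def subMatrix {R : Type*} (a : ι → σ → R) (B : Finset ι) : Matrix B σ R := Matrix.of fun h => a h

/-- The characteristic polynomial of the arrangement of the kernels of a family of linear forms, in
Whitney's form: an alternating sum over all subfamilies. -/
def whitneyPoly (a : ι → σ → K) : ℤ[X] :=
  ∑ B : Finset ι, Polynomial.C ((-1) ^ B.card) *
    Polynomial.X ^ Module.finrank K (LinearMap.ker (subMatrix a B).mulVecLin)

/-- Over a finite field with `q` elements, the value of the characteristic polynomial at `q` is the
number of points of the complement, by inclusion and exclusion. -/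
theorem eval_whitneyPoly_card [Fintype K] [DecidableEq K] [DecidableEq σ] (a : ι → σ → K) :
    (whitneyPoly a).eval (Fintype.card K : ℤ) =
      (Finset.univ.filter fun v : σ → K => ∀ h, a h ⬝ᵥ v ≠ 0).card := by
  classical
  have h1 := Finset.inclusion_exclusion_card_inf_compl (Finset.univ : Finset ι)
    (fun h => Finset.univ.filter fun v : σ → K => a h ⬝ᵥ v = 0)
  have h2 : (Finset.univ.inf fun h => (Finset.univ.filter fun v : σ → K => a h ⬝ᵥ v = 0)ᶜ) =
      Finset.univ.filter fun v : σ → K => ∀ h, a h ⬝ᵥ v ≠ 0 := by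
    ext v
    simp [Finset.mem_inf]
  rw [h2, Finset.powerset_univ] at h1
  rw [h1, whitneyPoly, Polynomial.eval_finsetSum]
  refine Finset.sum_congr rfl fun B _ => ?_
  simp only [Polynomial.eval_mul, Polynomial.eval_pow, Polynomial.eval_X, Polynomial.eval_C]
  congr 1
  rw [← Nat.cast_pow, ← Module.card_eq_pow_finrank, ← Fintype.card_coe]
  congr 1
  refine Fintype.card_congr (Equiv.subtypeEquivRight fun v => ?_)
  rw [LinearMap.mem_ker, Matrix.mulVecLin_apply, Finset.mem_inf]
  constructor
  · intro h0 h hB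
    simpa [Matrix.mulVec, subMatrix] using congrFun h0 ⟨h, hB⟩
  · intro h0
    funext h
    simpa [Matrix.mulVec, subMatrix] using h0 h h.2

end CoordCharPoly

/-! ### Reduction to finite fields and the factorization of the characteristic polynomial -/

section Factorization

open MvPolynomial

theorem isJacobsonRing_int : IsJacobsonRing ℤ := by
  rw [isJacobsonRing_iff_prime_eq]
  intro P hP
  by_cases hP0 : P = ⊥
  · subst hP0
    refine le_antisymm (fun x hx => ?_) Ideal.le_jacobson
    have h1 := Ideal.mem_jacobson_bot.1 hx x
    rw [Int.isUnit_iff] at h1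
    rw [Ideal.mem_bot]
    rcases h1 with h1 | h1
    · exact mul_self_eq_zero.1 (by linarith)
    · nlinarith [mul_self_nonneg x]
  · have := Ring.DimensionLEOne.maximalOfPrime hP0 hP
    exact Ideal.jacobson_eq_self_of_isMaximal

/-- A nonzero ring of finite type over `ℤ` has a finite residue field. -/
theorem exists_hom_finite_field (R : Type*) [CommRing R] [Nontrivial R] [Algebra.FiniteType ℤ R] :
    ∃ (I : Ideal R) (_ : I.IsMaximal), Finite (R ⧸ I) := by
  obtain ⟨I, hI⟩ := Ideal.exists_maximal R
  refine ⟨I, hI, ?_⟩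
  let _ := Ideal.Quotient.field I
  have := isJacobsonRing_int
  have hft : Algebra.FiniteType ℤ (R ⧸ I) :=
    Algebra.FiniteType.of_surjective (Ideal.Quotient.mkₐ ℤ I) (Ideal.Quotient.mkₐ_surjective ℤ I)
  have hfin : Module.Finite ℤ (R ⧸ I) := finite_of_finite_type_of_isJacobsonRing ℤ (R ⧸ I)
  -- a field that is finite over `ℤ` has positive characteristic
  obtain ⟨p, hp⟩ := CharP.exists (R ⧸ I)
  rcases Nat.eq_zero_or_pos p with rfl | hpos
  · exfalso
    have hc0 : CharZero (R ⧸ I) := CharP.charP_to_charZero _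
    have hint : Algebra.IsIntegral ℤ (R ⧸ I) := Algebra.IsIntegral.of_finite ℤ (R ⧸ I)
    have hf := isField_of_isIntegral_of_isField (R := ℤ) (S := R ⧸ I)
      (algebraMap ℤ (R ⧸ I)).injective_int (Field.toIsField (R ⧸ I))
    exact Int.not_isField hf
  · have hpn : NeZero p := ⟨hpos.ne'⟩
    let _ := ZMod.algebra (R ⧸ I) p
    have : IsScalarTower ℤ (ZMod p) (R ⧸ I) := IsScalarTower.of_algebraMap_eq fun x => by simp
    have : Module.Finite (ZMod p) (R ⧸ I) := Module.Finite.of_restrictScalars_finite ℤ _ _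
    exact Module.finite_of_finite (ZMod p)

theorem exists_large_finite_intermediateField (E L : Type*) [Field E] [Field L] [Algebra E L]
    [Finite E] [Infinite L] [Algebra.IsAlgebraic E L] (N : ℕ) :
    ∃ F : IntermediateField E L, Finite F ∧ N < Nat.card F := by
  obtain ⟨t, ht⟩ := Infinite.exists_subset_card_eq L (N + 1)
  have hfd : FiniteDimensional E (IntermediateField.adjoin E (t : Set L)) :=
    IntermediateField.finiteDimensional_adjoin fun x _ => Algebra.IsIntegral.isIntegral x
  have hfin : Finite (IntermediateField.adjoin E (t : Set L)) := Module.finite_of_finite E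
  refine ⟨_, hfin, ?_⟩
  have h1 : Nat.card t ≤ Nat.card (IntermediateField.adjoin E (t : Set L)) :=
    Nat.card_le_card_of_injective
      (fun x : t => (⟨x.1, IntermediateField.subset_adjoin E _ x.2⟩ :
        IntermediateField.adjoin E (t : Set L))) fun x y h => by
          exact Subtype.ext (Subtype.mk.inj h)
  rw [Nat.card_eq_fintype_card, Fintype.card_coe, ht] at h1
  omega

theorem totalDegree_map_le' {R R' σ : Type*} [CommRing R] [CommRing R'] (f : R →+* R')
    (p : MvPolynomial σ R) : (map f p).totalDegree ≤ p.totalDegree :=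
  Finset.sup_mono (support_map_subset f p)

theorem totalDegree_map_injective {R R' σ : Type*} [CommRing R] [CommRing R'] {f : R →+* R'}
    (hf : Function.Injective f) (p : MvPolynomial σ R) :
    (map f p).totalDegree = p.totalDegree := by
  rw [totalDegree, support_map_of_injective p hf, totalDegree]

theorem matrix_mul_eq_of_map {R R' α β γ : Type*} [CommRing R] [CommRing R'] [Fintype β]
    {j : R →+* R'} (hj : Function.Injective j) {A : Matrix α β R} {B : Matrix β γ R}
    {D : Matrix α γ R} {A' : Matrix α β R'} {B' : Matrix β γ R'} {D' : Matrix α γ R'}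
    (hA : A.map j = A') (hB : B.map j = B') (hD : D.map j = D') (h : A' * B' = D') :
    A * B = D := by
  have h1 : (A * B).map j = D.map j := by rw [Matrix.map_mul, hA, hB, hD, h]
  exact Matrix.map_injective hj h1

/-- Terao's factorization theorem for a family of linear forms: if the logarithmic derivations have
a basis of degrees `m j`, in the form of Saito's criterion, the characteristic polynomial is
`∏ (t - m j)`. All data are defined over a finitely generated ring, so they can be reduced to finite
fields of arbitrarily large order `q`, where both sides at `t = q` count the complement. -/
theorem whitneyPoly_eq_prod {K : Type*} [Field K] {σ ι : Type*} [Fintype σ] [DecidableEq σ]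
    [Fintype ι] (a : ι → σ → K)
    (ha : ∀ h, a h ≠ 0) (hpair : ∀ h h', h ≠ h' → ∃ u, a h ⬝ᵥ u = 0 ∧ a h' ⬝ᵥ u = 1)
    (m : σ → ℕ) (hm : ∑ j, m j = Fintype.card ι)
    (Θ : Matrix σ σ (MvPolynomial σ K)) (hΘ : ∀ j i, (Θ j i).totalDegree ≤ m j)
    (b : ι → σ → MvPolynomial σ K) (hb : ∀ h j, ∑ i, C (a h i) * Θ j i = linForm (a h) * b h j)
    {c : K} (hc : c ≠ 0) (hdet : Θ.det = C c * ∏ h, linForm (a h)) :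
    whitneyPoly a = ∏ j, (Polynomial.X - Polynomial.C (m j : ℤ)) := by
  classical
  have hone : ∀ h, ∃ u, a h ⬝ᵥ u = 1 := fun h => by
    obtain ⟨i, hi⟩ := Function.ne_iff.1 (ha h)
    exact ⟨Pi.single i (a h i)⁻¹, by simpa using mul_inv_cancel₀ hi⟩
  choose w hw using hone
  have hpair' : ∀ h h', ∃ u, h ≠ h' → a h ⬝ᵥ u = 0 ∧ a h' ⬝ᵥ u = 1 := fun h h' => by
    by_cases hne : h = h'
    · exact ⟨0, fun h0 => absurd hne h0⟩
    · obtain ⟨u, hu⟩ := hpair h h' hne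
      exact ⟨u, fun _ => hu⟩
  choose u hu using hpair'
  choose r x y x' y' hxy hx hy using fun B => exists_rank_factorization (subMatrix a B)
  -- a finitely generated ring containing all the data
  set s : Set K := (⋃ h, Set.range (a h)) ∪ (⋃ h, Set.range (w h)) ∪
    (⋃ h, ⋃ h', Set.range (u h h')) ∪ (⋃ j, ⋃ i, ((Θ j i).coeffs : Set K)) ∪
    (⋃ h, ⋃ j, ((b h j).coeffs : Set K)) ∪ {c, c⁻¹} ∪
    (⋃ B, ⋃ i, Set.range (x B i)) ∪ (⋃ B, ⋃ i, Set.range (y B i)) ∪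
    (⋃ B, ⋃ i, Set.range (x' B i)) ∪ (⋃ B, ⋃ i, Set.range (y' B i)) with hs
  have hsfin : s.Finite := by
    have h1 : ∀ p : MvPolynomial σ K, (p.coeffs : Set K).Finite := fun p => Finset.finite_toSet _
    refine Set.Finite.union (Set.Finite.union (Set.Finite.union (Set.Finite.union (Set.Finite.union
      (Set.Finite.union (Set.Finite.union (Set.Finite.union (Set.Finite.union ?_ ?_) ?_) ?_) ?_)
      (Set.toFinite _)) ?_) ?_) ?_) ?_
    all_goals first
      | exact Set.finite_iUnion fun _ => Set.finite_range _
      | exact Set.finite_iUnion fun _ => Set.finite_iUnion fun _ => Set.finite_range _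
      | exact Set.finite_iUnion fun _ => Set.finite_iUnion fun _ => h1 _
  set R := Algebra.adjoin ℤ s with hR
  have hsub : ∀ z ∈ s, z ∈ R := fun z hz => Algebra.subset_adjoin hz
  have hft : Algebra.FiniteType ℤ R := by
    rw [← Subalgebra.fg_iff_finiteType]
    have := Subalgebra.fg_adjoin_finset (R := ℤ) hsfin.toFinset
    rwa [hsfin.coe_toFinset] at this
  set j : R →+* K := R.val.toRingHom with hj
  have hjinj : Function.Injective j := Subtype.val_injective
  have hlift : ∀ z ∈ s, ∃ z', j z' = z := fun z hz => ⟨⟨z, hsub z hz⟩, rfl⟩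
  have hplift : ∀ p : MvPolynomial σ K, (p.coeffs : Set K) ⊆ s → ∃ p', map j p' = p := fun p hp =>
    mem_range_map_iff_coeffs_subset.2 fun z hz => hlift z (hp hz)
  choose aR haR using fun h i => hlift (a h i) (by
    simp only [hs, Set.mem_union, Set.mem_iUnion, Set.mem_range]
    iterate 9 left
    exact ⟨h, i, rfl⟩)
  choose wR hwR using fun h i => hlift (w h i) (by
    simp only [hs, Set.mem_union, Set.mem_iUnion, Set.mem_range]
    iterate 8 left
    exact Or.inr ⟨h, i, rfl⟩)
  choose uR huR using fun h h' i => hlift (u h h' i) (by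
    simp only [hs, Set.mem_union, Set.mem_iUnion, Set.mem_range]
    iterate 7 left
    exact Or.inr ⟨h, h', i, rfl⟩)
  choose ΘR hΘR using fun k i => hplift (Θ k i) (fun z hz => by
    simp only [hs, Set.mem_union, Set.mem_iUnion, Set.mem_range]
    iterate 6 left
    exact Or.inr ⟨k, i, hz⟩)
  choose bR hbR using fun h k => hplift (b h k) (fun z hz => by
    simp only [hs, Set.mem_union, Set.mem_iUnion, Set.mem_range]
    iterate 5 left
    exact Or.inr ⟨h, k, hz⟩)
  obtain ⟨cR, hcR⟩ := hlift c (by simp [hs])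
  obtain ⟨dR, hdR⟩ := hlift c⁻¹ (by simp [hs])
  choose xR hxR using fun B i k => hlift (x B i k) (by
    simp only [hs, Set.mem_union, Set.mem_iUnion, Set.mem_range]
    iterate 3 left
    exact Or.inr ⟨B, i, k, rfl⟩)
  choose yR hyR using fun B i k => hlift (y B i k) (by
    simp only [hs, Set.mem_union, Set.mem_iUnion, Set.mem_range]
    iterate 2 left
    exact Or.inr ⟨B, i, k, rfl⟩)
  choose xR' hxR' using fun B i k => hlift (x' B i k) (by
    simp only [hs, Set.mem_union, Set.mem_iUnion, Set.mem_range]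
    left
    exact Or.inr ⟨B, i, k, rfl⟩)
  choose yR' hyR' using fun B i k => hlift (y' B i k) (by
    simp only [hs, Set.mem_union, Set.mem_iUnion, Set.mem_range]
    exact Or.inr ⟨B, i, k, rfl⟩)
  -- the identities between the lifted data
  have haR' : ∀ h, (j ∘ aR h) = a h := fun h => funext (haR h)
  have hwid : ∀ h, aR h ⬝ᵥ wR h = 1 := fun h => hjinj (by
    rw [RingHom.map_dotProduct, haR', map_one, ← hw h]
    congr 1
    exact funext (hwR h))
  have huid : ∀ h h', h ≠ h' → aR h ⬝ᵥ uR h h' = 0 ∧ aR h' ⬝ᵥ uR h h' = 1 := fun h h' hne => by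
    have h1 : j ∘ uR h h' = u h h' := funext (huR h h')
    refine ⟨hjinj ?_, hjinj ?_⟩
    · rw [RingHom.map_dotProduct, haR', h1, map_zero, (hu h h' hne).1]
    · rw [RingHom.map_dotProduct, haR', h1, map_one, (hu h h' hne).2]
  have hcd : cR * dR = 1 := hjinj (by rw [map_mul, hcR, hdR, map_one, mul_inv_cancel₀ hc])
  have hlin : ∀ h, map j (∑ i, C (aR h i) * X i) = linForm (a h) := fun h => by
    simp [linForm, haR]
  have hbid : ∀ h k, ∑ i, C (aR h i) * ΘR k i = (∑ i, C (aR h i) * X i) * bR h k := fun h k =>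
    map_injective j hjinj (by
      rw [map_mul, hlin, hbR, ← hb, map_sum]
      exact Finset.sum_congr rfl fun i _ => by rw [map_mul, map_C, haR, hΘR])
  have hdetid : (Matrix.of ΘR).det = C cR * ∏ h, ∑ i, C (aR h i) * X i :=
    map_injective j hjinj (by
      rw [RingHom.map_det, map_mul, map_prod, map_C, hcR, Finset.prod_congr rfl fun h _ => hlin h,
        ← hdet]
      congr 1
      exact Matrix.ext fun k i => hΘR k i)
  -- the finite fields
  obtain ⟨I, hI, hfin⟩ := exists_hom_finite_field R
  let _ := Ideal.Quotient.field I
  set L := AlgebraicClosure (R ⧸ I)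
  refine Polynomial.eq_of_infinite_eval_eq _ _ (Set.infinite_of_forall_exists_gt fun N => ?_)
  obtain ⟨F, hF, hcard⟩ := exists_large_finite_intermediateField (R ⧸ I) L (N.toNat + ∑ k, m k)
  let _ : Fintype F := Fintype.ofFinite F
  rw [Nat.card_eq_fintype_card] at hcard
  refine ⟨(Fintype.card F : ℤ), ?_, by omega⟩
  set g : R →+* F := (algebraMap (R ⧸ I) F).comp (Ideal.Quotient.mk I) with hg
  set f : R →+* L := (algebraMap F L).comp g with hf
  set aF : ι → σ → F := fun h i => g (aR h i) with haF
  have hlinF : ∀ h, map f (∑ i, C (aR h i) * X i) = linForm fun i => algebraMap F L (aF h i) :=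
    fun h => by simp [linForm, haF, hf]
  have hwhit : whitneyPoly a = whitneyPoly aF := by
    refine Finset.sum_congr rfl fun B _ => ?_
    have e1 : Matrix.of (xR B) * Matrix.of (yR B) = subMatrix aR B :=
      matrix_mul_eq_of_map hjinj (Matrix.ext (hxR B)) (Matrix.ext (hyR B))
        (Matrix.ext fun i k => haR i k) (hxy B).symm
    have e2 : Matrix.of (xR' B) * Matrix.of (xR B) = 1 :=
      matrix_mul_eq_of_map hjinj (Matrix.ext (hxR' B)) (Matrix.ext (hxR B))
        (Matrix.map_one _ (map_zero j) (map_one j)) (hx B)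
    have e3 : Matrix.of (yR B) * Matrix.of (yR' B) = 1 :=
      matrix_mul_eq_of_map hjinj (Matrix.ext (hyR B)) (Matrix.ext (hyR' B))
        (Matrix.map_one _ (map_zero j) (map_one j)) (hy B)
    rw [finrank_ker_of_factorization (hxy B) (hx B) (hy B)]
    have h1 : subMatrix aF B = (Matrix.of (xR B)).map g * (Matrix.of (yR B)).map g := by
      rw [← Matrix.map_mul, e1]; rfl
    have h2 : (Matrix.of (xR' B)).map g * (Matrix.of (xR B)).map g = 1 := by
      rw [← Matrix.map_mul, e2, Matrix.map_one _ (map_zero g) (map_one g)]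
    have h3 : (Matrix.of (yR B)).map g * (Matrix.of (yR' B)).map g = 1 := by
      rw [← Matrix.map_mul, e3, Matrix.map_one _ (map_zero g) (map_one g)]
    rw [finrank_ker_of_factorization h1 h2 h3]
  have hmF : ∀ k, m k < Fintype.card F := fun k => by
    have := Finset.single_le_sum (f := m) (fun _ _ => Nat.zero_le _) (Finset.mem_univ k)
    omega
  have hmain := card_complement (F := F) (L := L) aF
    (fun h h0 => by
      have h1 := congrArg g (hwid h)
      rw [RingHom.map_dotProduct, map_one] at h1
      have h2 : g ∘ aR h = 0 := h0
      rw [h2, zero_dotProduct] at h1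
      exact zero_ne_one h1)
    (fun h h' hne => by
      refine ⟨g ∘ uR h h', ?_, ?_⟩
      · have h1 := congrArg g (huid h h' hne).1
        rwa [RingHom.map_dotProduct, map_zero] at h1
      · have h1 := congrArg g (huid h h' hne).2
        rwa [RingHom.map_dotProduct, map_one] at h1)
    m hm hmF (Matrix.of fun k i => map f (ΘR k i))
    (fun k i => by
      refine (totalDegree_map_le' f _).trans ?_
      rw [← totalDegree_map_injective hjinj, hΘR]
      exact hΘ k i)
    (fun h k => map f (bR h k))
    (fun h k => by
      rw [← hlinF, ← map_mul, ← hbid, map_sum]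
      exact Finset.sum_congr rfl fun i _ => by rw [map_mul, map_C]; rfl)
    (c := f cR)
    (fun h0 => by
      have h1 := congrArg f hcd
      rw [map_mul, h0, zero_mul, map_one] at h1
      exact zero_ne_one h1)
    (by
      have h1 := congrArg (map f) hdetid
      rw [RingHom.map_det, map_mul, map_prod, map_C,
        Finset.prod_congr rfl fun h _ => hlinF h] at h1
      exact h1)
  rw [Set.mem_ofPred_eq, hwhit, eval_whitneyPoly_card, hmain, Polynomial.eval_prod, Nat.cast_prod]
  refine Finset.prod_congr rfl fun k _ => ?_
  rw [Nat.cast_sub (hmF k).le]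
  simp

end Factorization

/-! ### Logarithmic vector fields in coordinates and Saito's criterion -/

section LogFields

open MvPolynomial

variable {K : Type*} [Field K] {σ ι : Type*} [Fintype σ]

/-- A family of nonzero linear forms with pairwise different kernels, the latter in the form of a
point that separates them. -/
structure IsSimpleFamily (a : ι → σ → K) : Prop where
  ne_zero : ∀ h, a h ≠ 0
  separated : ∀ h h', h ≠ h' → ∃ u, a h ⬝ᵥ u = 0 ∧ a h' ⬝ᵥ u = 1

/-- The logarithmic vector fields of a family of linear forms, a vector field being given by its
components. -/
def logFields (a : ι → σ → K) : Submodule (MvPolynomial σ K) (σ → MvPolynomial σ K) where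
  carrier := {θ | ∀ h, linForm (a h) ∣ ∑ i, C (a h i) * θ i}
  add_mem' := fun h1 h2 h => by
    simp only [Pi.add_apply, mul_add, Finset.sum_add_distrib]
    exact dvd_add (h1 h) (h2 h)
  zero_mem' := fun h => by simp
  smul_mem' := fun c θ hθ h => by
    have h1 : ∑ i, C (a h i) * (c • θ) i = c * ∑ i, C (a h i) * θ i := by
      rw [Finset.mul_sum]
      exact Finset.sum_congr rfl fun i _ => by rw [Pi.smul_apply, smul_eq_mul]; ring
    rw [h1]
    exact Dvd.dvd.mul_left (hθ h) c

theorem mem_logFields {a : ι → σ → K} {θ : σ → MvPolynomial σ K} :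
    θ ∈ logFields a ↔ ∀ h, linForm (a h) ∣ ∑ i, C (a h i) * θ i := Iff.rfl

/-- The vector fields `Θ j` form a basis of the logarithmic vector fields, and `Θ j` is homogeneous
of degree `m j`. -/
structure IsLogBasis {τ : Type*} (a : ι → σ → K) (Θ : τ → σ → MvPolynomial σ K) (m : τ → ℕ) :
    Prop where
  linearIndependent : LinearIndependent (MvPolynomial σ K) Θ
  span_eq : Submodule.span (MvPolynomial σ K) (Set.range Θ) = logFields a
  homogeneous : ∀ j i, (Θ j i).IsHomogeneous (m j)

theorem IsLogBasis.mem {τ : Type*} {a : ι → σ → K} {Θ : τ → σ → MvPolynomial σ K} {m : τ → ℕ}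
    (h : IsLogBasis a Θ m) (j : τ) : Θ j ∈ logFields a := by
  rw [← h.span_eq]
  exact Submodule.subset_span ⟨j, rfl⟩

theorem IsLogBasis.reindex {τ τ' : Type*} {a : ι → σ → K} {Θ : τ → σ → MvPolynomial σ K}
    {m : τ → ℕ} (h : IsLogBasis a Θ m) (e : τ' ≃ τ) : IsLogBasis a (Θ ∘ e) (m ∘ e) where
  linearIndependent := h.linearIndependent.comp e e.injective
  span_eq := by rw [Set.range_comp, e.surjective.range_eq, Set.image_univ, h.span_eq]
  homogeneous := fun j i => h.homogeneous (e j) i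

theorem IsSimpleFamily.isRelPrime {a : ι → σ → K} (ha : IsSimpleFamily a) {h h' : ι} (hne : h ≠ h') :
    IsRelPrime (linForm (a h)) (linForm (a h')) := by
  obtain ⟨u, h1, h2⟩ := ha.separated h h' hne
  exact linForm_isRelPrime (ha.ne_zero h) h1 (by rw [h2]; exact one_ne_zero)

theorem IsSimpleFamily.not_dvd {a : ι → σ → K} (ha : IsSimpleFamily a) {h h' : ι} (hne : h ≠ h') :
    ¬ linForm (a h) ∣ linForm (a h') := by
  obtain ⟨u, h1, h2⟩ := ha.separated h h' hne
  exact linForm_not_dvd h1 (by rw [h2]; exact one_ne_zero)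

variable [DecidableEq σ]

omit [Fintype σ] [DecidableEq σ] in
theorem det_isHomogeneous {τ : Type*} [Fintype τ] [DecidableEq τ]
    (N : Matrix τ τ (MvPolynomial σ K)) (k : τ → ℕ)
    (h : ∀ i j, (N i j).IsHomogeneous (k i)) : N.det.IsHomogeneous (∑ i, k i) := by
  rw [Matrix.det_apply']
  refine IsHomogeneous.sum _ _ _ fun s _ => ?_
  rw [← map_intCast (C : K →+* MvPolynomial σ K), ← Equiv.sum_comp s k]
  exact (IsHomogeneous.prod _ _ _ fun i _ => h _ _).C_mul _

theorem IsLogBasis.det_dvd {a : ι → σ → K} {Θ : σ → σ → MvPolynomial σ K} {m : σ → ℕ}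
    (hΘ : IsLogBasis a Θ m) (N : Matrix σ σ (MvPolynomial σ K)) (hN : ∀ k, N k ∈ logFields a) :
    (Matrix.of Θ).det ∣ N.det := by
  have h1 : ∀ k, ∃ c : σ → MvPolynomial σ K, ∑ j, c j • Θ j = N k := fun k => by
    rw [← Submodule.mem_span_range_iff_exists_fun, hΘ.span_eq]
    exact hN k
  choose c hc using h1
  have h2 : N = Matrix.of c * Matrix.of Θ := by
    ext1 k i
    rw [← hc, Matrix.mul_apply]
    simp
  rw [h2, Matrix.det_mul]
  exact dvd_mul_left _ _

/-- Saito's criterion: the coefficient determinant of a basis of the logarithmic vector fields is a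
nonzero multiple of the product of the forms. The quotient is a unit, for it divides a power of
the product, while for each form `α` it divides a power of the product of the other ones, which is
seen from logarithmic vector fields that are tangent to the kernel of `α`. -/
theorem IsLogBasis.det_eq [Fintype ι] {a : ι → σ → K} (ha : IsSimpleFamily a)
    {Θ : σ → σ → MvPolynomial σ K} {m : σ → ℕ} (hΘ : IsLogBasis a Θ m) :
    ∃ c : K, c ≠ 0 ∧ (Matrix.of Θ).det = C c * ∏ h, linForm (a h) := by
  classical
  set Q := ∏ h, linForm (a h) with hQ
  have hQ0 : Q ≠ 0 := Finset.prod_ne_zero_iff.2 fun h _ => linForm_ne_zero (ha.ne_zero h)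
  have hQd : Q ∣ (Matrix.of Θ).det := by
    refine Fintype.prod_dvd_of_isRelPrime (fun h h' hne => ha.isRelPrime hne) fun h => ?_
    exact dvd_det_of_dvd_combination _ (ha.ne_zero h) fun k => hΘ.mem k h
  obtain ⟨u, hu⟩ := hQd
  have hpow : (Matrix.of Θ).det ∣ Q ^ Fintype.card σ := by
    have h1 := hΘ.det_dvd (Matrix.diagonal fun _ => Q) (fun k h => by
      refine Finset.dvd_sum fun i _ => Dvd.dvd.mul_left ?_ _
      by_cases hk : k = i
      · subst hk
        rw [Matrix.diagonal_apply_eq]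
        exact Finset.dvd_prod_of_mem _ (Finset.mem_univ h)
      · rw [Matrix.diagonal_apply_ne _ hk]
        exact dvd_zero _)
    rwa [Matrix.det_diagonal, Finset.prod_const, Finset.card_univ] at h1
  have hloc : ∀ h, ∃ k, u ∣ (∏ h' ∈ Finset.univ.erase h, linForm (a h')) ^ k := by
    intro h
    set Qh := ∏ h' ∈ Finset.univ.erase h, linForm (a h') with hQh
    have hQQ : Q = linForm (a h) * Qh := (Finset.mul_prod_erase _ _ (Finset.mem_univ h)).symm
    obtain ⟨i₀, hi₀⟩ := Function.ne_iff.1 (ha.ne_zero h)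
    rw [Pi.zero_apply] at hi₀
    set D : Matrix σ σ (MvPolynomial σ K) := Matrix.diagonal fun k => if k = i₀ then Q else Qh
    -- the rows of `U` apart from the one with index `i₀` span the kernel of the form `a h`
    set U : Matrix σ σ (MvPolynomial σ K) :=
      (1 : Matrix σ σ (MvPolynomial σ K)).updateCol i₀
        fun k => if k = i₀ then 1 else C (-(a h k / a h i₀)) with hU
    have hUdet : U.det = 1 := by
      rw [hU, ← Matrix.cramer_apply, Matrix.cramer_one]
      simp
    have hrow : ∀ k i, (D * U) k i = (if k = i₀ then Q else Qh) * U k i := fun k i => by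
      rw [Matrix.diagonal_mul]
    have h1 := hΘ.det_dvd (D * U) (fun k h' => by
      simp only [hrow]
      by_cases hk : k = i₀
      · simp only [hk, if_true]
        refine Finset.dvd_sum fun i _ => Dvd.dvd.mul_left (Dvd.dvd.mul_right ?_ _) _
        exact Finset.dvd_prod_of_mem _ (Finset.mem_univ h')
      · simp only [hk, if_false]
        by_cases hh : h' = h
        · subst hh
          have h2 : ∑ i, C (a h' i) * (Qh * U k i) = 0 := by
            have h3 : ∀ i, C (a h' i) * (Qh * U k i) = Qh * (C (a h' i) * U k i) := fun i => by ring
            rw [Finset.sum_congr rfl fun i _ => h3 i, ← Finset.mul_sum,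
              ← Finset.add_sum_erase _ _ (Finset.mem_univ i₀), hU, Matrix.updateCol_self, if_neg hk,
              Finset.sum_eq_single_of_mem k (Finset.mem_erase.2 ⟨hk, Finset.mem_univ k⟩)]
            · rw [Matrix.updateCol_ne hk, Matrix.one_apply_eq, ← C_mul, mul_one, ← C_add]
              have h4 : a h' i₀ * -(a h' k / a h' i₀) + a h' k = 0 := by field_simp; ring
              rw [h4, C_0, mul_zero]
            · intro i hi hik
              rw [Matrix.updateCol_ne (Finset.mem_erase.1 hi).1, Matrix.one_apply_ne (Ne.symm hik),
                mul_zero]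
          rw [h2]
          exact dvd_zero _
        · refine Finset.dvd_sum fun i _ => Dvd.dvd.mul_left (Dvd.dvd.mul_right ?_ _) _
          exact Finset.dvd_prod_of_mem _ (Finset.mem_erase.2 ⟨hh, Finset.mem_univ h'⟩))
    refine ⟨(Finset.univ.erase i₀).card, ?_⟩
    rw [Matrix.det_mul, hUdet, mul_one, Matrix.det_diagonal,
      ← Finset.mul_prod_erase _ _ (Finset.mem_univ i₀), if_pos rfl,
      Finset.prod_congr rfl fun k hk => if_neg (Finset.mem_erase.1 hk).1, Finset.prod_const,
      hu] at h1
    exact (mul_dvd_mul_iff_left hQ0).1 h1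
  have hunit : IsUnit u := by
    by_contra hnu
    have hu0 : u ≠ 0 := by
      rintro rfl
      rw [hu, mul_zero, zero_dvd_iff] at hpow
      exact pow_ne_zero _ hQ0 hpow
    obtain ⟨p, hp, hpu⟩ := WfDvdMonoid.exists_irreducible_factor hnu hu0
    have hpp := hp.prime
    have h1 : p ∣ Q := hpp.dvd_of_dvd_pow ((hpu.trans (hu ▸ dvd_mul_left u Q)).trans hpow)
    obtain ⟨h, -, hph⟩ := (hpp.dvd_finsetProd_iff _).1 h1
    obtain ⟨k, hk⟩ := hloc h
    have h2 := hpp.dvd_of_dvd_pow (hpu.trans hk)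
    obtain ⟨h', hh', hph'⟩ := (hpp.dvd_finsetProd_iff _).1 h2
    have h3 := hp.associated_of_dvd (linForm_prime (ha.ne_zero h)).irreducible hph
    exact ha.not_dvd (Finset.mem_erase.1 hh').1.symm (h3.dvd_iff_dvd_left.1 hph')
  obtain ⟨c, hc, rfl⟩ := MvPolynomial.isUnit_iff_eq_C_of_isReduced.1 hunit
  exact ⟨c, hc.ne_zero, by rw [hu, mul_comm]⟩

/-- The degrees of a homogeneous basis add up to the number of forms. -/
theorem IsLogBasis.sum_eq [Fintype ι] {a : ι → σ → K} (ha : IsSimpleFamily a)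
    {Θ : σ → σ → MvPolynomial σ K} {m : σ → ℕ} (hΘ : IsLogBasis a Θ m) :
    ∑ j, m j = Fintype.card ι := by
  obtain ⟨c, hc, hdet⟩ := hΘ.det_eq ha
  have hQ0 : ∏ h, linForm (a h) ≠ 0 :=
    Finset.prod_ne_zero_iff.2 fun h _ => linForm_ne_zero (ha.ne_zero h)
  have h1 := (det_isHomogeneous (Matrix.of Θ) m hΘ.homogeneous).totalDegree (by
    rw [hdet]; exact mul_ne_zero (C_ne_zero.2 hc) hQ0)
  rw [← h1, hdet, totalDegree_mul_of_isDomain (C_ne_zero.2 hc) hQ0, totalDegree_C, zero_add,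
    totalDegree_prod_linForm _ _ fun h _ => ha.ne_zero h, Finset.card_univ]

theorem IsLogBasis.whitneyPoly_eq [Fintype ι] {a : ι → σ → K} (ha : IsSimpleFamily a)
    {Θ : σ → σ → MvPolynomial σ K} {m : σ → ℕ} (hΘ : IsLogBasis a Θ m) :
    whitneyPoly a = ∏ j, (Polynomial.X - Polynomial.C (m j : ℤ)) := by
  obtain ⟨c, hc, hdet⟩ := hΘ.det_eq ha
  choose b hb using fun h j => hΘ.mem j h
  exact whitneyPoly_eq_prod a ha.ne_zero ha.separated m (hΘ.sum_eq ha) (Matrix.of Θ)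
    (fun j i => (hΘ.homogeneous j i).totalDegree_le) b hb hc hdet

end LogFields

theorem Module.Basis.linearIndependent_coe {R M τ : Type*} [Ring R] [AddCommGroup M] [Module R M]
    {N : Submodule R M} (θ : Module.Basis τ R N) : LinearIndependent R fun j => (θ j : M) :=
  θ.linearIndependent.map' N.subtype N.ker_subtype

theorem Module.Basis.span_range_coe {R M τ : Type*} [Ring R] [AddCommGroup M] [Module R M]
    {N : Submodule R M} (θ : Module.Basis τ R N) :
    Submodule.span R (Set.range fun j => (θ j : M)) = N := by
  have h1 := congrArg (Submodule.map N.subtype) θ.span_eq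
  rw [Submodule.map_span, Submodule.map_top, Submodule.range_subtype, ← Set.range_comp] at h1
  exact h1

namespace HypArr

variable {K V : Type*} [Field K] [AddCommGroup V] [Module K V]

/-! ### Arrangements in coordinates -/

/-- The forms `α h` define the hyperplanes of `A`, each of them once. -/
structure IsDefining {ι : Type*} (A : HypArr K V) (α : ι → Module.Dual K V) : Prop where
  ne_zero : ∀ h, α h ≠ 0
  injective : Function.Injective fun h => LinearMap.ker (α h)
  range_eq : Set.range (fun h => LinearMap.ker (α h)) = A.carrier

theorem ker_eq_of_ker_le {α β : Module.Dual K V} (hα : α ≠ 0) (hβ : β ≠ 0)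
    (h : LinearMap.ker α ≤ LinearMap.ker β) : LinearMap.ker α = LinearMap.ker β := by
  have hco : IsCoatom (LinearMap.ker α) :=
    LinearMap.isCoatom_ker_of_surjective (LinearMap.surjective hα)
  rcases hco.le_iff.1 h with h | h
  · exact absurd (LinearMap.ker_eq_top.1 h) hβ
  · exact h.symm

theorem exists_eq_smul_of_ker_eq {α β : Module.Dual K V} (hα : α ≠ 0)
    (h : LinearMap.ker α = LinearMap.ker β) : ∃ c : K, c ≠ 0 ∧ β = c • α := by
  obtain ⟨v, hv⟩ := LinearMap.surjective hα 1
  have hβv : β v ≠ 0 := fun h0 => by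
    have : v ∈ LinearMap.ker α := h ▸ (LinearMap.mem_ker.2 h0)
    rw [LinearMap.mem_ker, hv] at this
    exact one_ne_zero this
  refine ⟨β v, hβv, LinearMap.ext fun x => ?_⟩
  have h1 : x - α x • v ∈ LinearMap.ker β := by
    rw [← h, LinearMap.mem_ker, map_sub, map_smul, hv]
    simp
  rw [LinearMap.mem_ker, map_sub, map_smul, sub_eq_zero] at h1
  rw [h1, LinearMap.smul_apply, smul_eq_mul, smul_eq_mul, mul_comm]

section Coordinates

variable {ι : Type*} {A : HypArr K V} {α : ι → Module.Dual K V} {σ : Type*} [Fintype σ]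
  (b : Module.Basis σ K V)

theorem dotProduct_equivFun (β : Module.Dual K V) (v : V) :
    (fun i => β (b i)) ⬝ᵥ b.equivFun v = β v := by
  conv_rhs => rw [← b.sum_equivFun v, map_sum]
  simp only [dotProduct, map_smul, smul_eq_mul]
  exact Finset.sum_congr rfl fun i _ => mul_comm _ _

theorem IsDefining.isSimpleFamily (hα : A.IsDefining α) :
    IsSimpleFamily fun h i => α h (b i) where
  ne_zero := fun h h0 => hα.ne_zero h (b.ext fun i => congrFun h0 i)
  separated := fun h h' hne => by
    have h1 : ¬ LinearMap.ker (α h) ≤ LinearMap.ker (α h') := fun hle =>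
      hne (hα.injective (ker_eq_of_ker_le (hα.ne_zero h) (hα.ne_zero h') hle))
    obtain ⟨v, hv, hv'⟩ := Set.not_subset.1 h1
    have hv2 : α h' v ≠ 0 := hv'
    refine ⟨b.equivFun ((α h' v)⁻¹ • v), ?_, ?_⟩
    · rw [dotProduct_equivFun, map_smul, LinearMap.mem_ker.1 hv, smul_zero]
    · rw [dotProduct_equivFun, map_smul, smul_eq_mul, inv_mul_cancel₀ hv2]

variable [DecidableEq σ]

theorem equivMvPolynomial_ι (β : Module.Dual K V) :
    SymmetricAlgebra.equivMvPolynomial b.dualBasis (SymmetricAlgebra.ι K _ β) =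
      linForm fun i => β (b i) := by
  have h1 : β = ∑ i, β (b i) • b.dualBasis i := by
    refine b.ext fun j => ?_
    simp
  conv_lhs => rw [h1]
  simp only [map_sum, map_smul, SymmetricAlgebra.equivMvPolynomial_ι_apply, linForm,
    MvPolynomial.smul_eq_C_mul]

theorem isHomogeneous_equivMvPolynomial {n : ℕ} {x : CoordRing K V}
    (hx : x ∈ homogeneousPart K V n) :
    (SymmetricAlgebra.equivMvPolynomial b.dualBasis x).IsHomogeneous n := by
  have h1 := Submodule.mem_map_of_mem
    (f := (SymmetricAlgebra.equivMvPolynomial b.dualBasis).toAlgHom.toLinearMap) hx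
  rw [homogeneousPart, Submodule.map_pow] at h1
  have h2 : (LinearMap.range (SymmetricAlgebra.ι K (Module.Dual K V))).map
      (SymmetricAlgebra.equivMvPolynomial b.dualBasis).toAlgHom.toLinearMap ≤
      MvPolynomial.homogeneousSubmodule σ K 1 := by
    rintro _ ⟨_, ⟨β, rfl⟩, rfl⟩
    exact equivMvPolynomial_ι b β ▸ linForm_isHomogeneous _
  have h3 := pow_le_pow_left' h2 n h1
  rw [MvPolynomial.homogeneousSubmodule_one_pow] at h3
  exact h3

/-- The derivation of the coordinate ring with given components. -/
def derOfComponents (g : σ → MvPolynomial σ K) :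
    Derivation K (CoordRing K V) (CoordRing K V) where
  toLinearMap := (SymmetricAlgebra.equivMvPolynomial b.dualBasis).symm.toLinearMap ∘ₗ
    (MvPolynomial.mkDerivation K g).toLinearMap ∘ₗ
    (SymmetricAlgebra.equivMvPolynomial b.dualBasis).toLinearMap
  map_one_eq_zero' := by simp
  leibniz' := fun x y => by simp

/-- The components of a derivation of the coordinate ring. -/
def components (θ : Derivation K (CoordRing K V) (CoordRing K V)) : σ → MvPolynomial σ K :=
  fun i => SymmetricAlgebra.equivMvPolynomial b.dualBasis
    (θ (SymmetricAlgebra.ι K _ (b.dualBasis i)))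

theorem components_derOfComponents (g : σ → MvPolynomial σ K) :
    components b (derOfComponents b g) = g := by
  funext i
  set e := SymmetricAlgebra.equivMvPolynomial b.dualBasis with he
  have h1 : components b (derOfComponents b g) i =
      e (e.symm (MvPolynomial.mkDerivation K g
        (e (SymmetricAlgebra.ι K _ (b.dualBasis i))))) := rfl
  rw [h1, he, SymmetricAlgebra.equivMvPolynomial_ι_apply, MvPolynomial.mkDerivation_X,
    AlgEquiv.apply_symm_apply]

theorem components_sum {τ : Type*} [Fintype τ] (c : τ → CoordRing K V)
    (θ : τ → Derivation K (CoordRing K V) (CoordRing K V)) :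
    components b (∑ j, c j • θ j) =
      ∑ j, SymmetricAlgebra.equivMvPolynomial b.dualBasis (c j) • components b (θ j) := by
  classical
  funext i
  have h1 : ∀ (s : Finset τ) x, (∑ j ∈ s, c j • θ j) x = ∑ j ∈ s, c j * θ j x := fun s x => by
    induction s using Finset.induction_on with
    | empty => simp
    | insert j s hj ih => rw [Finset.sum_insert hj, Finset.sum_insert hj, Derivation.add_apply, ih,
        Derivation.smul_apply, smul_eq_mul]
  rw [Finset.sum_apply, components, h1, map_sum]
  exact Finset.sum_congr rfl fun j _ => map_mul _ _ _

theorem components_injective {θ : Derivation K (CoordRing K V) (CoordRing K V)}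
    (h : components b θ = 0) : θ = 0 := by
  set e := SymmetricAlgebra.equivMvPolynomial b.dualBasis with he
  have h1 : ∀ x, e.symm (e x) = x := e.symm_apply_apply
  let D : Derivation K (MvPolynomial σ K) (MvPolynomial σ K) :=
    { toLinearMap := e.toLinearMap ∘ₗ θ.toLinearMap ∘ₗ e.symm.toLinearMap
      map_one_eq_zero' := by simp
      leibniz' := fun x y => by simp }
  have hD : D = 0 := MvPolynomial.derivation_ext fun i => by
    have h2 := congrFun h i
    have h3 : e.symm (MvPolynomial.X i) = SymmetricAlgebra.ι K _ (b.dualBasis i) :=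
      SymmetricAlgebra.equivMvPolynomial_symm_X _ _
    have h4 : D (MvPolynomial.X i) = e (θ (e.symm (MvPolynomial.X i))) := rfl
    rw [h4, h3]
    exact h2
  refine Derivation.ext fun x => ?_
  have h5 : D (e x) = e (θ (e.symm (e x))) := rfl
  rw [hD, h1] at h5
  exact (map_eq_zero_iff e e.injective).1 h5.symm

theorem equivMvPolynomial_der (θ : Derivation K (CoordRing K V) (CoordRing K V))
    (β : Module.Dual K V) :
    SymmetricAlgebra.equivMvPolynomial b.dualBasis (θ (SymmetricAlgebra.ι K _ β)) =
      ∑ i, MvPolynomial.C (β (b i)) * components b θ i := by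
  have h1 : β = ∑ i, β (b i) • b.dualBasis i := by
    refine b.ext fun j => ?_
    simp
  conv_lhs => rw [h1, map_sum, map_sum, map_sum]
  refine Finset.sum_congr rfl fun i _ => ?_
  rw [map_smul, Derivation.map_smul, map_smul, MvPolynomial.smul_eq_C_mul, components]

theorem IsDefining.mem_logDer_iff (hα : A.IsDefining α)
    {θ : Derivation K (CoordRing K V) (CoordRing K V)} :
    θ ∈ A.logDer ↔ components b θ ∈ logFields fun h i => α h (b i) := by
  set e := SymmetricAlgebra.equivMvPolynomial b.dualBasis with he
  have key : ∀ β : Module.Dual K V,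
      θ (SymmetricAlgebra.ι K _ β) ∈ Ideal.span {SymmetricAlgebra.ι K (Module.Dual K V) β} ↔
        linForm (fun i => β (b i)) ∣ ∑ i, MvPolynomial.C (β (b i)) * components b θ i := by
    intro β
    rw [Ideal.mem_span_singleton, ← equivMvPolynomial_der, ← equivMvPolynomial_ι, ← he]
    exact (map_dvd_iff e).symm
  constructor
  · intro hθ h
    exact (key _).1 (hθ (LinearMap.ker (α h)) (hα.range_eq ▸ ⟨h, rfl⟩) _ rfl)
  · intro hθ H hH β hβ
    rw [← hα.range_eq] at hH
    obtain ⟨h, rfl⟩ := hH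
    obtain ⟨c, hc, rfl⟩ := exists_eq_smul_of_ker_eq (hα.ne_zero h) hβ.symm
    have h1 := (key _).2 (hθ h)
    rw [Ideal.mem_span_singleton] at h1 ⊢
    obtain ⟨x, hx⟩ := h1
    exact ⟨x, by rw [map_smul, Derivation.map_smul, hx, smul_mul_assoc]⟩

theorem linearIndependent_components {τ : Type*} [Fintype τ]
    {θ : τ → Derivation K (CoordRing K V) (CoordRing K V)}
    (hθ : LinearIndependent (CoordRing K V) θ) :
    LinearIndependent (MvPolynomial σ K) fun j => components b (θ j) := by
  rw [Fintype.linearIndependent_iff] at hθ ⊢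
  intro p hp j
  let e := SymmetricAlgebra.equivMvPolynomial b.dualBasis
  have h1 := components_sum b (fun j => e.symm (p j)) θ
  have h2 : ∀ j, e (e.symm (p j)) = p j := fun j => e.apply_symm_apply _
  rw [Finset.sum_congr rfl fun j _ => congrArg (· • components b (θ j)) (h2 j), hp] at h1
  have h3 := hθ _ (components_injective b h1) j
  exact (map_eq_zero_iff e.symm e.symm.injective).1 h3

theorem components_mem_span {τ : Type*} [Fintype τ]
    {θ : τ → Derivation K (CoordRing K V) (CoordRing K V)}
    {η : Derivation K (CoordRing K V) (CoordRing K V)}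
    (h : η ∈ Submodule.span (CoordRing K V) (Set.range θ)) :
    components b η ∈
      Submodule.span (MvPolynomial σ K) (Set.range fun j => components b (θ j)) := by
  obtain ⟨c, rfl⟩ := (Submodule.mem_span_range_iff_exists_fun _).1 h
  rw [components_sum]
  exact Submodule.sum_mem _ fun j _ => Submodule.smul_mem _ _ (Submodule.subset_span ⟨j, rfl⟩)

/-- A free arrangement has a homogeneous basis of logarithmic vector fields in coordinates. -/
theorem IsDefining.exists_isLogBasis (hα : A.IsDefining α) (hA : A.IsFree) :
    ∃ (Θ : σ → σ → MvPolynomial σ K) (m : σ → ℕ), IsLogBasis (fun h i => α h (b i)) Θ m := by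
  obtain ⟨m, θ, hθ⟩ := hA
  have hcard : Fintype.card σ = Fintype.card (Fin (Module.finrank K V)) := by
    rw [Module.finrank_eq_card_basis b, Fintype.card_fin]
  have hlog : IsLogBasis (fun h i => α h (b i))
      (fun j => components b (θ j : Derivation K (CoordRing K V) (CoordRing K V))) m := by
    refine ⟨linearIndependent_components b
      θ.linearIndependent_coe, le_antisymm ?_ ?_,
      fun j i => isHomogeneous_equivMvPolynomial b (hθ j _)⟩
    · rw [Submodule.span_le]
      rintro _ ⟨j, rfl⟩
      exact (hα.mem_logDer_iff b).1 (θ j).2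
    · intro g hg
      rw [← components_derOfComponents b g] at hg ⊢
      refine components_mem_span b ?_
      rw [θ.span_range_coe]
      exact (hα.mem_logDer_iff b).2 hg
  exact ⟨_, _, hlog.reindex (Fintype.equivOfCardEq hcard)⟩

end Coordinates

/-! ### Whitney's formula for the characteristic polynomial -/

section Whitney

variable {ι : Type*} [Fintype ι] {A : HypArr K V} {α : ι → Module.Dual K V}

/-- The intersection of the kernels of the forms with index in `B`. -/
def flatOf (α : ι → Module.Dual K V) (B : Finset ι) : Submodule K V :=
  B.inf fun h => LinearMap.ker (α h)

theorem IsDefining.mem_flats_iff (hα : A.IsDefining α) {X : Submodule K V} :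
    X ∈ A.flats ↔ ∃ B : Finset ι, flatOf α B = X := by
  classical
  rw [flats, Set.Finite.mem_toFinset, lattice, Set.mem_image]
  constructor
  · rintro ⟨S, hS, rfl⟩
    refine ⟨Finset.univ.filter fun h => LinearMap.ker (α h) ∈ S, le_antisymm ?_ ?_⟩
    · refine le_sInf fun L hL => ?_
      obtain ⟨h, rfl⟩ : L ∈ Set.range fun h => LinearMap.ker (α h) := hα.range_eq ▸ hS hL
      exact Finset.inf_le (Finset.mem_filter.2 ⟨Finset.mem_univ _, hL⟩)
    · exact Finset.le_inf fun h hh => sInf_le (Finset.mem_filter.1 hh).2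
  · rintro ⟨B, rfl⟩
    refine ⟨(fun h => LinearMap.ker (α h)) '' B, ?_, ?_⟩
    · rintro _ ⟨h, _, rfl⟩
      exact hα.range_eq ▸ ⟨h, rfl⟩
    · rw [sInf_image, flatOf, Finset.inf_eq_iInf]
      rfl

variable [FiniteDimensional K V]

open Classical in
/-- Whitney's formula for the Möbius function: the right hand side satisfies the same recursion, since
the signs of the subfamilies of the hyperplanes that contain a proper flat cancel. -/
theorem IsDefining.moebius_eq (hα : A.IsDefining α) (X : Submodule K V) (hX : X ∈ A.flats) :
    A.moebius X = ∑ B ∈ Finset.univ.filter (fun B : Finset ι => flatOf α B = X), (-1) ^ B.card := by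
  induction X using WellFoundedGT.induction with
  | _ X ih =>
  rw [moebius]
  by_cases hXt : X = ⊤
  · have h1 : Finset.univ.filter (fun B : Finset ι => flatOf α B = X) = {∅} := by
      ext B
      rw [Finset.mem_filter, Finset.mem_singleton, hXt]
      refine ⟨fun h => Finset.eq_empty_of_forall_notMem fun h' hh' => ?_, fun h => by
        simp [h, flatOf]⟩
      have h2 : ⊤ ≤ LinearMap.ker (α h') := h.2 ▸ Finset.inf_le hh'
      exact hα.ne_zero h' (LinearMap.ker_eq_top.1 (top_le_iff.1 h2))
    rw [if_pos hXt, h1]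
    simp
  · rw [if_neg hXt, Finset.sum_attach _ fun Y => A.moebius Y, neg_eq_iff_add_eq_zero]
    set A_X : Finset ι := Finset.univ.filter fun h => X ≤ LinearMap.ker (α h) with hAX
    have hpow : Finset.univ.filter (fun B : Finset ι => X ≤ flatOf α B) = A_X.powerset := by
      ext B
      simp [flatOf, hAX, Finset.subset_iff]
    have hne : A_X.Nonempty := by
      obtain ⟨B, rfl⟩ := hα.mem_flats_iff.1 hX
      rcases B.eq_empty_or_nonempty with rfl | ⟨h, hh⟩
      · exact absurd (by simp [flatOf]) hXt
      · exact ⟨h, Finset.mem_filter.2 ⟨Finset.mem_univ _, Finset.inf_le hh⟩⟩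
    have hzero : ∑ B ∈ Finset.univ.filter (fun B : Finset ι => X ≤ flatOf α B),
        (-1 : ℤ) ^ B.card = 0 := by
      rw [hpow]
      exact Finset.sum_powerset_neg_one_pow_card_of_nonempty hne
    have hfib : ∑ Y ∈ A.flats.filter (fun Y => X ≤ Y),
        ∑ B ∈ Finset.univ.filter (fun B : Finset ι => flatOf α B = Y), (-1 : ℤ) ^ B.card = 0 := by
      rw [← hzero, ← Finset.sum_fiberwise_of_maps_to (t := A.flats.filter (fun Y => X ≤ Y))
        (g := flatOf α)]
      · refine Finset.sum_congr rfl fun Y hY => Finset.sum_congr ?_ fun _ _ => rfl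
        ext B
        simp only [Finset.mem_filter, Finset.mem_univ, true_and]
        exact ⟨fun h => ⟨h ▸ (Finset.mem_filter.1 hY).2, h⟩, fun h => h.2⟩
      · intro B hB
        exact Finset.mem_filter.2 ⟨hα.mem_flats_iff.2 ⟨B, rfl⟩, (Finset.mem_filter.1 hB).2⟩
    have hsplit : A.flats.filter (fun Y => X ≤ Y) =
        insert X (A.flats.filter (fun Y => X < Y)) := by
      ext Y
      simp only [Finset.mem_filter, Finset.mem_insert, le_iff_eq_or_lt]
      constructor
      · rintro ⟨h1, rfl | h2⟩
        · exact Or.inl rfl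
        · exact Or.inr ⟨h1, h2⟩
      · rintro (rfl | h)
        · exact ⟨hX, Or.inl rfl⟩
        · exact ⟨h.1, Or.inr h.2⟩
    rw [hsplit, Finset.sum_insert (by simp)] at hfib
    rw [Finset.sum_congr rfl fun Y hY => ih Y (Finset.mem_filter.1 hY).2 (Finset.mem_filter.1 hY).1]
    linarith

omit [Fintype ι] [FiniteDimensional K V] in
theorem finrank_flatOf {σ : Type*} [Fintype σ] (b : Module.Basis σ K V) (B : Finset ι) :
    Module.finrank K (flatOf α B) =
      Module.finrank K (LinearMap.ker (subMatrix (fun h i => α h (b i)) B).mulVecLin) := by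
  have h1 : LinearMap.ker (subMatrix (fun h i => α h (b i)) B).mulVecLin =
      (flatOf α B).map b.equivFun.toLinearMap := by
    ext v
    obtain ⟨w, rfl⟩ := b.equivFun.surjective v
    rw [LinearMap.mem_ker, Submodule.mem_map_equiv, LinearEquiv.symm_apply_apply, flatOf,
      Submodule.mem_finsetInf]
    constructor
    · intro h0 h hB
      have := congrFun h0 ⟨h, hB⟩
      rw [Matrix.mulVecLin_apply] at this
      rw [LinearMap.mem_ker, ← dotProduct_equivFun b]
      exact this
    · intro h0
      funext h
      have := h0 h h.2
      rw [LinearMap.mem_ker, ← dotProduct_equivFun b] at this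
      exact this
  rw [h1]
  exact (LinearEquiv.finrank_map_eq b.equivFun (flatOf α B)).symm

theorem IsDefining.charPoly_eq_whitneyPoly {σ : Type*} [Fintype σ] (b : Module.Basis σ K V)
    (hα : A.IsDefining α) : A.charPoly = whitneyPoly fun h i => α h (b i) := by
  classical
  have h1 : ∀ X ∈ A.flats, Polynomial.C (A.moebius X) * Polynomial.X ^ Module.finrank K X =
      ∑ B ∈ Finset.univ.filter (fun B : Finset ι => flatOf α B = X),
        Polynomial.C ((-1 : ℤ) ^ B.card) * Polynomial.X ^ Module.finrank K (flatOf α B) := by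
    intro X hX
    rw [hα.moebius_eq X hX, map_sum, Finset.sum_mul]
    refine Finset.sum_congr rfl fun B hB => ?_
    rw [(Finset.mem_filter.1 hB).2]
  rw [charPoly, Finset.sum_congr rfl h1, whitneyPoly,
    Finset.sum_fiberwise_of_maps_to fun B _ => hα.mem_flats_iff.2 ⟨B, rfl⟩]
  exact Finset.sum_congr rfl fun B _ => by rw [finrank_flatOf b]

theorem IsDefining.charPoly_eq_mul (hα : A.IsDefining α) [Nonempty ι] :
    A.charPoly = (Polynomial.X - Polynomial.C 1) * A.charPoly₀ := by
  classical
  have h1 : A.charPoly.eval 1 = 0 := by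
    rw [hα.charPoly_eq_whitneyPoly (Module.finBasis K V), whitneyPoly, Polynomial.eval_finsetSum]
    simp only [Polynomial.eval_mul, Polynomial.eval_C, Polynomial.eval_pow, Polynomial.eval_X,
      one_pow, mul_one]
    rw [← Finset.powerset_univ]
    exact Finset.sum_powerset_neg_one_pow_card_of_nonempty Finset.univ_nonempty
  exact (Polynomial.mul_divByMonic_eq_iff_isRoot.2 h1).symm

end Whitney

end HypArr

/-! ### Restriction to a coordinate hyperplane -/

section Restriction

open MvPolynomial

/-- The coefficients in a combination of homogeneous vectors that is homogeneous can be taken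
homogeneous of the complementary degrees. -/
theorem exists_homogeneous_coeff {R σ τ J : Type*} [CommRing R] [Fintype J] {e : ℕ}
    {u : τ → MvPolynomial σ R} (hu : ∀ i, (u i).IsHomogeneous e)
    {w : J → τ → MvPolynomial σ R} {d : J → ℕ} (hw : ∀ j i, (w j i).IsHomogeneous (d j))
    (h : u ∈ Submodule.span (MvPolynomial σ R) (Set.range w)) :
    ∃ c : J → MvPolynomial σ R, ∑ j, c j • w j = u ∧ ∀ j, (c j).IsHomogeneous (e - d j) ∧
      (e < d j → c j = 0) := by
  obtain ⟨c, rfl⟩ := (Submodule.mem_span_range_iff_exists_fun _).1 h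
  refine ⟨fun j => if d j ≤ e then homogeneousComponent (e - d j) (c j) else 0, ?_, fun j => ?_⟩
  · funext i
    have h1 : homogeneousComponent e ((∑ j, c j • w j) i) = (∑ j, c j • w j) i := by
      rw [homogeneousComponent_of_mem (hu i), if_pos rfl]
    rw [← h1, Finset.sum_apply, Finset.sum_apply, map_sum]
    refine Finset.sum_congr rfl fun j _ => ?_
    let _ := gradedAlgebra (σ := σ) (R := R)
    have h2 := DirectSum.coe_decompose_mul_of_right_mem (homogeneousSubmodule σ R) (a := c j) e
      (hw j i)
    rw [← decomposition.decompose'_apply]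
    refine Eq.trans ?_ h2.symm
    simp only [Pi.smul_apply, smul_eq_mul]
    split_ifs
    · rw [← decomposition.decompose'_apply]
      rfl
    · exact zero_mul _
  · simp only
    split_ifs with hj
    · exact ⟨homogeneousComponent_isHomogeneous _ _, fun h => absurd hj h.not_ge⟩
    · exact ⟨isHomogeneous_zero _ _ _, fun _ => rfl⟩

theorem mem_span_of_homogeneous {R σ τ J : Type*} [CommRing R] [Fintype J] {e : ℕ}
    {u : τ → MvPolynomial σ R} (hu : ∀ i, (u i).IsHomogeneous e)
    {w : J → τ → MvPolynomial σ R} {d : J → ℕ} (hw : ∀ j i, (w j i).IsHomogeneous (d j))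
    (h : u ∈ Submodule.span (MvPolynomial σ R) (Set.range w)) {s : Set J}
    (hs : ∀ j, d j ≤ e → j ∈ s) : u ∈ Submodule.span (MvPolynomial σ R) (w '' s) := by
  obtain ⟨c, rfl, hc⟩ := exists_homogeneous_coeff hu hw h
  refine Submodule.sum_mem _ fun j _ => ?_
  by_cases hj : d j ≤ e
  · exact Submodule.smul_mem _ _ (Submodule.subset_span ⟨j, hs j hj, rfl⟩)
  · rw [(hc j).2 (not_le.1 hj), zero_smul]
    exact Submodule.zero_mem _

/-- A vector lies in the span of an independent family as soon as its product with `∏ p i` does and,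
for each of the primes `p i`, also its product with some element prime to `p i`. -/
theorem mem_span_of_prod_smul_mem {R M ι J : Type*} [CommRing R] [IsDomain R] [AddCommGroup M]
    [Module R M] [Module.IsTorsionFree R M] [Fintype J] {w : J → M} (hw : LinearIndependent R w) {v : M}
    {p : ι → R} (hp : ∀ i, Prime (p i))
    (hq : ∀ i, ∃ q, ¬ p i ∣ q ∧ q • v ∈ Submodule.span R (Set.range w)) (s : Finset ι)
    (hs : (∏ i ∈ s, p i) • v ∈ Submodule.span R (Set.range w)) :
    v ∈ Submodule.span R (Set.range w) := by
  classical
  induction s using Finset.induction_on with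
  | empty => simpa using hs
  | insert i s hi ih =>
    refine ih ?_
    obtain ⟨q, hpq, hqv⟩ := hq i
    rw [Finset.prod_insert hi] at hs
    obtain ⟨c, hc⟩ := (Submodule.mem_span_range_iff_exists_fun _).1 hs
    obtain ⟨d, hd⟩ := (Submodule.mem_span_range_iff_exists_fun _).1 hqv
    have h1 : ∑ j, (q * c j - p i * (∏ i ∈ s, p i) * d j) • w j = 0 := by
      simp only [sub_smul, mul_smul, Finset.sum_sub_distrib, ← Finset.smul_sum, hc, hd]
      rw [smul_comm q, smul_comm q, sub_self]
    have h2 : ∀ j, p i ∣ c j := fun j => by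
      have h3 := sub_eq_zero.1 (Fintype.linearIndependent_iff.1 hw _ h1 j)
      refine ((hp i).dvd_or_dvd (a := q) ?_).resolve_left hpq
      rw [h3, mul_assoc]
      exact dvd_mul_right _ _
    choose c' hc' using h2
    rw [Submodule.mem_span_range_iff_exists_fun]
    refine ⟨c', smul_right_injective M (hp i).ne_zero ?_⟩
    simp only
    rw [smul_smul, ← hc, Finset.smul_sum]
    exact Finset.sum_congr rfl fun j _ => by rw [smul_smul, ← hc']

variable {K : Type*} [Field K] {n : ℕ}

variable (K n) in
/-- The restriction of polynomials to the hyperplane `X 0 = 0`. -/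
def restrictPoly : MvPolynomial (Fin (n + 1)) K →ₐ[K] MvPolynomial (Fin n) K :=
  aeval (Fin.cons 0 X : Fin (n + 1) → MvPolynomial (Fin n) K)

theorem restrictPoly_rename (f : MvPolynomial (Fin n) K) :
    restrictPoly K n (rename Fin.succ f) = f := by
  rw [restrictPoly, aeval_rename]
  have h1 : (Fin.cons 0 X : Fin (n + 1) → MvPolynomial (Fin n) K) ∘ Fin.succ = X := by
    funext i
    rw [Function.comp_apply, Fin.cons_succ]
  rw [h1, aeval_X_left_apply]

theorem restrictPoly_C (c : K) : restrictPoly K n (C c) = C c :=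
  (restrictPoly K n).commutes c

theorem restrictPoly_X_zero : restrictPoly K n (X 0) = 0 := by
  rw [restrictPoly, aeval_X, Fin.cons_zero]

theorem restrictPoly_linForm (a : Fin (n + 1) → K) :
    restrictPoly K n (linForm a) = linForm fun i => a i.succ := by
  rw [linForm, linForm, Fin.sum_univ_succ]
  simp [restrictPoly]

theorem X_zero_dvd_sub (f : MvPolynomial (Fin (n + 1)) K) :
    X 0 ∣ f - rename Fin.succ (restrictPoly K n f) := by
  induction f using MvPolynomial.induction_on with
  | C c => rw [restrictPoly_C, rename_C, sub_self]; exact dvd_zero _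
  | add p q hp hq =>
    rw [map_add, map_add, add_sub_add_comm]
    exact dvd_add hp hq
  | mul_X p i hp =>
    rw [map_mul, map_mul]
    cases i using Fin.cases with
    | zero =>
      rw [restrictPoly_X_zero, map_zero, mul_zero, sub_zero]
      exact dvd_mul_left _ _
    | succ i =>
      have h1 : restrictPoly K n (X i.succ) = X i := by
        rw [restrictPoly, aeval_X, Fin.cons_succ]
      rw [h1, rename_X, ← sub_mul]
      exact Dvd.dvd.mul_right hp _

theorem restrictPoly_eq_zero_iff {f : MvPolynomial (Fin (n + 1)) K} :
    restrictPoly K n f = 0 ↔ X 0 ∣ f := by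
  constructor
  · intro h
    have h1 := X_zero_dvd_sub f
    rwa [h, map_zero, sub_zero] at h1
  · rintro ⟨g, rfl⟩
    rw [map_mul, restrictPoly_X_zero, zero_mul]

theorem isHomogeneous_restrictPoly {f : MvPolynomial (Fin (n + 1)) K} {d : ℕ}
    (hf : f.IsHomogeneous d) : (restrictPoly K n f).IsHomogeneous d := by
  have h1 := hf.aeval (n := 1) (Fin.cons 0 X : Fin (n + 1) → MvPolynomial (Fin n) K) (fun i => by
    cases i using Fin.cases with
    | zero => exact isHomogeneous_zero _ _ _
    | succ i => exact isHomogeneous_X _ _)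
  rwa [one_mul] at h1

theorem totalDegree_restrictPoly_le (f : MvPolynomial (Fin (n + 1)) K) :
    (restrictPoly K n f).totalDegree ≤ f.totalDegree := by
  conv_lhs => rw [← sum_homogeneousComponent f, map_sum]
  refine totalDegree_finsetSum_le fun d hd => ?_
  exact (isHomogeneous_restrictPoly (homogeneousComponent_isHomogeneous d f)).totalDegree_le.trans
    (Nat.lt_succ_iff.1 (Finset.mem_range.1 hd))

/-- The forms `c` are the restrictions of the forms `a` to the hyperplane `X 0 = 0`, both families
being simple: each form `a h` restricts to `c (r h)`. -/
structure IsRestriction {ι κ : Type*} (a : ι → Fin (n + 1) → K) (c : κ → Fin n → K)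
    (r : ι → κ) : Prop where
  simple : IsSimpleFamily a
  simple_restrict : IsSimpleFamily c
  surjective : Function.Surjective r
  succ_eq : ∀ h i, a h (Fin.succ i) = c (r h) i

variable {ι κ : Type*} {a : ι → Fin (n + 1) → K} {c : κ → Fin n → K} {r : ι → κ}

namespace IsRestriction

theorem restrictPoly_linForm_eq (hr : IsRestriction a c r) (h : ι) :
    restrictPoly K n (linForm (a h)) = linForm (c (r h)) := by
  rw [restrictPoly_linForm]
  exact congrArg linForm (funext fun i => hr.succ_eq h i)

theorem linForm_eq (hr : IsRestriction a c r) (h : ι) :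
    linForm (a h) = C (a h 0) * X 0 + rename Fin.succ (linForm (c (r h))) := by
  rw [linForm, Fin.sum_univ_succ, linForm]
  simp [hr.succ_eq]

theorem isRelPrime_X_zero (hr : IsRestriction a c r) (h : ι) :
    IsRelPrime (linForm (a h)) (X 0) := by
  rw [isRelPrime_comm, X_prime.irreducible.isRelPrime_iff_not_dvd, ← restrictPoly_eq_zero_iff,
    hr.restrictPoly_linForm_eq]
  exact linForm_ne_zero (hr.simple_restrict.ne_zero _)

theorem mem_logFields_of_X_zero_smul (hr : IsRestriction a c r)
    {ζ : Fin (n + 1) → MvPolynomial (Fin (n + 1)) K}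
    (hζ : (X 0 : MvPolynomial (Fin (n + 1)) K) • ζ ∈ logFields a) :
    ζ ∈ logFields a := fun h => by
  have h1 := hζ h
  have h2 : ∑ i, C (a h i) * ((X 0 : MvPolynomial (Fin (n + 1)) K) • ζ) i = X 0 * ∑ i, C (a h i) * ζ i := by
    rw [Finset.mul_sum]
    exact Finset.sum_congr rfl fun i _ => by rw [Pi.smul_apply, smul_eq_mul]; ring
  rw [h2] at h1
  exact (hr.isRelPrime_X_zero h).dvd_of_dvd_mul_left h1

theorem exists_eq_X_zero_smul {τ : Type*} {η : τ → MvPolynomial (Fin (n + 1)) K}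
    (h : ∀ i, restrictPoly K n (η i) = 0) : ∃ ζ, η = (X 0 : MvPolynomial (Fin (n + 1)) K) • ζ := by
  choose ζ hζ using fun i => restrictPoly_eq_zero_iff.1 (h i)
  exact ⟨ζ, funext hζ⟩

/-- The restrictions of the members of a basis to the hyperplane `X 0 = 0` remain independent: a
logarithmic vector field that restricts to zero is `X 0` times a logarithmic vector field. -/
theorem linearIndependent_restrict (hr : IsRestriction a c r) {τ : Type*} [Fintype τ]
    {Θ : τ → Fin (n + 1) → MvPolynomial (Fin (n + 1)) K} {m : τ → ℕ} (hΘ : IsLogBasis a Θ m) :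
    LinearIndependent (MvPolynomial (Fin n) K) fun j i => restrictPoly K n (Θ j i) := by
  rw [Fintype.linearIndependent_iff]
  intro p hp j
  obtain ⟨ζ, hζ⟩ := exists_eq_X_zero_smul (η := ∑ j, rename Fin.succ (p j) • Θ j) (fun i => by
    have h1 := congrFun hp i
    rw [Finset.sum_apply] at h1 ⊢
    rw [map_sum]
    refine (Finset.sum_congr rfl fun j _ => ?_).trans h1
    rw [Pi.smul_apply, Pi.smul_apply, smul_eq_mul, smul_eq_mul, map_mul, restrictPoly_rename])
  have h2 : ζ ∈ logFields a := hr.mem_logFields_of_X_zero_smul (by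
    rw [← hζ]
    exact Submodule.sum_mem _ fun j _ => Submodule.smul_mem _ _ (hΘ.mem j))
  rw [← hΘ.span_eq, Submodule.mem_span_range_iff_exists_fun] at h2
  obtain ⟨q, rfl⟩ := h2
  rw [Finset.smul_sum, ← sub_eq_zero, ← Finset.sum_sub_distrib] at hζ
  simp only [smul_smul, ← sub_smul] at hζ
  have h3 := Fintype.linearIndependent_iff.1 hΘ.linearIndependent _ hζ j
  rw [← restrictPoly_rename (p j), sub_eq_zero.1 h3, map_mul, restrictPoly_X_zero, zero_mul]

/-- A logarithmic vector field of the restriction becomes, after multiplication with the forms that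
do not restrict to the form with index `x`, the restriction of a logarithmic vector field. -/
theorem prod_smul_mem (hr : IsRestriction a c r) [Fintype ι] [DecidableEq κ] {τ : Type*} [Fintype τ]
    {Θ : τ → Fin (n + 1) → MvPolynomial (Fin (n + 1)) K} {m : τ → ℕ} (hΘ : IsLogBasis a Θ m)
    {φ : Fin n → MvPolynomial (Fin n) K} (hφ : φ ∈ logFields c) (x : κ) :
    (∏ h ∈ Finset.univ.filter (fun h => r h ≠ x), linForm (c (r h))) •
      (Fin.cons 0 φ : Fin (n + 1) → MvPolynomial (Fin n) K) ∈
      Submodule.span (MvPolynomial (Fin n) K) (Set.range fun j i => restrictPoly K n (Θ j i)) := by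
  obtain ⟨g, hg⟩ := hφ x
  -- an extension of `φ` that is tangent to the hyperplanes with restriction `x`
  set ψ : Fin (n + 1) → MvPolynomial (Fin (n + 1)) K :=
    Fin.cons (X 0 * rename Fin.succ g) fun i => rename Fin.succ (φ i) with hψ
  set Q := ∏ h ∈ Finset.univ.filter (fun h => r h ≠ x), linForm (a h) with hQ
  have h1 : Q • ψ ∈ logFields a := by
    intro h
    have h2 : ∑ i, C (a h i) * (Q • ψ) i = Q * ∑ i, C (a h i) * ψ i := by
      rw [Finset.mul_sum]
      exact Finset.sum_congr rfl fun i _ => by rw [Pi.smul_apply, smul_eq_mul]; ring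
    rw [h2]
    by_cases hx : r h = x
    · refine Dvd.dvd.mul_left ⟨rename Fin.succ g, ?_⟩ _
      have h3 := congrArg (rename (Fin.succ : Fin n → Fin (n + 1))) hg
      rw [map_sum, map_mul] at h3
      simp only [map_mul, rename_C] at h3
      rw [hr.linForm_eq, hx, add_mul, ← h3, Fin.sum_univ_succ, hψ]
      simp only [Fin.cons_zero, Fin.cons_succ, hr.succ_eq, hx]
      ring
    · exact Dvd.dvd.mul_right
        (Finset.dvd_prod_of_mem _ (Finset.mem_filter.2 ⟨Finset.mem_univ h, hx⟩)) _
  rw [← hΘ.span_eq, Submodule.mem_span_range_iff_exists_fun] at h1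
  obtain ⟨q, hq⟩ := h1
  rw [Submodule.mem_span_range_iff_exists_fun]
  refine ⟨fun j => restrictPoly K n (q j), funext fun i => ?_⟩
  have h2 := congrArg (restrictPoly K n) (congrFun hq i)
  rw [Finset.sum_apply, map_sum, Pi.smul_apply, smul_eq_mul, map_mul, hQ, map_prod] at h2
  simp only [hr.restrictPoly_linForm_eq] at h2
  rw [Finset.sum_apply, Pi.smul_apply, smul_eq_mul]
  refine (Finset.sum_congr rfl fun j _ => ?_).trans (h2.trans ?_)
  · rw [Pi.smul_apply, Pi.smul_apply, smul_eq_mul, smul_eq_mul, map_mul]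
  · congr 1
    cases i using Fin.cases with
    | zero => simp only [hψ, Fin.cons_zero, map_mul, restrictPoly_X_zero, zero_mul]
    | succ i => simp only [hψ, Fin.cons_succ, restrictPoly_rename]

/-- If the deletion is free, then every logarithmic vector field of the restriction extends to one of
the deletion. -/
theorem cons_zero_mem_span (hr : IsRestriction a c r) [Fintype ι] [Nonempty ι] {τ : Type*}
    [Fintype τ] {Θ : τ → Fin (n + 1) → MvPolynomial (Fin (n + 1)) K} {m : τ → ℕ}
    (hΘ : IsLogBasis a Θ m) {φ : Fin n → MvPolynomial (Fin n) K} (hφ : φ ∈ logFields c) :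
    (Fin.cons 0 φ : Fin (n + 1) → MvPolynomial (Fin n) K) ∈
      Submodule.span (MvPolynomial (Fin n) K) (Set.range fun j i => restrictPoly K n (Θ j i)) := by
  classical
  obtain ⟨h₀⟩ := ‹Nonempty ι›
  refine mem_span_of_prod_smul_mem (hr.linearIndependent_restrict hΘ)
    (fun h => linForm_prime (hr.simple_restrict.ne_zero (r h))) (fun h => ?_) _
    (hr.prod_smul_mem hΘ hφ (r h₀))
  refine ⟨_, fun hd => ?_, hr.prod_smul_mem hΘ hφ (r h)⟩
  obtain ⟨h', hh', hd'⟩ := ((linForm_prime (hr.simple_restrict.ne_zero (r h))).dvd_finsetProd_iff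
    _).1 hd
  exact hr.simple_restrict.not_dvd (Finset.mem_filter.1 hh').2.symm hd'

/-- The exponents of a free restriction dominate those of a free deletion. -/
theorem deletion_le (hr : IsRestriction a c r) [Fintype ι] [Nonempty ι]
    {Θ : Fin (n + 1) → Fin (n + 1) → MvPolynomial (Fin (n + 1)) K} {d : Fin (n + 1) → ℕ}
    (hΘ : IsLogBasis a Θ d) (hd : Monotone d)
    {Φ : Fin n → Fin n → MvPolynomial (Fin n) K} {e : Fin n → ℕ}
    (hΦ : IsLogBasis c Φ e) (he : Monotone e) (i : Fin n) : d i.castSucc ≤ e i := by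
  by_contra! hlt
  -- the first `i + 1` basis fields of the restriction lie in the span of the first `i` basis fields
  -- of the deletion
  have h1 : LinearIndependent (MvPolynomial (Fin n) K) fun k : Finset.Iic i =>
      (Fin.cons 0 (Φ k) : Fin (n + 1) → MvPolynomial (Fin n) K) := by
    have h2 := hΦ.linearIndependent.comp (Subtype.val : Finset.Iic i → Fin n) Subtype.val_injective
    rw [Fintype.linearIndependent_iff] at h2 ⊢
    intro p hp
    refine h2 p (funext fun l => ?_)
    have h3 := congrFun hp l.succ
    simpa [Finset.sum_apply] using h3
  have h2 := h1.card_le_of_mem_span (Finset.Iio i.castSucc)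
    (fun j i => restrictPoly K n (Θ j i)) (fun k => by
      refine mem_span_of_homogeneous (e := e k) (d := d) (fun l => ?_)
        (fun j l => isHomogeneous_restrictPoly (hΘ.homogeneous j l))
        (hr.cons_zero_mem_span hΘ (hΦ.mem k)) fun j hj => ?_
      · cases l using Fin.cases with
        | zero => exact isHomogeneous_zero _ _ _
        | succ l => exact hΦ.homogeneous k l
      · rw [Finset.mem_coe, Finset.mem_Iio]
        by_contra! hle
        exact absurd (hlt.trans_le (hd hle)) (hj.trans (he (Finset.mem_Iic.1 k.2))).not_gt)
  rw [Fin.card_Iio, Fin.val_castSucc, Fintype.card_coe, Fin.card_Iic] at h2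
  omega

end IsRestriction
end Restriction

/-! ### Restriction of a free arrangement -/

section FreeRestriction

open MvPolynomial

variable {K : Type*} [Field K] {n : ℕ} {ι κ : Type*} {a : ι → Fin (n + 1) → K} {c : κ → Fin n → K}
  {r : ι → κ}

/-- The restriction of a vector field to the hyperplane `X 0 = 0`, without the component with index
`0`, which vanishes there if the vector field is tangent to the hyperplane. -/
def restrictField (θ : Fin (n + 1) → MvPolynomial (Fin (n + 1)) K) : Fin n → MvPolynomial (Fin n) K :=
  fun i => restrictPoly K n (θ i.succ)

theorem restrictField_sum {τ : Type*} [Fintype τ] (p : τ → MvPolynomial (Fin (n + 1)) K)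
    (θ : τ → Fin (n + 1) → MvPolynomial (Fin (n + 1)) K) :
    restrictField (∑ j, p j • θ j) = ∑ j, restrictPoly K n (p j) • restrictField (θ j) := by
  funext i
  rw [restrictField, Finset.sum_apply, Finset.sum_apply, map_sum]
  exact Finset.sum_congr rfl fun j _ => map_mul _ _ _

/-- The family `a`, enlarged by the form `X 0`. -/
def adjoinZero (a : ι → Fin (n + 1) → K) : Option ι → Fin (n + 1) → K :=
  fun h => h.elim (Pi.single 0 1) a

theorem mem_logFields_adjoinZero {θ : Fin (n + 1) → MvPolynomial (Fin (n + 1)) K} :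
    θ ∈ logFields (adjoinZero a) ↔ X 0 ∣ θ 0 ∧ θ ∈ logFields a := by
  have h1 : linForm (Pi.single 0 1 : Fin (n + 1) → K) = X 0 := by
    rw [linForm, Finset.sum_eq_single_of_mem 0 (Finset.mem_univ _) fun i _ hi => by simp [hi]]
    simp
  have h2 : ∑ i, C ((Pi.single 0 1 : Fin (n + 1) → K) i) * θ i = θ 0 := by
    rw [Finset.sum_eq_single_of_mem 0 (Finset.mem_univ _) fun i _ hi => by simp [hi]]
    simp
  rw [mem_logFields, Option.forall]
  simp only [adjoinZero, Option.elim, h1, h2]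
  rfl

namespace IsRestriction

theorem restrictField_mem (hr : IsRestriction a c r)
    {θ : Fin (n + 1) → MvPolynomial (Fin (n + 1)) K} (hθ : θ ∈ logFields (adjoinZero a)) :
    restrictField θ ∈ logFields c := by
  rw [mem_logFields_adjoinZero] at hθ
  intro x
  obtain ⟨h, rfl⟩ := hr.surjective x
  have h1 := map_dvd (restrictPoly K n) (hθ.2 h)
  rw [hr.restrictPoly_linForm_eq, Fin.sum_univ_succ, map_add, map_mul,
    restrictPoly_eq_zero_iff.2 hθ.1, mul_zero, zero_add, map_sum] at h1
  simpa only [map_mul, restrictPoly_C, hr.succ_eq, restrictField] using h1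

/-- The restricted basis fields have full rank. -/
theorem prod_smul_mem_restrictField (hr : IsRestriction a c r) [Fintype ι] {τ : Type*} [Fintype τ]
    {Θ : τ → Fin (n + 1) → MvPolynomial (Fin (n + 1)) K} {d : τ → ℕ}
    (hΘ : IsLogBasis (adjoinZero a) Θ d) (φ : Fin n → MvPolynomial (Fin n) K) :
    (∏ h, linForm (c (r h))) • φ ∈
      Submodule.span (MvPolynomial (Fin n) K) (Set.range fun j => restrictField (Θ j)) := by
  set ψ : Fin (n + 1) → MvPolynomial (Fin (n + 1)) K :=
    Fin.cons 0 fun i => rename Fin.succ (φ i) with hψ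
  set Q := ∏ h, linForm (a h) with hQ
  have h1 : Q • ψ ∈ logFields (adjoinZero a) := by
    rw [mem_logFields_adjoinZero]
    constructor
    · rw [Pi.smul_apply, hψ, Fin.cons_zero, smul_zero]
      exact dvd_zero _
    · intro h
      refine Finset.dvd_sum fun i _ => Dvd.dvd.mul_left ?_ _
      exact Dvd.dvd.mul_right (Finset.dvd_prod_of_mem _ (Finset.mem_univ h)) _
  rw [← hΘ.span_eq, Submodule.mem_span_range_iff_exists_fun] at h1
  obtain ⟨q, hq⟩ := h1
  rw [Submodule.mem_span_range_iff_exists_fun]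
  refine ⟨fun j => restrictPoly K n (q j), ?_⟩
  rw [← restrictField_sum, hq]
  funext i
  rw [restrictField, Pi.smul_apply, smul_eq_mul, map_mul, hψ, Fin.cons_succ, restrictPoly_rename,
    hQ, map_prod]
  simp only [hr.restrictPoly_linForm_eq]
  rfl

/-- The exponents of the free arrangement, apart from the smallest one, dominate those of the free
restriction. Otherwise too many restricted basis fields lie in the span of too few basis fields of
the restriction, although the restricted fields have full rank. -/
theorem restriction_le (hr : IsRestriction a c r) [Fintype ι]
    {Θ : Fin (n + 1) → Fin (n + 1) → MvPolynomial (Fin (n + 1)) K} {d : Fin (n + 1) → ℕ}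
    (hΘ : IsLogBasis (adjoinZero a) Θ d) (hd : Monotone d)
    {Φ : Fin n → Fin n → MvPolynomial (Fin n) K} {e : Fin n → ℕ}
    (hΦ : IsLogBasis c Φ e) (he : Monotone e) (i : Fin n) : e i ≤ d i.succ := by
  by_contra! hlt
  -- otherwise `n - 1` vector fields would span a module of rank `n`
  have hQ0 : ∏ h, linForm (c (r h)) ≠ 0 :=
    Finset.prod_ne_zero_iff.2 fun h _ => linForm_ne_zero (hr.simple_restrict.ne_zero _)
  have h1 : LinearIndependent (MvPolynomial (Fin n) K) fun k =>
      (∏ h, linForm (c (r h))) • Φ k := by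
    have h2 := hΦ.linearIndependent
    rw [Fintype.linearIndependent_iff] at h2 ⊢
    intro p hp k
    refine (mul_eq_zero.1 (h2 (fun k => p k * ∏ h, linForm (c (r h))) ?_ k)).resolve_right hQ0
    rw [← hp]
    exact Finset.sum_congr rfl fun k _ => mul_smul _ _ _
  set w : Fin n ⊕ Fin (n + 1) → Fin n → MvPolynomial (Fin n) K :=
    Sum.elim Φ fun j => restrictField (Θ j) with hw
  have h2 := h1.card_le_of_mem_span ((Finset.Iio i).disjSum (Finset.Ioi i.succ)) w (fun k => by
    refine Submodule.span_le.2 ?_ (hr.prod_smul_mem_restrictField hΘ (Φ k))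
    rintro _ ⟨j, rfl⟩
    rcases le_or_gt j i.succ with hj | hj
    · have h3 : restrictField (Θ j) ∈ Submodule.span (MvPolynomial (Fin n) K) (Φ '' Set.Iio i) := by
        refine mem_span_of_homogeneous (e := d j)
          (fun l => isHomogeneous_restrictPoly (hΘ.homogeneous j _)) hΦ.homogeneous ?_ fun k hk => ?_
        · rw [hΦ.span_eq]
          exact hr.restrictField_mem (hΘ.mem j)
        · rw [Set.mem_Iio]
          by_contra! hle
          exact absurd (hlt.trans_le (he hle)) (hk.trans (hd hj)).not_gt
      refine Submodule.span_mono ?_ h3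
      rintro _ ⟨k, hk, rfl⟩
      exact ⟨Sum.inl k, by simpa using hk, rfl⟩
    · exact Submodule.subset_span ⟨Sum.inr j, by simpa using hj, rfl⟩)
  rw [Finset.card_disjSum, Fin.card_Iio, Fin.card_Ioi, Fintype.card_fin, Fin.val_succ] at h2
  omega

/-- Let `θ` be a logarithmic vector field of `a` that is not tangent to the hyperplane `X 0 = 0`. The
forms `a h` and `a h'` with the same restriction differ by a multiple of `X 0`; so modulo `X 0`, the
component `θ 0` is divisible by the restriction of `a h` for all but one `h` in each fibre of `r`. -/
theorem card_le_totalDegree (hr : IsRestriction a c r) [Fintype ι] [Fintype κ]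
    {θ : Fin (n + 1) → MvPolynomial (Fin (n + 1)) K} (hθ : θ ∈ logFields a) (h0 : ¬ X 0 ∣ θ 0) :
    Fintype.card ι ≤ (θ 0).totalDegree + Fintype.card κ := by
  classical
  set g := Function.surjInv hr.surjective with hg
  have hrg : ∀ x, r (g x) = x := Function.surjInv_eq hr.surjective
  set T : Finset ι := Finset.univ.filter fun h => g (r h) ≠ h with hT
  have hfib : ∀ x, ∏ h ∈ T with r h = x, linForm (c (r h)) ∣ restrictPoly K n (θ 0) := by
    intro x
    obtain ⟨q, hq⟩ := hθ (g x)
    have h1 : ∏ h ∈ T with r h = x, linForm (a h) ∣ θ 0 - X 0 * q := by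
      refine Finset.prod_dvd_of_isRelPrime
        (fun h _ h' _ hne => hr.simple.isRelPrime hne) fun h hh => ?_
      obtain ⟨hh1, rfl⟩ := Finset.mem_filter.1 hh
      have hne : g (r h) ≠ h := (Finset.mem_filter.1 hh1).2
      have h2 : a h 0 - a (g (r h)) 0 ≠ 0 := by
        intro h3
        have h4 : a h = a (g (r h)) := by
          funext i
          cases i using Fin.cases with
          | zero => exact sub_eq_zero.1 h3
          | succ i => rw [hr.succ_eq, hr.succ_eq, hrg]
        exact hr.simple.not_dvd hne (by rw [← h4])
      have h5 : C (a h 0 - a (g (r h)) 0) * (θ 0 - X 0 * q) =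
          ∑ i, C (a h i) * θ i - linForm (a h) * q := by
        rw [hr.linForm_eq, hrg] at hq
        rw [hr.linForm_eq]
        rw [Fin.sum_univ_succ] at hq ⊢
        simp only [hr.succ_eq, hrg] at hq ⊢
        rw [C_sub]
        linear_combination -hq
      have h6 : linForm (a h) ∣ C (a h 0 - a (g (r h)) 0) * (θ 0 - X 0 * q) := by
        rw [h5]
        exact dvd_sub (hθ h) (dvd_mul_right _ _)
      exact (IsUnit.dvd_mul_left ((isUnit_iff_ne_zero.2 h2).map C)).1 h6
    have h7 := map_dvd (restrictPoly K n) h1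
    rw [map_prod, map_sub, map_mul, restrictPoly_X_zero, zero_mul, sub_zero] at h7
    simpa only [hr.restrictPoly_linForm_eq] using h7
  have h1 := Fintype.prod_dvd_of_isRelPrime (s := fun x => ∏ h ∈ T with r h = x, linForm (c (r h)))
    (fun x y hxy => IsRelPrime.prod_left fun h hh => IsRelPrime.prod_right fun h' hh' => by
      rw [(Finset.mem_filter.1 hh).2, (Finset.mem_filter.1 hh').2]
      exact hr.simple_restrict.isRelPrime hxy) hfib
  rw [Finset.prod_fiberwise T r fun h => linForm (c (r h))] at h1
  have h2 := totalDegree_le_of_dvd_of_isDomain h1 (fun h => h0 (restrictPoly_eq_zero_iff.1 h))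
  rw [totalDegree_prod_linForm _ _ fun h _ => hr.simple_restrict.ne_zero _] at h2
  have h3 : Fintype.card ι = (Finset.univ.filter fun h => g (r h) = h).card + T.card := by
    rw [hT, Finset.card_filter_add_card_filter_not, Finset.card_univ]
  have h4 : (Finset.univ.filter fun h => g (r h) = h).card ≤ Fintype.card κ := by
    rw [← Finset.card_univ (α := κ)]
    refine (Finset.card_le_card (t := Finset.univ.image g) fun h hh => ?_).trans
      Finset.card_image_le
    exact Finset.mem_image.2 ⟨r h, Finset.mem_univ _, (Finset.mem_filter.1 hh).2⟩
  have h5 := totalDegree_restrictPoly_le (θ 0)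
  omega

/-- A combination of the basis fields that restricts to zero, but is not a multiple of `X 0`, is of
large degree. -/
theorem card_le_of_restrictField_eq_zero (hr : IsRestriction a c r) [Fintype ι] [Fintype κ]
    {τ : Type*} [Fintype τ] {Θ : τ → Fin (n + 1) → MvPolynomial (Fin (n + 1)) K} {d : τ → ℕ}
    (hΘ : IsLogBasis (adjoinZero a) Θ d) {p : τ → MvPolynomial (Fin (n + 1)) K}
    (hp : restrictField (∑ j, p j • Θ j) = 0) {j : τ} (hj : ¬ X 0 ∣ p j) {D : ℕ}
    (hD : ((∑ j, p j • Θ j) 0).totalDegree ≤ D) :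
    Fintype.card ι + 1 ≤ D + Fintype.card κ := by
  have h1 : ∑ j, p j • Θ j ∈ logFields (adjoinZero a) :=
    Submodule.sum_mem _ fun j _ => Submodule.smul_mem _ _ (hΘ.mem j)
  obtain ⟨ζ, hζ⟩ := exists_eq_X_zero_smul (η := ∑ j, p j • Θ j) (fun i => by
    cases i using Fin.cases with
    | zero => exact restrictPoly_eq_zero_iff.2 (mem_logFields_adjoinZero.1 h1).1
    | succ i => exact congrFun hp i)
  have h2 : ζ ∈ logFields a :=
    hr.mem_logFields_of_X_zero_smul (hζ ▸ (mem_logFields_adjoinZero.1 h1).2)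
  have h3 : ¬ X 0 ∣ ζ 0 := fun hd => by
    have h4 := mem_logFields_adjoinZero.2 ⟨hd, h2⟩
    rw [← hΘ.span_eq, Submodule.mem_span_range_iff_exists_fun] at h4
    obtain ⟨q, rfl⟩ := h4
    rw [Finset.smul_sum, ← sub_eq_zero, ← Finset.sum_sub_distrib] at hζ
    simp only [smul_smul, ← sub_smul] at hζ
    have h5 := Fintype.linearIndependent_iff.1 hΘ.linearIndependent _ hζ j
    exact hj ⟨q j, sub_eq_zero.1 h5⟩
  have h4 := hr.card_le_totalDegree h2 h3
  have h5 : ζ 0 ≠ 0 := fun h => h3 (h ▸ dvd_zero _)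
  rw [hζ, Pi.smul_apply, smul_eq_mul, totalDegree_mul_of_isDomain (X_ne_zero 0) h5,
    totalDegree_X] at hD
  omega

/-- If the second exponent of the free arrangement is smaller than that of the free restriction, then
it is large: the first two basis fields restrict to multiples of one vector field, and a combination
of them that restricts to zero is `X 0` times a vector field not tangent to the hyperplane. -/
theorem card_le_of_lt {n : ℕ} {a : ι → Fin (n + 3) → K} {c : κ → Fin (n + 2) → K}
    (hr : IsRestriction a c r) [Fintype ι] [Fintype κ]
    {Θ : Fin (n + 3) → Fin (n + 3) → MvPolynomial (Fin (n + 3)) K} {d : Fin (n + 3) → ℕ}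
    (hΘ : IsLogBasis (adjoinZero a) Θ d) (hd0 : d 0 = 1) (hd1 : 1 ≤ d 1)
    {Φ : Fin (n + 2) → Fin (n + 2) → MvPolynomial (Fin (n + 2)) K} {e : Fin (n + 2) → ℕ}
    (hΦ : IsLogBasis c Φ e) (he : Monotone e) (he0 : e 0 = 1) (hlt : d 1 < e 1) :
    Fintype.card ι + 1 ≤ d 1 + Fintype.card κ := by
  have hmul : ∀ j, d j < e 1 → ∃ q : MvPolynomial (Fin (n + 2)) K,
      restrictField (Θ j) = q • Φ 0 ∧ q.IsHomogeneous (d j - 1) := by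
    intro j hj
    obtain ⟨q, hq, hq'⟩ := exists_homogeneous_coeff (e := d j)
      (fun l => isHomogeneous_restrictPoly (hΘ.homogeneous j l.succ)) hΦ.homogeneous (by
        rw [hΦ.span_eq]
        exact hr.restrictField_mem (hΘ.mem j))
    have h0 := (hq' 0).1
    rw [he0] at h0
    refine ⟨q 0, ?_, h0⟩
    refine hq.symm.trans (Finset.sum_eq_single_of_mem 0 (Finset.mem_univ _) fun k _ hk => ?_)
    rw [(hq' k).2 (hj.trans_le (he (Fin.one_le_of_ne_zero hk))), zero_smul]
  obtain ⟨q0, hq0, hq0'⟩ := hmul 0 (by omega)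
  obtain ⟨q1, hq1, hq1'⟩ := hmul 1 hlt
  -- `q0` is a constant, so the combination `q0 • Θ 1 - q1 • Θ 0` is still of degree `d 1`
  by_cases h0 : q0 = 0
  · refine hr.card_le_of_restrictField_eq_zero hΘ (p := Pi.single 0 1) (j := 0) ?_ ?_ ?_
    · rw [restrictField_sum, Finset.sum_eq_single_of_mem 0 (Finset.mem_univ _) fun k _ hk => by
        rw [Pi.single_eq_of_ne hk, map_zero, zero_smul], hq0, h0, zero_smul, smul_zero]
    · rw [Pi.single_eq_same]
      exact fun h => X_prime.not_isUnit (isUnit_of_dvd_one h)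
    · rw [Finset.sum_eq_single_of_mem 0 (Finset.mem_univ _) fun k _ hk => by
        rw [Pi.single_eq_of_ne hk, zero_smul], Pi.single_eq_same, one_smul]
      exact (hΘ.homogeneous 0 0).totalDegree_le.trans (hd0.trans_le hd1)
  · have hne : (1 : Fin (n + 3)) ≠ 0 := by simp
    set s0 : MvPolynomial (Fin (n + 3)) K := rename Fin.succ q0 with hs0
    set s1 : MvPolynomial (Fin (n + 3)) K := rename Fin.succ q1 with hs1
    set p : Fin (n + 3) → MvPolynomial (Fin (n + 3)) K := Pi.single 1 s0 - Pi.single 0 s1 with hp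
    have hsum : ∑ j, p j • Θ j = s0 • Θ 1 - s1 • Θ 0 := by
      simp only [hp, Pi.sub_apply, sub_smul, Finset.sum_sub_distrib]
      rw [Finset.sum_eq_single_of_mem 1 (Finset.mem_univ _) fun k _ hk => by
        rw [Pi.single_eq_of_ne hk, zero_smul],
        Finset.sum_eq_single_of_mem 0 (Finset.mem_univ _) fun k _ hk => by
        rw [Pi.single_eq_of_ne hk, zero_smul], Pi.single_eq_same, Pi.single_eq_same]
    refine hr.card_le_of_restrictField_eq_zero hΘ (p := p) (j := 1) ?_ ?_ ?_
    · rw [hsum]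
      funext i
      have h1 := congrFun hq0 i
      have h2 := congrFun hq1 i
      rw [restrictField, Pi.smul_apply, smul_eq_mul] at h1 h2
      rw [restrictField, Pi.sub_apply, Pi.smul_apply, Pi.smul_apply, smul_eq_mul, smul_eq_mul,
        map_sub, map_mul, map_mul, hs0, hs1, restrictPoly_rename, restrictPoly_rename, h1, h2, Pi.zero_apply]
      ring
    · rw [hp, Pi.sub_apply, Pi.single_eq_same, Pi.single_eq_of_ne hne, sub_zero,
        ← restrictPoly_eq_zero_iff, hs0, restrictPoly_rename]
      exact h0
    · rw [hsum]
      refine ((totalDegree_sub _ _).trans (max_le ?_ ?_))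
      · have h1 := (hq0'.rename_isHomogeneous (f := Fin.succ)).mul (hΘ.homogeneous 1 0)
        rw [hd0, Nat.sub_self, zero_add] at h1
        exact h1.totalDegree_le
      · have h1 := (hq1'.rename_isHomogeneous (f := Fin.succ)).mul (hΘ.homogeneous 0 0)
        rw [hd0, Nat.sub_add_cancel hd1] at h1
        exact h1.totalDegree_le

end IsRestriction

end FreeRestriction

/-! ### Exponents and roots of the characteristic polynomial -/

theorem eq_of_monotone_of_prod_eq {N : ℕ} {f g : Fin N → ℤ} (hf : Monotone f) (hg : Monotone g)
    (h : ∏ j, (Polynomial.X - Polynomial.C (f j)) = ∏ j, (Polynomial.X - Polynomial.C (g j))) :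
    f = g := by
  have h1 : ∀ f : Fin N → ℤ, (∏ j, (Polynomial.X - Polynomial.C (f j))).roots =
      (List.ofFn f : Multiset ℤ) := fun f => by
    rw [← Fin.univ_val_map, ← Polynomial.roots_multiset_prod_X_sub_C (Multiset.map f _),
      Multiset.map_map]
    rfl
  have h2 := congrArg Polynomial.roots h
  rw [h1, h1, Multiset.coe_eq_coe] at h2
  exact List.ofFn_injective
    (h2.eq_of_sortedLE (List.sortedLE_ofFn_iff.2 hf) (List.sortedLE_ofFn_iff.2 hg))

theorem prod_Icc_two_eq {M : Type*} [CommMonoid M] (f : ℕ → M) (n : ℕ) :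
    ∏ i ∈ Finset.Icc 2 (n + 1), f i = ∏ j : Fin n, f (j + 2) := by
  rw [Fin.prod_univ_eq_prod_range (fun i => f (i + 2)) n]
  refine (Finset.prod_nbij' (fun i => i + 2) (fun i => i - 2) ?_ ?_ ?_ ?_ fun _ _ => rfl).symm
  all_goals
    intro i hi
    simp only [Finset.mem_range, Finset.mem_Icc] at *
    omega

/-- The exponents are `1` and the roots of the reduced characteristic polynomial. -/
theorem exponents_eq {n : ℕ} {m : Fin (n + 1) → ℕ} (hm : Monotone m) {d : ℕ → ℤ}
    (hd1 : ∀ i ∈ Finset.Icc 2 (n + 1), 1 ≤ d i) (hd : MonotoneOn d (Set.Icc 2 (n + 1)))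
    (h : ∏ j, (Polynomial.X - Polynomial.C (m j : ℤ)) = (Polynomial.X - Polynomial.C 1) *
      ∏ i ∈ Finset.Icc 2 (n + 1), (Polynomial.X - Polynomial.C (d i))) :
    m 0 = 1 ∧ ∀ j : Fin n, (m j.succ : ℤ) = d (j + 2) := by
  set g : Fin (n + 1) → ℤ := Fin.cons 1 fun j : Fin n => d (j + 2) with hg
  have hmem : ∀ j : Fin n, (j : ℕ) + 2 ∈ Finset.Icc 2 (n + 1) := fun j =>
    Finset.mem_Icc.2 ⟨by omega, by omega⟩
  have h1 : (fun j => (m j : ℤ)) = g := by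
    refine eq_of_monotone_of_prod_eq (fun i j hij => by exact_mod_cast hm hij) ?_ ?_
    · intro i j hij
      cases j using Fin.cases with
      | zero => rw [Fin.le_zero_iff.1 hij]
      | succ j =>
        cases i using Fin.cases with
        | zero => exact hd1 _ (hmem j)
        | succ i =>
          have hij' : i ≤ j := Fin.succ_le_succ_iff.1 hij
          exact hd (Finset.mem_Icc.1 (hmem i)) (Finset.mem_Icc.1 (hmem j))
            (Nat.add_le_add_right hij' 2)
    · rw [h, prod_Icc_two_eq, Fin.prod_univ_succ]
      rfl
  constructor
  · have h2 := congrFun h1 0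
    rw [hg, Fin.cons_zero] at h2
    exact_mod_cast h2
  · exact fun j => congrFun h1 j.succ

/-! ### Coordinates adapted to a hyperplane -/

namespace HypArr

section AdaptedCoordinates

variable {K V : Type*} [Field K] [AddCommGroup V] [Module K V]

/-- Coordinates in which `H` is the hyperplane `X 0 = 0`, and linear forms for the arrangement, its
deletion and its restriction that restrict to each other. -/
theorem exists_coordinates [FiniteDimensional K V] (A : HypArr K V) (H : Submodule K V)
    (hH : H ∈ A.carrier) {n : ℕ} (hn : Module.finrank K V = n + 1) :
    ∃ (b : Module.Basis (Fin (n + 1)) K V) (bH : Module.Basis (Fin n) K H) (β : Module.Dual K V)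
      (α : ↥(A.carrier \ {H}) → Module.Dual K V)
      (γ : (A.restriction H hH).carrier → Module.Dual K H)
      (r : ↥(A.carrier \ {H}) → (A.restriction H hH).carrier),
      A.IsDefining (fun h : Option ↥(A.carrier \ {H}) => h.elim β α) ∧
      (A.deletion H).IsDefining α ∧ (A.restriction H hH).IsDefining γ ∧
      (fun (h : Option ↥(A.carrier \ {H})) i => h.elim β α (b i)) =
        adjoinZero (fun h i => α h (b i)) ∧
      IsRestriction (fun h i => α h (b i)) (fun x i => γ x (bH i)) r := by
  obtain ⟨β, hβ, hHβ⟩ := A.hyperplane H hH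
  have hfin : Module.finrank K H = n := by
    have h1 := Module.Dual.finrank_ker_add_one_of_ne_zero hβ
    rw [← hHβ, hn] at h1
    omega
  obtain ⟨v, hv⟩ := LinearMap.surjective hβ 1
  have hβH : ∀ x, x ∈ H ↔ β x = 0 := fun x => by rw [hHβ, LinearMap.mem_ker]
  let bH : Module.Basis (Fin n) K H := Module.finBasisOfFinrankEq K H hfin
  let b : Module.Basis (Fin (n + 1)) K V := Module.Basis.mkFinCons v bH
    (fun c x hx hcx => by
      have h1 := congrArg β hcx
      rwa [map_add, map_smul, hv, (hβH x).1 hx, map_zero, add_zero, smul_eq_mul, mul_one] at h1)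
    (fun z => ⟨-β z, by rw [hβH, map_add, map_smul, hv, smul_eq_mul, mul_one, add_neg_cancel]⟩)
  have hb0 : b 0 = v := by rw [Module.Basis.coe_mkFinCons, Fin.cons_zero]
  have hbs : ∀ i, b (Fin.succ i) = bH i := fun i => by
    rw [Module.Basis.coe_mkFinCons, Fin.cons_succ]
    rfl
  choose γ hγ hγker using fun x : (A.restriction H hH).carrier =>
    (A.restriction H hH).hyperplane x.1 x.2
  let r : ↥(A.carrier \ {H}) → (A.restriction H hH).carrier := fun L =>
    ⟨L.1.comap H.subtype, ⟨L.1, L.2, rfl⟩⟩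
  have hα : ∀ L : ↥(A.carrier \ {H}), ∃ α : Module.Dual K V, α ≠ 0 ∧ L.1 = LinearMap.ker α ∧
      α ∘ₗ H.subtype = γ (r L) := fun L => by
    obtain ⟨α, hα0, hαker⟩ := A.hyperplane L.1 L.2.1
    have h1 : LinearMap.ker (α ∘ₗ H.subtype) = LinearMap.ker (γ (r L)) := by
      rw [LinearMap.ker_comp, ← hαker, ← hγker]
    have h2 : α ∘ₗ H.subtype ≠ 0 := fun h0 => by
      rw [h0, LinearMap.ker_zero] at h1
      exact hγ _ (LinearMap.ker_eq_top.1 h1.symm)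
    obtain ⟨c, hc, hcγ⟩ := exists_eq_smul_of_ker_eq h2 h1
    refine ⟨c • α, smul_ne_zero hc hα0, ?_, ?_⟩
    · rw [LinearMap.ker_smul _ _ hc, hαker]
    · rw [hcγ]
      rfl
  choose α hα0 hαker hαγ using hα
  have hdel : (A.deletion H).IsDefining α := by
    refine ⟨hα0, fun L L' h => Subtype.ext ?_, Set.ext fun X => ⟨?_, fun hX => ?_⟩⟩
    · rw [hαker L, hαker L']
      exact h
    · rintro ⟨L, rfl⟩
      simp only [← hαker]
      exact L.2
    · exact ⟨⟨X, hX⟩, (hαker ⟨X, hX⟩).symm⟩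
  have hres : (A.restriction H hH).IsDefining γ := by
    refine ⟨hγ, fun L L' h => Subtype.ext ?_, Set.ext fun X => ⟨?_, fun hX => ?_⟩⟩
    · rw [hγker L, hγker L']
      exact h
    · rintro ⟨L, rfl⟩
      simp only [← hγker]
      exact L.2
    · exact ⟨⟨X, hX⟩, (hγker ⟨X, hX⟩).symm⟩
  have hall : A.IsDefining (fun h : Option ↥(A.carrier \ {H}) => h.elim β α) := by
    refine ⟨fun h => ?_, fun h h' hh => ?_, Set.ext fun X => ⟨?_, fun hX => ?_⟩⟩
    · cases h with
      | none => exact hβ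
      | some h => exact hα0 h
    · have hne : ∀ L, LinearMap.ker β ≠ LinearMap.ker (α L) := fun L h1 => by
        rw [← hHβ, ← hαker] at h1
        exact L.2.2 h1.symm
      cases h with
      | none =>
        cases h' with
        | none => rfl
        | some h' => exact absurd hh (hne h')
      | some h =>
        cases h' with
        | none => exact absurd hh.symm (hne h)
        | some h' => exact congrArg some (hdel.injective hh)
    · rintro ⟨h, rfl⟩
      cases h with
      | none => exact hHβ ▸ hH
      | some h =>
        have h1 := h.2.1
        rwa [hαker h] at h1
    · by_cases hXH : X = H
      · exact ⟨none, by rw [hXH]; exact hHβ.symm⟩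
      · exact ⟨some ⟨X, hX, hXH⟩, (hαker ⟨X, hX, hXH⟩).symm⟩
  refine ⟨b, bH, β, α, γ, r, hall, hdel, hres, ?_, hdel.isSimpleFamily b, hres.isSimpleFamily bH,
    ?_, fun L i => ?_⟩
  · funext h i
    cases h with
    | some h => rfl
    | none =>
      cases i using Fin.cases with
      | zero => simp [adjoinZero, hb0, hv]
      | succ i => simp [adjoinZero, hbs, (hβH _).1 (bH i).2]
  · rintro ⟨_, L, hL, rfl⟩
    exact ⟨⟨L, hL⟩, rfl⟩
  · rw [hbs, ← hαγ]
    rfl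

/-- The bases of a free arrangement in given coordinates, sorted by degree. -/
theorem IsDefining.exists_monotone_isLogBasis {ι : Type*} {A : HypArr K V}
    {α : ι → Module.Dual K V} (hα : A.IsDefining α) {n : ℕ} (b : Module.Basis (Fin n) K V)
    (hA : A.IsFree) :
    ∃ (Θ : Fin n → Fin n → MvPolynomial (Fin n) K) (m : Fin n → ℕ),
      IsLogBasis (fun h i => α h (b i)) Θ m ∧ Monotone m := by
  obtain ⟨Θ, m, hΘ⟩ := hα.exists_isLogBasis b hA
  exact ⟨_, _, hΘ.reindex (Tuple.sort m), Tuple.monotone_sort m⟩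

theorem IsDefining.charPoly_eq_prod {ι : Type*} [Fintype ι] [FiniteDimensional K V]
    {A : HypArr K V} {α : ι → Module.Dual K V} (hα : A.IsDefining α) {n : ℕ}
    (b : Module.Basis (Fin n) K V) {Θ : Fin n → Fin n → MvPolynomial (Fin n) K} {m : Fin n → ℕ}
    (hΘ : IsLogBasis (fun h i => α h (b i)) Θ m) :
    A.charPoly = ∏ j, (Polynomial.X - Polynomial.C (m j : ℤ)) := by
  rw [hα.charPoly_eq_whitneyPoly b, hΘ.whitneyPoly_eq (hα.isSimpleFamily b)]

theorem IsDefining.exponents_eq {ι : Type*} [Fintype ι] [Nonempty ι] [FiniteDimensional K V]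
    {A : HypArr K V} {α : ι → Module.Dual K V} (hα : A.IsDefining α) {n : ℕ}
    (b : Module.Basis (Fin (n + 1)) K V)
    {Θ : Fin (n + 1) → Fin (n + 1) → MvPolynomial (Fin (n + 1)) K} {m : Fin (n + 1) → ℕ}
    (hΘ : IsLogBasis (fun h i => α h (b i)) Θ m) (hm : Monotone m) {d : ℕ → ℤ}
    (hd1 : ∀ i ∈ Finset.Icc 2 (n + 1), 1 ≤ d i) (hd : MonotoneOn d (Set.Icc 2 (n + 1)))
    (h : A.charPoly₀ = ∏ i ∈ Finset.Icc 2 (n + 1), (Polynomial.X - Polynomial.C (d i))) :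
    m 0 = 1 ∧ ∀ j : Fin n, (m j.succ : ℤ) = d (j + 2) :=
  _root_.exponents_eq hm hd1 hd
    (by rw [← hα.charPoly_eq_prod b hΘ, hα.charPoly_eq_mul, h])

/-- The reduced characteristic polynomial of the empty arrangement has no positive root. -/
theorem IsDefining.charPoly₀_eval_pos {ι : Type*} [Fintype ι] [IsEmpty ι] [FiniteDimensional K V]
    {A : HypArr K V} {α : ι → Module.Dual K V} (hα : A.IsDefining α)
    (hV : Module.finrank K V ≠ 0) {t : ℤ} (ht : 1 ≤ t) : 0 < A.charPoly₀.eval t := by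
  classical
  set N := Module.finrank K V with hN
  have h1 : A.charPoly = Polynomial.X ^ N := by
    rw [hα.charPoly_eq_whitneyPoly (Module.finBasis K V), whitneyPoly, Fintype.sum_unique,
      ← finrank_flatOf (α := α) (Module.finBasis K V), Finset.eq_empty_of_isEmpty default, flatOf,
      Finset.inf_empty, finrank_top]
    simp [hN]
  have h2 : A.charPoly₀ = ∑ i ∈ Finset.range N, Polynomial.X ^ i := by
    refine (Polynomial.div_modByMonic_unique _ 1 (Polynomial.monic_X_sub_C 1) ⟨?_, ?_⟩).1
    · rw [h1, map_one, mul_geom_sum]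
      ring
    · rw [Polynomial.degree_one, Polynomial.degree_X_sub_C]
      exact zero_lt_one
  rw [h2, Polynomial.eval_finsetSum]
  refine Finset.sum_pos (fun i _ => ?_) (Finset.nonempty_range_iff.2 hV)
  rw [Polynomial.eval_pow, Polynomial.eval_X]
  positivity

end AdaptedCoordinates

end HypArr

/-! ### Comparison of the exponents -/

namespace HypArr

section Exponents

variable {K V : Type*} [Field K] [AddCommGroup V] [Module K V] [FiniteDimensional K V]

/-- The exponents of a free arrangement and a free restriction. Here `n + 1` is the dimension. If
`d 2 < e 2`, then all inequalities `e (i - 1) ≤ d i` for `3 ≤ i` are equalities, for the sums of the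
exponents are the numbers of hyperplanes. -/
theorem charPoly_dvd_or_le {A : HypArr K V} {H : Submodule K V} {hH : H ∈ A.carrier}
    (hA : A.IsFree) (hAH : (A.restriction H hH).IsFree) {n : ℕ}
    (hn : Module.finrank K V = n + 1) {d e : ℕ → ℤ}
    (hd0 : A.charPoly₀ = ∏ i ∈ Finset.Icc 2 (n + 1), (Polynomial.X - Polynomial.C (d i)))
    (he0 : (A.restriction H hH).charPoly₀ =
      ∏ i ∈ Finset.Icc 2 n, (Polynomial.X - Polynomial.C (e i)))
    (hd1 : ∀ i ∈ Finset.Icc 2 (n + 1), 1 ≤ d i) (hd : MonotoneOn d (Set.Icc 2 (n + 1)))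
    (he1 : ∀ i ∈ Finset.Icc 2 n, 1 ≤ e i) (he : MonotoneOn e (Set.Icc 2 n)) :
    (A.restriction H hH).charPoly ∣ A.charPoly ∨
      (e 2 ≤ d 2 ∧ ∀ i ∈ Finset.Icc 3 (n + 1), e (i - 1) ≤ d i) := by
  obtain ⟨b, bH, β, α, γ, r, hall, -, hres, hadj, hr⟩ := A.exists_coordinates H hH hn
  let _ : Fintype ↥(A.carrier \ {H}) := A.finite.sdiff.fintype
  let _ : Fintype (A.restriction H hH).carrier := (A.restriction H hH).finite.fintype
  obtain ⟨Θ, m, hΘ, hm⟩ := hall.exists_monotone_isLogBasis b hA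
  obtain ⟨Φ, k, hΦ, hk⟩ := hres.exists_monotone_isLogBasis bH hAH
  have hsumA := hΘ.sum_eq (hall.isSimpleFamily b)
  have hsumH := hΦ.sum_eq (hres.isSimpleFamily bH)
  have hpolyA := hall.charPoly_eq_prod b hΘ
  have hpolyH := hres.charPoly_eq_prod bH hΦ
  obtain ⟨hm0, hmd⟩ := hall.exponents_eq b hΘ hm hd1 hd hd0
  rw [hadj] at hΘ
  rw [Fintype.card_option] at hsumA
  rcases n with - | n
  · left
    rw [hpolyH, Finset.univ_eq_empty, Finset.prod_empty]
    exact one_dvd _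
  have hm1 : ∀ j : Fin (n + 1), 1 ≤ m j.succ := fun j => by
    have h1 := hd1 (j + 2) (Finset.mem_Icc.2 ⟨by omega, by omega⟩)
    rw [← hmd] at h1
    exact_mod_cast h1
  -- the exponents are positive and at least two in number, so that `H` is not the only hyperplane
  have hcard : 0 < Fintype.card ↥(A.carrier \ {H}) := by
    rw [Fin.sum_univ_succ, Fin.sum_univ_succ] at hsumA
    have h1 := hm1 0
    omega
  have hne : Nonempty ↥(A.carrier \ {H}) := Fintype.card_pos_iff.1 hcard
  have hneH : Nonempty (A.restriction H hH).carrier := hne.map r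
  obtain ⟨hk0, hke⟩ := hres.exponents_eq bH hΦ hk he1 he he0
  rcases n with - | n
  · left
    rw [hpolyH, hpolyA, Fin.prod_univ_succ, Fin.prod_univ_succ, hk0, hm0]
    simp
  by_cases hlt : m 1 < k 1
  · left
    have h1 := hr.card_le_of_lt hΘ hm0 (hm1 0) hΦ hk hk0 hlt
    have hle : ∀ j ∈ Finset.univ, k (Fin.succ j) ≤ m (Fin.succ (Fin.succ j)) := fun j _ =>
      hr.restriction_le hΘ hm hΦ hk (Fin.succ j)
    have h2 := Finset.sum_le_sum hle
    rw [Fin.sum_univ_succ, Fin.sum_univ_succ, Fin.succ_zero_eq_one] at hsumA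
    rw [Fin.sum_univ_succ] at hsumH
    have h3 := (Finset.sum_eq_sum_iff_of_le hle).1 (by omega)
    rw [hpolyA, hpolyH, Fin.prod_univ_succ (n := n + 1), Fin.prod_univ_succ (n := n + 2),
      Fin.prod_univ_succ (n := n + 1), hm0, hk0]
    refine mul_dvd_mul_left _ (Dvd.dvd.mul_left (dvd_of_eq ?_) _)
    exact Finset.prod_congr rfl fun j hj => by rw [h3 j hj]
  · right
    have h1 : ∀ j : Fin (n + 2), 1 ≤ (j : ℕ) → (k j : ℤ) = e (j + 1) := fun j hj => by
      obtain ⟨i, rfl⟩ := Fin.exists_succ_eq.2 (fun h : j = 0 => by simp [h] at hj)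
      rw [hke, Fin.val_succ]
    refine ⟨?_, fun i hi => ?_⟩
    · have h2 := hke 0
      have h3 := hmd 0
      rw [Fin.val_zero, zero_add] at h2 h3
      rw [← h2, ← h3]
      exact_mod_cast not_lt.1 hlt
    · rw [Finset.mem_Icc] at hi
      have h2 := hr.restriction_le hΘ hm hΦ hk ⟨i - 2, by omega⟩
      have h3 := hmd ⟨i - 2, by omega⟩
      have h4 := h1 ⟨i - 2, by omega⟩ (by simp only; omega)
      have h5 : i - 2 + 2 = i := by omega
      have h6 : i - 2 + 1 = i - 1 := by omega
      simp only [h5, h6] at h3 h4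
      rw [← h3, ← h4]
      exact_mod_cast h2

/-- The exponents of a free deletion and a free restriction. Here `n + 1` is the dimension. The
deletion is not empty because its reduced characteristic polynomial has a positive root. -/
theorem deletion_exponent_le {A : HypArr K V} {H : Submodule K V} {hH : H ∈ A.carrier}
    (hA : (A.deletion H).IsFree) (hAH : (A.restriction H hH).IsFree) {n : ℕ}
    (hn : Module.finrank K V = n + 1) {d e : ℕ → ℤ}
    (hd0 : (A.deletion H).charPoly₀ =
      ∏ i ∈ Finset.Icc 2 (n + 1), (Polynomial.X - Polynomial.C (d i)))
    (he0 : (A.restriction H hH).charPoly₀ =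
      ∏ i ∈ Finset.Icc 2 n, (Polynomial.X - Polynomial.C (e i)))
    (hd1 : ∀ i ∈ Finset.Icc 2 (n + 1), 1 ≤ d i) (hd : MonotoneOn d (Set.Icc 2 (n + 1)))
    (he1 : ∀ i ∈ Finset.Icc 2 n, 1 ≤ e i) (he : MonotoneOn e (Set.Icc 2 n)) :
    ∀ i ∈ Finset.Icc 2 n, d i ≤ e i := by
  intro i hi
  obtain ⟨hi2, hin⟩ := Finset.mem_Icc.1 hi
  obtain ⟨n, rfl⟩ : ∃ k, n = k + 1 := ⟨n - 1, by omega⟩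
  obtain ⟨b, bH, β, α, γ, r, -, hdel, hres, -, hr⟩ := A.exists_coordinates H hH hn
  let _ : Fintype ↥(A.carrier \ {H}) := A.finite.sdiff.fintype
  let _ : Fintype (A.restriction H hH).carrier := (A.restriction H hH).finite.fintype
  rcases isEmpty_or_nonempty ↥(A.carrier \ {H}) with hemp | hne
  · have h1 := hdel.charPoly₀_eval_pos (by omega)
      (hd1 2 (Finset.mem_Icc.2 ⟨le_rfl, by omega⟩))
    rw [hd0, Polynomial.eval_prod, Finset.prod_eq_zero (i := 2)
      (Finset.mem_Icc.2 ⟨le_rfl, by omega⟩) (by simp)] at h1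
    exact absurd h1 (lt_irrefl _)
  obtain ⟨Θ, m, hΘ, hm⟩ := hdel.exists_monotone_isLogBasis b hA
  obtain ⟨Φ, k, hΦ, hk⟩ := hres.exists_monotone_isLogBasis bH hAH
  have hneH : Nonempty (A.restriction H hH).carrier := hne.map r
  obtain ⟨-, hmd⟩ := hdel.exponents_eq b hΘ hm hd1 hd hd0
  obtain ⟨-, hke⟩ := hres.exponents_eq bH hΦ hk he1 he he0
  have h2 := hr.deletion_le hΘ hm hΦ hk (Fin.succ ⟨i - 2, by omega⟩)
  rw [← Fin.succ_castSucc] at h2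
  have h3 := hmd (Fin.castSucc ⟨i - 2, by omega⟩)
  have h4 := hke ⟨i - 2, by omega⟩
  have h5 : i - 2 + 2 = i := by omega
  simp only [Fin.val_castSucc, h5] at h3 h4
  rw [← h3, ← h4]
  exact_mod_cast h2

theorem exists_finrank_eq_succ {A : HypArr K V} {H : Submodule K V} (hH : H ∈ A.carrier) :
    ∃ n, Module.finrank K V = n + 1 := by
  obtain ⟨β, hβ, -⟩ := A.hyperplane H hH
  exact ⟨_, (Module.Dual.finrank_ker_add_one_of_ne_zero hβ).symm⟩

end Exponents

end HypArr
end

theorem proposition5p1 {K : Type*} [Field K] (ℓ : ℕ) (A : HypArr K (Fin ℓ → K))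
    (H : Submodule K (Fin ℓ → K)) (hH : H ∈ A.carrier) :
    (∀ d e : ℕ → ℤ,
      A.IsFree → A.charPoly₀ = ∏ i ∈ Finset.Icc 2 ℓ, (Polynomial.X - Polynomial.C (d i)) →
      (A.restriction H hH).IsFree →
      (A.restriction H hH).charPoly₀ =
        ∏ i ∈ Finset.Icc 2 (ℓ - 1), (Polynomial.X - Polynomial.C (e i)) →
      (∀ i ∈ Finset.Icc 2 ℓ, 1 ≤ d i) → MonotoneOn d (Set.Icc 2 ℓ) →
      (∀ i ∈ Finset.Icc 2 (ℓ - 1), 1 ≤ e i) → MonotoneOn e (Set.Icc 2 (ℓ - 1)) →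
      (A.restriction H hH).charPoly ∣ A.charPoly ∨
        (e 2 ≤ d 2 ∧ ∀ i ∈ Finset.Icc 3 ℓ, e (i - 1) ≤ d i)) ∧
    (∀ d e : ℕ → ℤ,
      (A.deletion H).IsFree →
      (A.deletion H).charPoly₀ = ∏ i ∈ Finset.Icc 2 ℓ, (Polynomial.X - Polynomial.C (d i)) →
      (A.restriction H hH).IsFree →
      (A.restriction H hH).charPoly₀ =
        ∏ i ∈ Finset.Icc 2 (ℓ - 1), (Polynomial.X - Polynomial.C (e i)) →
      (∀ i ∈ Finset.Icc 2 ℓ, 1 ≤ d i) → MonotoneOn d (Set.Icc 2 ℓ) →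
      (∀ i ∈ Finset.Icc 2 (ℓ - 1), 1 ≤ e i) → MonotoneOn e (Set.Icc 2 (ℓ - 1)) →
      ∀ i ∈ Finset.Icc 2 (ℓ - 1), d i ≤ e i) := by
  obtain ⟨n, hn⟩ := HypArr.exists_finrank_eq_succ hH
  obtain rfl : ℓ = n + 1 := by rwa [Module.finrank_fin_fun] at hn
  exact ⟨fun _ _ hA hd0 hAH he0 hd1 hd he1 he =>
      HypArr.charPoly_dvd_or_le hA hAH hn hd0 he0 hd1 hd he1 he,
    fun _ _ hA hd0 hAH he0 hd1 hd he1 he =>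
      HypArr.deletion_exponent_le hA hAH hn hd0 he0 hd1 hd he1 he⟩
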